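/- All graphs are finite, simple and undirected. A graph $G=(V,E)$ is $2$-degenerate if its vertices can be ordered as $v_1,\dots,v_n$ such that each $v_i$ has at most two neighbours among $v_{i+1},\dots,v_n$. A set $S\subseteq V$ is a connected dominating set (CDS) if every vertex lies in $S$ or has a neighbour in $S$, and $G[S]$ is connected (in particular $S\neq\emptyset$); it is a minimal CDS if no proper subset of it is a CDS. (1) There are an algorithm (a program for a random access machine that stores only numbers of size polynomial in $n$), a constant $C$ and a polynomial $p$ such that, given the adjacency matrix of any $2$-degenerate graph $G$ of order $n$, the algorithm outputs every minimal CDS of $G$ exactly once and nothing else, halts after at most $C\cdot 1.9767^n$ steps, and uses at most $p(n)$ memory cells in each of its (finitely many) arrays, the output not being counted. (2) The number $1.9767$ is attained by branching with the following measure for $\alpha=\delta=0.106$. An instance $\mathcal I=(V';O_d,O_n;S)$ is a partition of $V$ into undecided vertices $V'$, solution vertices $S$, and discarded vertices $O_d$ (with a neighbour in $S$) and $O_n$ (without one); its measure is $\mu(\mathcal I)=|V'|+\alpha|O_n|+\delta c$, where $c$ is the number of connected components of $G[S]$. A set $M$ is compatible with $\mathcal I$ if $S\subseteq M\subseteq S\cup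 V'$. The branching number of a vector $(r_1,\dots,r_k)$ of positive reals is the positive root $x$ of $\sum_i x^{-r_i}=1$. The branching vectors $$(1,1+\alpha),\ (1,1+\delta),\ (1,2,2+\alpha),\ (1,2,2+\delta),\ (2-\delta,3-\delta-\alpha,2-\delta,3-\delta),\ (1+\alpha-\delta,2-\delta),$$ $$(1,4-2\alpha,2),\ (1,2,3,4-\alpha),\ (1,2,3,4-\alpha,5-\delta-\alpha),\ (1,2,3,5-2\alpha,5-2\alpha)$$ all have a branching number smaller than $1.9767$. For every $2$-degenerate graph $G$, every instance with $|S|=1$ has a finite search tree in which every child of a node decides at least one further vertex and keeps all earlier decisions, every minimal CDS compatible with an inner node is compatible with one of its children, and every inner node either has a single child, whose measure is not larger, or has children $\mathcal I_1,\dots,\mathcal I_k$ with $\mu(\mathcal I_i)\le\mu(\mathcal I)-r_i$ for one of the vectors $(r_1,\dots,r_k)$ above; at each leaf all vertices are decided or no minimal CDS is compatible with it. (3) Consequently, there is a constant $C'$ such that every $2$-degenerate graph of order $n$ has at most $C'\cdot 1.9767^n$ minimal CDS. -/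

import Mathlib

universe u

namespace CDSEnum

/-! ## Graphs -/

/-- `G` is `d`-degenerate: there is an elimination ordering `e 0, e 1, …` of the vertices such
that every `e i` has at most `d` neighbours among the vertices that are not earlier than it. -/
def IsDegenerate {V : Type u} [Fintype V] (G : SimpleGraph V) (d : ℕ) : Prop :=
  ∃ e : Fin (Fintype.card V) ≃ V,
    ∀ i, {j | i ≤ j ∧ G.Adj (e i) (e j)}.ncard ≤ d

/-- `S` is a connected dominating set of `G`: every vertex lies in `S` or has a neighbour in `S`,
and the induced graph `G[S]` is connected (in particular, `S` is not empty). -/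
def IsCDS {V : Type u} (G : SimpleGraph V) (S : Finset V) : Prop :=
  (∀ v, v ∈ S ∨ ∃ w ∈ S, G.Adj v w) ∧ (G.induce (S : Set V)).Connected

/-- `S` is an inclusion-wise minimal connected dominating set of `G`. -/
def IsMinimalCDS {V : Type u} (G : SimpleGraph V) (S : Finset V) : Prop :=
  Minimal (IsCDS G) S

/-! ## The machine model

A random access machine, programmed in a structured language.  A program uses finitely many
registers and finitely many arrays, all holding natural numbers, and a write-only output tape. -/

/-- Expressions: constants, registers, array reads, arithmetic and comparisons. -/
inductive Expr : Type
  | num (k : ℕ)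
  | var (x : ℕ)
  | get (a : ℕ) (i : Expr)
  | add (e f : Expr)
  | sub (e f : Expr)
  | mul (e f : Expr)
  | lt (e f : Expr)
  | eq (e f : Expr)

/-- Programs: assignment to a register, assignment to an array cell, output of a number,
sequential composition, conditional, and while loop (any non-zero value counts as true). -/
inductive Prog : Type
  | skip
  | assign (x : ℕ) (e : Expr)
  | put (a : ℕ) (i e : Expr)
  | write (e : Expr)
  | seq (p q : Prog)
  | ite (e : Expr) (p q : Prog)
  | loop (e : Expr) (p : Prog)

/-- Contents of the registers, of the arrays and of the output tape. -/
structure Store : Type where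
  vars : ℕ → ℕ
  arr : ℕ → ℕ → ℕ
  out : List ℕ

/-- The value of an expression; subtraction is truncated, comparisons yield `0` or `1`. -/
def Expr.eval (σ : Store) : Expr → ℕ
  | .num k => k
  | .var x => σ.vars x
  | .get a i => σ.arr a (i.eval σ)
  | .add e f => e.eval σ + f.eval σ
  | .sub e f => e.eval σ - f.eval σ
  | .mul e f => e.eval σ * f.eval σ
  | .lt e f => if e.eval σ < f.eval σ then 1 else 0
  | .eq e f => if e.eval σ = f.eval σ then 1 else 0

/-- The number of operations needed to evaluate an expression. -/
def Expr.cost : Expr → ℕ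
  | .num _ => 1
  | .var _ => 1
  | .get _ i => i.cost + 1
  | .add e f => e.cost + f.cost + 1
  | .sub e f => e.cost + f.cost + 1
  | .mul e f => e.cost + f.cost + 1
  | .lt e f => e.cost + f.cost + 1
  | .eq e f => e.cost + f.cost + 1

def Store.setVar (σ : Store) (x v : ℕ) : Store :=
  { σ with vars := Function.update σ.vars x v }

def Store.setArr (σ : Store) (a i v : ℕ) : Store :=
  { σ with arr := Function.update σ.arr a (Function.update (σ.arr a) i v) }

def Store.emit (σ : Store) (v : ℕ) : Store :=
  { σ with out := σ.out ++ [v] }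

/-- `Exec s p σ σ' t`: program `p`, started on `σ`, halts with `σ'` after exactly `t` steps, and it
does so in a memory of size `s`: every number that is stored is smaller than `s`, and only cells
with an index smaller than `s` are written.  As a program has finitely many registers and arrays,
it then occupies `O(s log s)` bits, in words of `O(log s)` bits; the output tape is not counted.
A run that would exceed this memory has no derivation. -/
inductive Exec (s : ℕ) : Prog → Store → Store → ℕ → Prop
  | skip (σ : Store) : Exec s .skip σ σ 1
  | assign (x : ℕ) (e : Expr) (σ : Store) (hv : e.eval σ < s) :
      Exec s (.assign x e) σ (σ.setVar x (e.eval σ)) (e.cost + 1)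
  | put (a : ℕ) (i e : Expr) (σ : Store) (hi : i.eval σ < s) (hv : e.eval σ < s) :
      Exec s (.put a i e) σ (σ.setArr a (i.eval σ) (e.eval σ)) (i.cost + e.cost + 1)
  | write (e : Expr) (σ : Store) (hv : e.eval σ < s) :
      Exec s (.write e) σ (σ.emit (e.eval σ)) (e.cost + 1)
  | seq {p q : Prog} {σ σ₁ σ₂ : Store} {t₁ t₂ : ℕ} (hp : Exec s p σ σ₁ t₁)
      (hq : Exec s q σ₁ σ₂ t₂) : Exec s (.seq p q) σ σ₂ (t₁ + t₂)
  | ite_true {e : Expr} {p q : Prog} {σ σ₁ : Store} {t : ℕ} (he : e.eval σ ≠ 0)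
      (hp : Exec s p σ σ₁ t) : Exec s (.ite e p q) σ σ₁ (e.cost + 1 + t)
  | ite_false {e : Expr} {p q : Prog} {σ σ₁ : Store} {t : ℕ} (he : e.eval σ = 0)
      (hq : Exec s q σ σ₁ t) : Exec s (.ite e p q) σ σ₁ (e.cost + 1 + t)
  | loop_done {e : Expr} {p : Prog} {σ : Store} (he : e.eval σ = 0) :
      Exec s (.loop e p) σ σ (e.cost + 1)
  | loop_step {e : Expr} {p : Prog} {σ σ₁ σ₂ : Store} {t₁ t₂ : ℕ} (he : e.eval σ ≠ 0)
      (hp : Exec s p σ σ₁ t₁) (hl : Exec s (.loop e p) σ₁ σ₂ t₂) :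
      Exec s (.loop e p) σ σ₂ (e.cost + 1 + t₁ + t₂)

open Classical in
/-- The input: register `0` holds the order `n`, array `0` holds the adjacency matrix row by row;
everything else is zero, and the output tape is empty. -/
noncomputable def inputStore {n : ℕ} (G : SimpleGraph (Fin n)) : Store where
  vars x := if x = 0 then n else 0
  arr a k := if a = 0 ∧ ∃ i j : Fin n, k = (i : ℕ) * n + j ∧ G.Adj i j then 1 else 0
  out := []

/-- A vertex set on the output tape: its characteristic vector, followed by the separator `2`. -/
def encodeSet {n : ℕ} (S : Finset (Fin n)) : List ℕ :=
  (List.ofFn fun i : Fin n => if i ∈ S then 1 else 0) ++ [2]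

/-- On input `G`, the program `P` halts within `T` steps in a memory of size `s`, and it outputs
every minimal connected dominating set of `G` exactly once, in some order, and nothing else. -/
def EnumeratesWithin (P : Prog) {n : ℕ} (G : SimpleGraph (Fin n)) (s : ℕ) (T : ℝ) : Prop :=
  ∃ (σ : Store) (t : ℕ) (L : List (Finset (Fin n))),
    Exec s P (inputStore G) σ t ∧ (t : ℝ) ≤ T ∧
    L.Nodup ∧ (∀ S, S ∈ L ↔ IsMinimalCDS G S) ∧ σ.out = L.flatMap encodeSet

/-! ## Branching with a measure -/

/-- An instance `(V'; O_d, O_n; S)` of the branching: `free` is the set `V'` of undecided vertices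
and `sol` the set `S` of vertices put into the solution.  All other vertices are discarded; which of
them lie in `O_d` and which in `O_n` is determined by `S`. -/
structure BranchInstance (V : Type u) where
  free : Finset V
  sol : Finset V
  disj : Disjoint free sol

namespace BranchInstance

variable {V : Type u} [Fintype V] [DecidableEq V]

open Classical in
/-- `O_n`: the discarded vertices without a neighbour in `S`. -/
noncomputable def discardedUndominated (G : SimpleGraph V) (I : BranchInstance V) : Finset V :=
  Finset.univ.filter fun v => v ∉ I.free ∧ v ∉ I.sol ∧ ∀ w ∈ I.sol, ¬ G.Adj v w

/-- The measure `|V'| + α |O_n| + δ c`, where `c` is the number of components of `G[S]`. -/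
noncomputable def measure (G : SimpleGraph V) (α δ : ℝ) (I : BranchInstance V) : ℝ :=
  (I.free.card : ℝ) + α * ((I.discardedUndominated G).card : ℝ)
    + δ * (Nat.card (G.induce (I.sol : Set V)).ConnectedComponent : ℝ)

/-- `M` agrees with the decisions made in `I`. -/
def Compatible (I : BranchInstance V) (M : Finset V) : Prop :=
  I.sol ⊆ M ∧ M ⊆ I.sol ∪ I.free

/-- `J` arises from `I` by deciding at least one more vertex. -/
def Refines (J I : BranchInstance V) : Prop :=
  J.free ⊂ I.free ∧ I.sol ⊆ J.sol ∧ J.sol ⊆ I.sol ∪ I.free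

/-- The instances `Js` form a complete case distinction for the instance `I`. -/
def Covers (G : SimpleGraph V) (Js : List (BranchInstance V)) (I : BranchInstance V) : Prop :=
  (∀ J ∈ Js, J.Refines I) ∧
    ∀ M, IsMinimalCDS G M → I.Compatible M → ∃ J ∈ Js, J.Compatible M

end BranchInstance

/-- The branching vectors. -/
noncomputable def branchingVectors (α δ : ℝ) : List (List ℝ) :=
  [[1, 1 + α],
   [1, 1 + δ],
   [1, 2, 2 + α],
   [1, 2, 2 + δ],
   [2 - δ, 3 - δ - α, 2 - δ, 3 - δ],
   [1 + α - δ, 2 - δ],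
   [1, 4 - 2 * α, 2],
   [1, 2, 3, 4 - α],
   [1, 2, 3, 4 - α, 5 - δ - α],
   [1, 2, 3, 5 - 2 * α, 5 - 2 * α]]

/-- `x` is the branching number of the vector `r = (r₁, …, r_k)` of positive reals: the positive
solution of `x ^ (-r₁) + ⋯ + x ^ (-r_k) = 1`. -/
def IsBranchingNumber (r : List ℝ) (x : ℝ) : Prop :=
  0 < x ∧ (r.map fun a => x ^ (-a)).sum = 1

/-- `HasSearchTree G α δ I`: the instance `I` is completely resolved by a finite search tree in
which every inner node is a reduction to one instance that does not increase the measure, or a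
complete case distinction whose decrease of the measure is not worse than one of the branching
vectors; at a leaf, all vertices are decided or no minimal connected dominating set is left. -/
inductive HasSearchTree {V : Type u} [Fintype V] [DecidableEq V] (G : SimpleGraph V) (α δ : ℝ) :
    BranchInstance V → Prop
  | leaf (I : BranchInstance V) (h : I.free = ∅) : HasSearchTree G α δ I
  | discard (I : BranchInstance V) (h : ∀ M, IsMinimalCDS G M → ¬ I.Compatible M) :
      HasSearchTree G α δ I
  | reduce (I J : BranchInstance V) (hc : BranchInstance.Covers G [J] I)
      (hm : J.measure G α δ ≤ I.measure G α δ) (hJ : HasSearchTree G α δ J) :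
      HasSearchTree G α δ I
  | branch (I : BranchInstance V) (Js : List (BranchInstance V)) (r : List ℝ)
      (hr : r ∈ branchingVectors α δ) (hc : BranchInstance.Covers G Js I)
      (hm : List.Forall₂ (fun J a => J.measure G α δ ≤ I.measure G α δ - a) Js r)
      (hJs : ∀ J ∈ Js, HasSearchTree G α δ J) : HasSearchTree G α δ I

end CDSEnum

/-!
The enumeration is a measure-and-conquer branching. A state of the search marks every vertex as
undecided, chosen or discarded; a state that has a chosen vertex and accepts a minimal CDS has an
applicable rule. The rules rest on two facts. First, the undecided vertices of a `2`-degenerate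
graph have a vertex with at most two undecided neighbours. Second, if a chosen vertex can be removed
from a CDS without disconnecting it, then minimality yields a private neighbour, that is, a vertex
which is not dominated without it; once the undecided neighbours of a vertex are few enough, this
determines the decisions about them.

Every rule is an exact case distinction: a set that is accepted by the state and is a minimal CDS is
accepted by exactly one of the branches. Hence the leaves of the search tree list the minimal CDS
without repetition, and no list of earlier outputs has to be kept. The branching numbers stay below
`1.97669`, and the gap to `1.9767` absorbs polynomial factors.

For the machine, the condition of every rule is a first-order formula over the graph, the statuses
and the relation of being connected inside the chosen, or the not discarded, vertices. Such formulas
are evaluated by nested loops, after the connections have been computed by the Floyd–Warshall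
algorithm. The states that are still to be processed lie on a stack of height at most `5 * n`, and a
potential that is exponential in the measure bounds the number of states processed.
-/

namespace CDSEnum

/-! ## Connectivity inside a vertex set -/

section Linked

variable {V : Type u} {G : SimpleGraph V}

/-- `u` and `v` lie in the same component of the subgraph of `G` induced by `T`; in particular, both
belong to `T`. -/
def Linked (G : SimpleGraph V) (T : Set V) (u v : V) : Prop :=
  ∃ (hu : u ∈ T) (hv : v ∈ T), (G.induce T).Reachable ⟨u, hu⟩ ⟨v, hv⟩

theorem Linked.refl {T : Set V} {u : V} (hu : u ∈ T) : Linked G T u u := ⟨hu, hu, .refl _⟩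

theorem Linked.symm {T : Set V} {u v : V} (h : Linked G T u v) : Linked G T v u :=
  ⟨h.2.1, h.1, h.2.2.symm⟩

theorem Linked.trans {T : Set V} {u v w : V} (h : Linked G T u v) (h' : Linked G T v w) :
    Linked G T u w :=
  ⟨h.1, h'.2.1, h.2.2.trans h'.2.2⟩

theorem Linked.of_adj {T : Set V} {u v : V} (hu : u ∈ T) (hv : v ∈ T) (h : G.Adj u v) :
    Linked G T u v :=
  ⟨hu, hv, SimpleGraph.Adj.reachable (G := G.induce T) (u := ⟨u, hu⟩) (v := ⟨v, hv⟩) h⟩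

theorem Linked.induction {T : Set V} {u : V} {P : V → Prop} (base : P u)
    (step : ∀ a b, a ∈ T → b ∈ T → G.Adj a b → P a → P b) {v : V} (h : Linked G T u v) : P v := by
  obtain ⟨hu, hv, h⟩ := h
  rw [SimpleGraph.reachable_iff_reflTransGen] at h
  have hP : ∀ w : T, Relation.ReflTransGen (G.induce T).Adj ⟨u, hu⟩ w → P w := by
    intro w hw
    induction hw with
    | refl => exact base
    | @tail b c _ hbc ih => exact step b c b.2 c.2 hbc ih
  exact hP ⟨v, hv⟩ h

theorem Linked.mono {T T' : Set V} (hT : T ⊆ T') {u v : V} (h : Linked G T u v) :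
    Linked G T' u v :=
  h.induction (.refl (hT h.1)) fun _ _ ha hb hab hP => hP.trans (.of_adj (hT ha) (hT hb) hab)

theorem connected_induce_iff {T : Set V} :
    (G.induce T).Connected ↔ T.Nonempty ∧ ∀ u ∈ T, ∀ v ∈ T, Linked G T u v := by
  constructor
  · intro h
    obtain ⟨⟨w, hw⟩⟩ := h.nonempty
    exact ⟨⟨w, hw⟩, fun u hu v hv => ⟨hu, hv, h.preconnected _ _⟩⟩
  · rintro ⟨⟨w, hw⟩, h⟩
    have : Nonempty T := ⟨⟨w, hw⟩⟩
    exact ⟨fun u v => (h u u.2 v v.2).2.2⟩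

end Linked

section Components

variable {V : Type u} {G : SimpleGraph V}

/-- The map between the components of two induced subgraphs that comes from an inclusion of their
vertex sets. -/
def componentMap (G : SimpleGraph V) {T T' : Set V} (h : T ⊆ T') :
    (G.induce T).ConnectedComponent → (G.induce T').ConnectedComponent :=
  SimpleGraph.ConnectedComponent.map (SimpleGraph.induceHomOfLE G h).toHom

theorem card_component_insert_le_add_one [Finite V] (T : Set V) (x : V) :
    Nat.card (G.induce (insert x T)).ConnectedComponent ≤
      Nat.card (G.induce T).ConnectedComponent + 1 := by
  rw [← Finite.card_option]
  refine Nat.card_le_card_of_surjective (fun o : Option _ => o.elim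
    ((G.induce (insert x T)).connectedComponentMk ⟨x, Set.mem_insert x T⟩)
    (componentMap G (Set.subset_insert x T))) fun c => ?_
  induction c using SimpleGraph.ConnectedComponent.ind with
  | h v =>
    obtain ⟨v, rfl | hv⟩ := v
    · exact ⟨none, rfl⟩
    · exact ⟨some ((G.induce T).connectedComponentMk ⟨v, hv⟩), rfl⟩

theorem componentMap_insert_surjective {T : Set V} {x s : V} (hs : s ∈ T) (h : G.Adj x s) :
    Function.Surjective (componentMap G (Set.subset_insert x T)) := by
  intro c
  induction c using SimpleGraph.ConnectedComponent.ind with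
  | h v =>
    obtain ⟨v, rfl | hv⟩ := v
    · exact ⟨(G.induce T).connectedComponentMk ⟨s, hs⟩, SimpleGraph.ConnectedComponent.sound
        (Linked.of_adj (Set.mem_insert_of_mem _ hs) (Set.mem_insert _ _) h.symm).2.2⟩
    · exact ⟨(G.induce T).connectedComponentMk ⟨v, hv⟩, rfl⟩

theorem card_component_insert_le_of_adj [Finite V] {T : Set V} {x s : V} (hs : s ∈ T)
    (h : G.Adj x s) :
    Nat.card (G.induce (insert x T)).ConnectedComponent ≤
      Nat.card (G.induce T).ConnectedComponent :=
  Nat.card_le_card_of_surjective _ (componentMap_insert_surjective hs h)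

theorem card_component_insert_lt_of_not_linked [Finite V] {T : Set V} {x s t : V} (hs : s ∈ T)
    (ht : t ∈ T) (hxs : G.Adj x s) (hxt : G.Adj x t) (hst : ¬ Linked G T s t) :
    Nat.card (G.induce (insert x T)).ConnectedComponent <
      Nat.card (G.induce T).ConnectedComponent := by
  refine lt_of_le_of_ne (card_component_insert_le_of_adj hs hxs) fun hcard => hst ?_
  have hinj := ((Nat.bijective_iff_surjective_and_card _).2
    ⟨componentMap_insert_surjective hs hxs, hcard.symm⟩).1
  have hx := Set.mem_insert x T
  have hlinked : Linked G (insert x T) s t :=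
    (Linked.of_adj (Set.mem_insert_of_mem x hs) hx hxs.symm).trans
      (.of_adj hx (Set.mem_insert_of_mem x ht) hxt)
  exact ⟨hs, ht, SimpleGraph.ConnectedComponent.exact
    (hinj (SimpleGraph.ConnectedComponent.sound hlinked.2.2))⟩

end Components

/-! ## Connected dominating sets -/

section CDS

variable {V : Type u} {G : SimpleGraph V}

theorem isCDS_iff_linked {S : Finset V} : IsCDS G S ↔
    (∀ v, v ∈ S ∨ ∃ w ∈ S, G.Adj v w) ∧ S.Nonempty ∧ ∀ u ∈ S, ∀ v ∈ S, Linked G S u v := by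
  simp only [IsCDS, connected_induce_iff, Finset.mem_coe, Finset.coe_nonempty]

theorem IsCDS.mono {S T : Finset V} (hST : S ⊆ T) (h : IsCDS G S) : IsCDS G T := by
  rw [isCDS_iff_linked] at h ⊢
  obtain ⟨hdom, ⟨a, ha⟩, hl⟩ := h
  have hST' : (S : Set V) ⊆ T := Finset.coe_subset.2 hST
  have linked_a : ∀ u ∈ T, Linked G T u a := fun u hu => by
    rcases hdom u with h | ⟨w, hw, h⟩
    · exact (hl u h a ha).mono hST'
    · exact (Linked.of_adj hu (hST hw) h).trans ((hl w hw a ha).mono hST')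
  exact ⟨fun v => (hdom v).imp (@hST v) fun ⟨w, hw, h⟩ => ⟨w, hST hw, h⟩, ⟨a, hST ha⟩,
    fun u hu v hv => (linked_a u hu).trans (linked_a v hv).symm⟩

theorem isMinimalCDS_iff_erase [DecidableEq V] {S : Finset V} :
    IsMinimalCDS G S ↔ IsCDS G S ∧ ∀ x ∈ S, ¬ IsCDS G (S.erase x) := by
  constructor
  · refine fun h => ⟨h.prop, fun x hx hc => ?_⟩
    exact Finset.notMem_erase x S (h.le_of_le hc (Finset.erase_subset x S) hx)
  · rintro ⟨h, hx⟩
    refine ⟨h, fun T hT hTS x hxS => ?_⟩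
    by_contra hxT
    exact hx x hxS (hT.mono (Finset.subset_erase.2 ⟨hTS, hxT⟩))

theorem IsCDS.linked_erase [DecidableEq V] {M : Finset V} (hM : IsCDS G M) {x s : V} (hs : s ∈ M)
    (hc : ∀ u ∈ M, G.Adj x u → Linked G (M.erase x : Finset V) s u) {u : V}
    (hu : u ∈ M.erase x) : Linked G (M.erase x : Finset V) s u := by
  obtain ⟨-, -, hl⟩ := isCDS_iff_linked.1 hM
  have mem {v : V} (hv : v ∈ M) (hvx : v ≠ x) : v ∈ ((M.erase x : Finset V) : Set V) :=
    Finset.mem_coe.2 (Finset.mem_erase.2 ⟨hvx, hv⟩)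
  obtain ⟨hux, huM⟩ := Finset.mem_erase.1 hu
  refine (hl s hs u huM).induction
    (P := fun v => v ≠ x → Linked G (M.erase x : Finset V) s v) ?_ ?_ hux
  · exact fun hsx => .refl (mem hs hsx)
  · intro a b ha hb hab ih hbx
    by_cases hax : a = x
    · exact hc b hb (hax ▸ hab)
    · exact (ih hax).trans (.of_adj (mem ha hax) (mem hb hbx) hab)

theorem IsCDS.erase [DecidableEq V] {M : Finset V} (hM : IsCDS G M) {x s : V} (hs : s ∈ M)
    (hxs : G.Adj x s) (hc : ∀ u ∈ M, G.Adj x u → Linked G (M.erase x : Finset V) s u)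
    (hd : ∀ v ∉ M, G.Adj x v → ∃ w ∈ M, w ≠ x ∧ G.Adj v w) : IsCDS G (M.erase x) := by
  have hlinked := fun u => hM.linked_erase hs hc (u := u)
  rw [isCDS_iff_linked] at hM ⊢
  have hsx : s ∈ M.erase x := Finset.mem_erase.2 ⟨hxs.ne', hs⟩
  refine ⟨fun v => ?_, ⟨s, hsx⟩, fun u hu v hv => (hlinked u hu).symm.trans (hlinked v hv)⟩
  by_cases hvx : v = x
  · exact .inr ⟨s, hsx, hvx ▸ hxs⟩
  by_cases hv : v ∈ M
  · exact .inl (Finset.mem_erase.2 ⟨hvx, hv⟩)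
  right
  by_cases hxv : G.Adj x v
  · obtain ⟨w, hw, hwx, h⟩ := hd v hv hxv
    exact ⟨w, Finset.mem_erase.2 ⟨hwx, hw⟩, h⟩
  · obtain ⟨w, hw, h⟩ := (hM.1 v).resolve_left hv
    exact ⟨w, Finset.mem_erase.2 ⟨fun e => hxv (e ▸ h.symm), hw⟩, h⟩

theorem IsCDS.exists_adj {M : Finset V} (hM : IsCDS G M) {s : V} (hs : s ∈ M) {v : V}
    (hv : v ≠ s) : ∃ w ∈ M, G.Adj v w := by
  rw [isCDS_iff_linked] at hM
  rcases hM.1 v with h | h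
  · exact (hM.2.2 s hs v h).induction (P := fun v => v ≠ s → ∃ w ∈ M, G.Adj v w)
      (fun h => absurd rfl h) (fun a b ha _ hab _ _ => ⟨a, ha, hab.symm⟩) hv
  · exact h

end CDS

section Degenerate

variable {V : Type u} {G : SimpleGraph V}

theorem IsDegenerate.exists_ncard_neighbors_le [Fintype V] {d : ℕ} (hG : IsDegenerate G d)
    {W : Set V} (hW : W.Nonempty) : ∃ v ∈ W, {u ∈ W | G.Adj v u}.ncard ≤ d := by
  obtain ⟨e, he⟩ := hG
  obtain ⟨w, hw⟩ := hW
  obtain ⟨i, hi, hmin⟩ := WellFounded.has_min (wellFounded_lt (α := Fin (Fintype.card V)))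
    {i | e i ∈ W} ⟨e.symm w, by simpa using hw⟩
  refine ⟨e i, hi, le_trans ?_ (he i)⟩
  rw [← Set.ncard_image_of_injective _ e.injective]
  refine Set.ncard_le_ncard (fun u ⟨hu, hadj⟩ => ⟨e.symm u, ⟨?_, ?_⟩, e.apply_symm_apply u⟩)
  · exact not_lt.1 (hmin (e.symm u) (by simpa using hu))
  · simpa using hadj

theorem exists_subset_pair_of_ncard_le_two {α : Type*} [Finite α] [Nonempty α] {s : Set α}
    (hs : s.ncard ≤ 2) : ∃ a b, s ⊆ {a, b} := by
  obtain ⟨c⟩ := ‹Nonempty α›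
  rcases hs.eq_or_lt with h | h
  · obtain ⟨a, b, -, h⟩ := Set.ncard_eq_two.1 h
    exact ⟨a, b, h.le⟩
  · rcases (Set.ncard_le_one_iff_eq (Set.toFinite s)).1 (Nat.lt_succ_iff.1 h) with rfl | ⟨a, rfl⟩
    · exact ⟨c, c, Set.empty_subset _⟩
    · exact ⟨a, a, by simp⟩

theorem IsDegenerate.exists_neighbors_subset_pair [Fintype V] (hG : IsDegenerate G 2) {W : Set V}
    (hW : W.Nonempty) : ∃ v ∈ W, ∃ a b, ∀ u ∈ W, G.Adj v u → u = a ∨ u = b := by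
  have : Nonempty V := hW.to_type
  obtain ⟨v, hv, hcard⟩ := hG.exists_ncard_neighbors_le hW
  obtain ⟨a, b, hab⟩ := exists_subset_pair_of_ncard_le_two hcard
  exact ⟨v, hv, a, b, fun u hu hvu => hab ⟨hu, hvu⟩⟩

end Degenerate

/-! ## States of the search -/

/-- The decision made about a vertex: none yet, put into the solution, or discarded. -/
inductive Status : Type
  | undecided
  | chosen
  | discarded
  deriving DecidableEq

/-- A state of the search; it carries the same information as a `BranchInstance`. -/
abbrev State (V : Type u) := V → Status

/-- The state obtained by putting `x` into the solution. -/
abbrev State.choose {V : Type u} [DecidableEq V] (st : State V) (x : V) : State V :=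
  Function.update st x .chosen

/-- The state obtained by discarding `x`. -/
abbrev State.discard {V : Type u} [DecidableEq V] (st : State V) (x : V) : State V :=
  Function.update st x .discarded

section State

variable {V : Type u} {G : SimpleGraph V} {st : State V}

/-- `v` is dominated by the solution, in the sense of having a neighbour in it. -/
def HasChosenNbr (G : SimpleGraph V) (st : State V) (v : V) : Prop :=
  ∃ w, st w = .chosen ∧ G.Adj v w

/-- `v` is neither in the solution nor adjacent to it. -/
def Undominated (G : SimpleGraph V) (st : State V) (v : V) : Prop :=
  st v ≠ .chosen ∧ ¬ HasChosenNbr G st v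

/-- The solution vertices. -/
def chosenSet (st : State V) : Set V := {v | st v = .chosen}

open Classical in
/-- Discard all undecided neighbours of `y`. -/
noncomputable def discardNbrs (G : SimpleGraph V) (y : V) (st : State V) : State V :=
  fun u => if st u = .undecided ∧ G.Adj y u then .discarded else st u

theorem hasChosenNbr_congr {st' : State V} (h : chosenSet st = chosenSet st') {v : V} :
    HasChosenNbr G st v ↔ HasChosenNbr G st' v :=
  exists_congr fun w => and_congr_left fun _ => Set.ext_iff.1 h w

theorem chosenSet_discardNbrs {y : V} : chosenSet (discardNbrs G y st) = chosenSet st := by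
  ext v
  by_cases h : st v = .undecided ∧ G.Adj y v <;> simp [chosenSet, discardNbrs, h]

theorem HasChosenNbr.card_component_insert_le [Finite V] {x : V} (hx : HasChosenNbr G st x) :
    Nat.card (G.induce (insert x (chosenSet st))).ConnectedComponent ≤
      Nat.card (G.induce (chosenSet st)).ConnectedComponent := by
  obtain ⟨s, hs, hxs⟩ := hx
  exact card_component_insert_le_of_adj hs hxs

section Update

variable [DecidableEq V] {x : V}

theorem chosenSet_choose : chosenSet (st.choose x) = insert x (chosenSet st) := by
  ext v
  by_cases h : v = x <;> simp [chosenSet, h]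

theorem chosenSet_discard (hx : st x = .undecided) : chosenSet (st.discard x) = chosenSet st := by
  ext v
  by_cases h : v = x <;> simp [chosenSet, h, hx]

theorem HasChosenNbr.choose {v : V} (hv : HasChosenNbr G st v) :
    HasChosenNbr G (st.choose x) v := by
  obtain ⟨w, hw, h⟩ := hv
  refine ⟨w, ?_, h⟩
  by_cases hwx : w = x <;> simp [hwx, hw]

end Update

variable [Fintype V]

/-- The branching instance given by a state. -/
def State.toInstance (st : State V) : BranchInstance V where
  free := {v | st v = .undecided}
  sol := {v | st v = .chosen}
  disj := Finset.disjoint_filter.2 fun v _ h h' => by simp [h] at h'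

@[simp] theorem mem_free {v : V} : v ∈ st.toInstance.free ↔ st v = .undecided := by
  simp [State.toInstance]

@[simp] theorem mem_sol {v : V} : v ∈ st.toInstance.sol ↔ st v = .chosen := by
  simp [State.toInstance]

theorem coe_sol (st : State V) : (st.toInstance.sol : Set V) = chosenSet st := by
  ext v
  simp [chosenSet]

theorem card_free_discardNbrs {y : V} :
    (discardNbrs G y st).toInstance.free.card + {u | st u = .undecided ∧ G.Adj y u}.ncard =
      st.toInstance.free.card := by
  classical
  have hN : {u | st u = .undecided ∧ G.Adj y u} = st.toInstance.free.filter (G.Adj y) := by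
    ext u; simp
  have hfree : (discardNbrs G y st).toInstance.free =
      st.toInstance.free \ st.toInstance.free.filter (G.Adj y) := by
    ext u
    by_cases h : st u = .undecided <;> by_cases h' : G.Adj y u <;> simp [discardNbrs, h, h']
  rw [hN, Set.ncard_coe_finset, hfree,
    Finset.card_sdiff_add_card_eq_card (Finset.filter_subset _ _)]

variable [DecidableEq V]

@[simp] theorem mem_discardedUndominated {v : V} :
    v ∈ st.toInstance.discardedUndominated G ↔
      st v = .discarded ∧ ¬ HasChosenNbr G st v := by
  cases h : st v <;> simp [BranchInstance.discardedUndominated, HasChosenNbr, h]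

end State

section Measure

variable {V : Type u} [Fintype V] [DecidableEq V] {G : SimpleGraph V} {α δ : ℝ} {st : State V}
  {x : V}

/-- The measure of a state. -/
noncomputable def mu (G : SimpleGraph V) (α δ : ℝ) (st : State V) : ℝ :=
  st.toInstance.measure G α δ

theorem mu_eq : mu G α δ st = (st.toInstance.free.card : ℝ)
    + α * ((st.toInstance.discardedUndominated G).card : ℝ)
    + δ * (Nat.card (G.induce (chosenSet st)).ConnectedComponent : ℝ) := by
  rw [mu, BranchInstance.measure, coe_sol]

theorem mu_nonneg (hα : 0 ≤ α) (hδ : 0 ≤ δ) : 0 ≤ mu G α δ st := by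
  rw [mu_eq]; positivity

theorem card_free_update (hx : st x = .undecided) {s : Status} (hs : s ≠ .undecided) :
    (State.toInstance (Function.update st x s)).free.card + 1 = st.toInstance.free.card := by
  have hfree : (State.toInstance (Function.update st x s)).free = st.toInstance.free.erase x := by
    ext v
    by_cases h : v = x <;> simp [h, hs]
  rw [hfree, Finset.card_erase_add_one (by simpa using hx)]

theorem discardedUndominated_choose_subset :
    (st.choose x).toInstance.discardedUndominated G ⊆ st.toInstance.discardedUndominated G := by
  intro v hv
  rw [mem_discardedUndominated] at hv ⊢
  have hvx : v ≠ x := by rintro rfl; simp at hv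
  rw [State.choose, Function.update_of_ne hvx] at hv
  exact ⟨hv.1, fun h => hv.2 h.choose⟩

theorem card_discardedUndominated_choose_le :
    ((st.choose x).toInstance.discardedUndominated G).card ≤
      (st.toInstance.discardedUndominated G).card :=
  Finset.card_le_card discardedUndominated_choose_subset

theorem card_discardedUndominated_choose_lt {v : V} (hv : st v = .discarded)
    (hd : ¬ HasChosenNbr G st v) (hxv : G.Adj x v) :
    ((st.choose x).toInstance.discardedUndominated G).card <
      (st.toInstance.discardedUndominated G).card := by
  refine Finset.card_lt_card ((Finset.ssubset_iff_of_subset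
    discardedUndominated_choose_subset).2 ⟨v, ?_, fun h => ?_⟩)
  · exact mem_discardedUndominated.2 ⟨hv, hd⟩
  · exact (mem_discardedUndominated.1 h).2 ⟨x, by simp, hxv.symm⟩

theorem mu_choose_le_sub (hα : 0 ≤ α) (hδ : 0 ≤ δ) (hx : st x = .undecided) {a c : ℤ}
    (ha : (((st.choose x).toInstance.discardedUndominated G).card : ℤ) + a ≤
      (st.toInstance.discardedUndominated G).card)
    (hc : (Nat.card (G.induce (insert x (chosenSet st))).ConnectedComponent : ℤ) + c ≤
      Nat.card (G.induce (chosenSet st)).ConnectedComponent) :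
    mu G α δ (st.choose x) ≤ mu G α δ st - (1 + α * a + δ * c) := by
  have hfree : ((st.choose x).toInstance.free.card : ℝ) + 1 = st.toInstance.free.card := by
    exact_mod_cast card_free_update hx (by simp)
  have ha' := mul_le_mul_of_nonneg_left (Int.cast_le (R := ℝ).2 ha) hα
  have hc' := mul_le_mul_of_nonneg_left (Int.cast_le (R := ℝ).2 hc) hδ
  push_cast at ha' hc'
  rw [mu_eq, mu_eq, chosenSet_choose]
  linarith

theorem mu_choose_le (hα : 0 ≤ α) (hδ : 0 ≤ δ) (hx : st x = .undecided) :
    mu G α δ (st.choose x) ≤ mu G α δ st - (1 - δ) := by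
  have hcard := card_discardedUndominated_choose_le (G := G) (st := st) (x := x)
  have hcomp := card_component_insert_le_add_one (G := G) (chosenSet st) x
  have hmu := mu_choose_le_sub (G := G) (a := 0) (c := -1) hα hδ hx (by lia) (by lia)
  push_cast at hmu
  linarith

theorem mu_choose_le_of_undominated_nbr (hα : 0 ≤ α) (hδ : 0 ≤ δ) {v : V} (hx : st x = .undecided)
    (hv : st v = .discarded) (hd : ¬ HasChosenNbr G st v) (hxv : G.Adj x v) :
    mu G α δ (st.choose x) ≤ mu G α δ st - (1 + α - δ) := by
  have hcard := card_discardedUndominated_choose_lt hv hd hxv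
  have hcomp := card_component_insert_le_add_one (G := G) (chosenSet st) x
  have hmu := mu_choose_le_sub (G := G) (a := 1) (c := -1) hα hδ hx (by lia) (by lia)
  push_cast at hmu
  linarith

theorem mu_choose_le_of_dominated (hα : 0 ≤ α) (hδ : 0 ≤ δ) (hx : st x = .undecided)
    (hdx : HasChosenNbr G st x) : mu G α δ (st.choose x) ≤ mu G α δ st - 1 := by
  have hcard := card_discardedUndominated_choose_le (G := G) (st := st) (x := x)
  have hcomp := hdx.card_component_insert_le
  have hmu := mu_choose_le_sub (G := G) (a := 0) (c := 0) hα hδ hx (by lia) (by lia)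
  push_cast at hmu
  linarith

theorem mu_choose_le_of_dominated_of_undominated_nbr (hα : 0 ≤ α) (hδ : 0 ≤ δ) {v : V}
    (hx : st x = .undecided) (hdx : HasChosenNbr G st x) (hv : st v = .discarded)
    (hd : ¬ HasChosenNbr G st v) (hxv : G.Adj x v) :
    mu G α δ (st.choose x) ≤ mu G α δ st - (1 + α) := by
  have hcard := card_discardedUndominated_choose_lt hv hd hxv
  have hcomp := hdx.card_component_insert_le
  have hmu := mu_choose_le_sub (G := G) (a := 1) (c := 0) hα hδ hx (by lia) (by lia)
  push_cast at hmu
  linarith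

theorem mu_choose_le_of_not_linked (hα : 0 ≤ α) (hδ : 0 ≤ δ) {s t : V} (hx : st x = .undecided)
    (hs : st s = .chosen) (ht : st t = .chosen) (hxs : G.Adj x s) (hxt : G.Adj x t)
    (hst : ¬ Linked G (chosenSet st) s t) :
    mu G α δ (st.choose x) ≤ mu G α δ st - (1 + δ) := by
  have hcard := card_discardedUndominated_choose_le (G := G) (st := st) (x := x)
  have hcomp := card_component_insert_lt_of_not_linked (T := chosenSet st) hs ht hxs hxt hst
  have hmu := mu_choose_le_sub (G := G) (a := 0) (c := 1) hα hδ hx (by lia) (by lia)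
  push_cast at hmu
  linarith

theorem mu_discard_le (hα : 0 ≤ α) (hx : st x = .undecided) :
    mu G α δ (st.discard x) ≤ mu G α δ st - (1 - α) := by
  have hfree : ((st.discard x).toInstance.free.card : ℝ) + 1 = st.toInstance.free.card := by
    exact_mod_cast card_free_update hx (by simp)
  have hsub : (st.discard x).toInstance.discardedUndominated G ⊆
      insert x (st.toInstance.discardedUndominated G) := fun v hv => by
    rw [mem_discardedUndominated, hasChosenNbr_congr (chosenSet_discard hx)] at hv
    by_cases hvx : v = x <;> simp_all
  have hcard : (((st.discard x).toInstance.discardedUndominated G).card : ℝ) ≤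
      (st.toInstance.discardedUndominated G).card + 1 := by
    exact_mod_cast (Finset.card_le_card hsub).trans (Finset.card_insert_le _ _)
  rw [mu_eq, mu_eq, chosenSet_discard hx]
  linarith [mul_le_mul_of_nonneg_left hcard hα]

theorem mu_discard_le_of_dominated (hα : 0 ≤ α) (hx : st x = .undecided)
    (hdx : HasChosenNbr G st x) : mu G α δ (st.discard x) ≤ mu G α δ st - 1 := by
  have hfree : ((st.discard x).toInstance.free.card : ℝ) + 1 = st.toInstance.free.card := by
    exact_mod_cast card_free_update hx (by simp)
  have hsub : (st.discard x).toInstance.discardedUndominated G ⊆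
      st.toInstance.discardedUndominated G := fun v hv => by
    rw [mem_discardedUndominated, hasChosenNbr_congr (chosenSet_discard hx)] at hv
    by_cases hvx : v = x <;> simp_all
  have hcard : (((st.discard x).toInstance.discardedUndominated G).card : ℝ) ≤
      (st.toInstance.discardedUndominated G).card := by
    exact_mod_cast Finset.card_le_card hsub
  rw [mu_eq, mu_eq, chosenSet_discard hx]
  linarith [mul_le_mul_of_nonneg_left hcard hα]

theorem mu_update_le_of_dominated (hα : 0 ≤ α) (hδ : 0 ≤ δ) (hx : st x = .undecided)
    (hdx : HasChosenNbr G st x) {s : Status} (hs : s ≠ .undecided) :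
    mu G α δ (Function.update st x s) ≤ mu G α δ st - 1 := by
  cases s with
  | undecided => exact absurd rfl hs
  | chosen => exact mu_choose_le_of_dominated hα hδ hx hdx
  | discarded => exact mu_discard_le_of_dominated hα hx hdx

theorem mu_choose_update_le (hα : 0 ≤ α) (hδ : 0 ≤ δ) {y : V} (hx : st x = .undecided)
    (hdx : HasChosenNbr G st x) (hy : st y = .undecided) (hxy : G.Adj x y) {s : Status}
    (hs : s ≠ .undecided) :
    mu G α δ (Function.update (st.choose x) y s) ≤ mu G α δ st - 2 := by
  have hchoose := mu_choose_le_of_dominated hα hδ hx hdx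
  have hupdate := mu_update_le_of_dominated (G := G) (st := st.choose x) hα hδ (x := y)
    (by simp [hxy.ne', hy]) ⟨x, by simp, hxy.symm⟩ hs
  linarith

theorem mu_choose_update_update_le (hα : 0 ≤ α) (hδ : 0 ≤ δ) {y z : V} (hx : st x = .undecided)
    (hdx : HasChosenNbr G st x) (hy : st y = .undecided) (hz : st z = .undecided) (hyz : y ≠ z)
    (hxy : G.Adj x y) (hxz : G.Adj x z) {s t : Status} (hs : s ≠ .undecided)
    (ht : t ≠ .undecided) :
    mu G α δ (Function.update (Function.update (st.choose x) y s) z t) ≤ mu G α δ st - 3 := by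
  have hchoose := mu_choose_update_le hα hδ hx hdx hy hxy hs
  have hupdate := mu_update_le_of_dominated (G := G)
    (st := Function.update (st.choose x) y s) hα hδ (x := z)
    (by simp [hxz.ne', hyz.symm, hz]) ⟨x, by simp [hxy.ne], hxz.symm⟩ ht
  linarith

theorem card_discardedUndominated_discardNbrs_le {y : V} :
    ((discardNbrs G y st).toInstance.discardedUndominated G).card ≤
      (st.toInstance.discardedUndominated G).card +
        {u | st u = .undecided ∧ G.Adj y u}.ncard := by
  classical
  have hN : {u | st u = .undecided ∧ G.Adj y u} = st.toInstance.free.filter (G.Adj y) := by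
    ext u; simp
  rw [hN, Set.ncard_coe_finset]
  refine (Finset.card_le_card fun v hv => ?_).trans (Finset.card_union_le _ _)
  rw [mem_discardedUndominated, hasChosenNbr_congr chosenSet_discardNbrs] at hv
  by_cases h : st v = .undecided ∧ G.Adj y v <;> simp_all [discardNbrs]

theorem mu_discardNbrs_le (hα : 0 ≤ α) (hα1 : α ≤ 1) {y : V} (B : Finset V)
    (hB : ∀ u ∈ B, st u = .undecided ∧ G.Adj y u) :
    mu G α δ (discardNbrs G y st) ≤ mu G α δ st - B.card * (1 - α) := by
  set k := {u | st u = .undecided ∧ G.Adj y u}.ncard with hk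
  have hBk : (B.card : ℝ) ≤ k := by
    rw [Nat.cast_le, hk, ← Set.ncard_coe_finset]
    exact Set.ncard_le_ncard hB
  have hfree : ((discardNbrs G y st).toInstance.free.card : ℝ) + k = st.toInstance.free.card := by
    exact_mod_cast card_free_discardNbrs
  have hcard : (((discardNbrs G y st).toInstance.discardedUndominated G).card : ℝ) ≤
      (st.toInstance.discardedUndominated G).card + k := by
    exact_mod_cast card_discardedUndominated_discardNbrs_le
  rw [mu_eq, mu_eq, chosenSet_discardNbrs]
  linarith [mul_le_mul_of_nonneg_left hcard hα,
    mul_le_mul_of_nonneg_right hBk (sub_nonneg.2 hα1)]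

theorem mu_discardNbrs_le_of_adj (hα : 0 ≤ α) (hα1 : α ≤ 1) {y w : V} (hw : st w = .undecided)
    (hyw : G.Adj y w) : mu G α δ (discardNbrs G y st) ≤ mu G α δ st - (1 - α) := by
  simpa using mu_discardNbrs_le (G := G) (δ := δ) hα hα1 {w} (by simp [hw, hyw])

end Measure

/-! ## Case distinctions on a few vertices -/

section Accepts

variable {V : Type u} {G : SimpleGraph V} {st : State V} {M : Finset V}

/-- `M` agrees with the decisions of the state. -/
def Accepts (st : State V) (M : Finset V) : Prop :=
  ∀ v, (st v = .chosen → v ∈ M) ∧ (st v = .discarded → v ∉ M)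

/-- `c` arises from `st` by decisions on undecided vertices, at least one of them. -/
def StrictlyExtends (c st : State V) : Prop :=
  (∀ v, st v ≠ .undecided → c v = st v) ∧ ∃ v, st v = .undecided ∧ c v ≠ .undecided

/-- The undecided neighbours of `v` satisfy `P`. -/
def ForallUndecidedNbr (G : SimpleGraph V) (st : State V) (v : V) (P : V → Prop) : Prop :=
  ∀ u, st u = .undecided → G.Adj v u → P u

/-- `x` is undecided, adjacent to exactly one component of the solution, and to no discarded
vertex that is not dominated. -/
def IsSimple (G : SimpleGraph V) (st : State V) (x : V) : Prop :=
  st x = .undecided ∧ HasChosenNbr G st x ∧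
    (∀ v, G.Adj x v → st v ≠ .undecided → ¬ Undominated G st v) ∧
    ∀ s t, st s = .chosen → st t = .chosen → G.Adj x s → G.Adj x t → Linked G (chosenSet st) s t

theorem StrictlyExtends.discardNbrs {c : State V} {y : V} (h : StrictlyExtends c st) :
    StrictlyExtends (discardNbrs G y c) st := by
  obtain ⟨hkeep, v, hv, hcv⟩ := h
  refine ⟨fun w hw => ?_, v, hv, by simp [CDSEnum.discardNbrs, hcv]⟩
  simp [CDSEnum.discardNbrs, hkeep w hw, hw]

theorem accepts_discardNbrs {y : V} :
    Accepts (discardNbrs G y st) M ↔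
      Accepts st M ∧ ForallUndecidedNbr G st y fun u => u ∉ M := by
  simp only [Accepts, ForallUndecidedNbr, discardNbrs]
  grind

section Update

variable [DecidableEq V] {x : V}

theorem strictlyExtends_update (hx : st x = .undecided) {s : Status} (hs : s ≠ .undecided) :
    StrictlyExtends (Function.update st x s) st := by
  refine ⟨fun v hv => Function.update_of_ne ?_ _ _, x, hx, by simpa using hs⟩
  rintro rfl
  exact hv hx

theorem StrictlyExtends.update {c : State V} (hx : st x = .undecided) {s : Status}
    (hs : s ≠ .undecided) (h : StrictlyExtends c st) :
    StrictlyExtends (Function.update c x s) st := by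
  obtain ⟨hkeep, -⟩ := h
  refine ⟨fun w hw => ?_, x, hx, by simpa using hs⟩
  rw [Function.update_of_ne (by rintro rfl; exact hw hx), hkeep w hw]

theorem accepts_choose (hx : st x = .undecided) :
    Accepts (st.choose x) M ↔ Accepts st M ∧ x ∈ M := by
  simp only [Accepts, Function.update_apply]
  grind

theorem accepts_discard (hx : st x = .undecided) :
    Accepts (st.discard x) M ↔ Accepts st M ∧ x ∉ M := by
  simp only [Accepts, Function.update_apply]
  grind

end Update

theorem Undominated.exists_mem {v : V} (hv : Undominated G st v) (hs : ∃ s, st s = .chosen)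
    (hM : IsCDS G M) (hA : Accepts st M) : ∃ u ∈ M, st u = .undecided ∧ G.Adj v u := by
  obtain ⟨s, hs⟩ := hs
  obtain ⟨w, hw, hvw⟩ := hM.exists_adj ((hA s).1 hs) (v := v) (by rintro rfl; exact hv.1 hs)
  refine ⟨w, hw, ?_, hvw⟩
  cases h : st w with
  | undecided => rfl
  | chosen => exact absurd ⟨w, h, hvw⟩ hv.2
  | discarded => exact absurd hw ((hA w).2 h)

/-- Removing `x` from `M` does not disconnect `M`, as `x` touches a single component, so `x` must
be needed for an undecided neighbour. -/
theorem IsSimple.exists_mem_or_private {x : V} (hx : IsSimple G st x) (hM : IsMinimalCDS G M)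
    (hA : Accepts st M) (hxM : x ∈ M) :
    ∃ y, st y = .undecided ∧ G.Adj x y ∧
      (y ∈ M ∨ ¬ HasChosenNbr G st y ∧ ∀ w ∈ M, G.Adj y w → w = x) := by
  classical
  obtain ⟨hx0, ⟨s, hs, hxs⟩, hnbr, hlinked⟩ := hx
  by_contra! hcon
  have hsub : chosenSet st ⊆ ((M.erase x : Finset V) : Set V) := fun v (hv : st v = .chosen) =>
    Finset.mem_coe.2 (Finset.mem_erase.2 ⟨by rintro rfl; simp [hx0] at hv, (hA v).1 hv⟩)
  refine (isMinimalCDS_iff_erase.1 hM).2 x hxM (hM.prop.erase ((hA s).1 hs) hxs ?_ ?_)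
  · intro u hu hxu
    cases h : st u with
    | undecided => exact absurd hu (hcon u h hxu).1
    | chosen => exact (hlinked s u hs h hxs hxu).mono hsub
    | discarded => exact absurd hu ((hA u).2 h)
  · intro v hv hxv
    by_cases hd : HasChosenNbr G st v
    · obtain ⟨w, hw, hvw⟩ := hd
      exact ⟨w, (hA w).1 hw, by rintro rfl; simp [hx0] at hw, hvw⟩
    by_cases h : st v = .undecided
    · obtain ⟨w, hw, hvw, hwx⟩ := (hcon v h hxv).2 hd
      exact ⟨w, hw, hwx, hvw⟩
    · exact absurd ⟨fun h => hv ((hA v).1 h), hd⟩ (hnbr v hxv h)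

theorem IsSimple.private_or_private {x y z : V} (hx : IsSimple G st x)
    (hN : ForallUndecidedNbr G st x fun u => u = y ∨ u = z) (hM : IsMinimalCDS G M)
    (hA : Accepts st M) (hxM : x ∈ M) (hyM : y ∉ M) (hzM : z ∉ M) :
    ¬ HasChosenNbr G st y ∧ (∀ w ∈ M, G.Adj y w → w = x) ∨
      ¬ HasChosenNbr G st z ∧ ∀ w ∈ M, G.Adj z w → w = x := by
  obtain ⟨u, hu, hxu, h⟩ := hx.exists_mem_or_private hM hA hxM
  rcases hN u hu hxu with rfl | rfl
  · exact .inl (h.resolve_left hyM)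
  · exact .inr (h.resolve_left hzM)

theorem IsSimple.private_or_private_of_accepts [DecidableEq V] {x y z : V} (hx : IsSimple G st x)
    (hy : st y = .undecided) (hz : st z = .undecided) (hyz : y ≠ z) (hxy : G.Adj x y)
    (hxz : G.Adj x z) (hN : ForallUndecidedNbr G st x fun u => u = y ∨ u = z)
    (hM : IsMinimalCDS G M) (hA : Accepts (((st.choose x).discard y).discard z) M) :
    ¬ HasChosenNbr G st y ∧ (∀ w ∈ M, G.Adj y w → w = x) ∨
      ¬ HasChosenNbr G st z ∧ ∀ w ∈ M, G.Adj z w → w = x := by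
  have hy' : st.choose x y = .undecided := by simp [hxy.ne', hy]
  have hz' : (st.choose x).discard y z = .undecided := by simp [hxz.ne', hyz.symm, hz]
  simp only [accepts_discard hz', accepts_discard hy', accepts_choose hx.1] at hA
  obtain ⟨⟨⟨hA, hxM⟩, hyM⟩, hzM⟩ := hA
  exact hx.private_or_private hN hM hA hxM hyM hzM

end Accepts

section Splits

variable {V : Type u} {G : SimpleGraph V} {st : State V} {cs : List (State V)}

open Classical in
/-- The states `cs` form an exact case distinction for `st`: a minimal connected dominating set
that is accepted by `st` is accepted by precisely one of them, and any other by none. -/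
def Splits (G : SimpleGraph V) (st : State V) (cs : List (State V)) : Prop :=
  ∀ M, IsMinimalCDS G M →
    cs.countP (fun c => Accepts c M) = if Accepts st M then 1 else 0

theorem Splits.refl : Splits G st [st] := fun M _ => by
  by_cases hA : Accepts st M <;> simp [hA]

theorem Splits.nil (h : ∀ M, IsMinimalCDS G M → ¬ Accepts st M) : Splits G st [] := fun M hM => by
  simp [h M hM]

theorem Splits.perm {cs' : List (State V)} (h : Splits G st cs) (hcs : cs.Perm cs') :
    Splits G st cs' := fun M hM => by
  rw [← hcs.countP_eq, h M hM]

theorem Splits.of_accepts_iff {c : State V} (h : Splits G c cs)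
    (hc : ∀ M, IsMinimalCDS G M → (Accepts c M ↔ Accepts st M)) : Splits G st cs := fun M hM => by
  rw [h M hM]
  by_cases hA : Accepts st M <;> simp [hc M hM, hA]

theorem Splits.of_discardNbrs {y : V} (h : Splits G (discardNbrs G y st) cs)
    (hy : ∀ M, IsMinimalCDS G M → Accepts st M → ForallUndecidedNbr G st y fun u => u ∉ M) :
    Splits G st cs :=
  h.of_accepts_iff fun M hM => accepts_discardNbrs.trans (and_iff_left_of_imp (hy M hM))

variable [DecidableEq V] {x : V}

theorem Splits.of_choose (hx : st x = .undecided) (h : Splits G (st.choose x) cs)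
    (hmem : ∀ M, IsMinimalCDS G M → Accepts st M → x ∈ M) : Splits G st cs :=
  h.of_accepts_iff fun M hM => (accepts_choose hx).trans (and_iff_left_of_imp (hmem M hM))

theorem Splits.of_discard (hx : st x = .undecided) (h : Splits G (st.discard x) cs)
    (hmem : ∀ M, IsMinimalCDS G M → Accepts st M → x ∉ M) : Splits G st cs :=
  h.of_accepts_iff fun M hM => (accepts_discard hx).trans (and_iff_left_of_imp (hmem M hM))

theorem Splits.append {cs' : List (State V)} (hx : st x = .undecided)
    (hchoose : Splits G (st.choose x) cs) (hdiscard : Splits G (st.discard x) cs') :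
    Splits G st (cs ++ cs') := fun M hM => by
  rw [List.countP_append, hchoose M hM, hdiscard M hM]
  by_cases hA : Accepts st M <;> by_cases hxM : x ∈ M <;>
    simp [accepts_choose hx, accepts_discard hx, hA, hxM]

theorem Splits.cons_choose (hx : st x = .undecided) (h : Splits G (st.discard x) cs) :
    Splits G st (st.choose x :: cs) :=
  .append hx .refl h

theorem Splits.cons_discard (hx : st x = .undecided) (h : Splits G (st.choose x) cs) :
    Splits G st (st.discard x :: cs) :=
  (Splits.append hx h .refl).perm (List.perm_append_singleton _ _)

theorem splits_discard_choose (hx : st x = .undecided) :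
    Splits G st [st.discard x, st.choose x] :=
  .cons_discard hx .refl

theorem Splits.cons_cons_cons {y z : V} (hx : st x = .undecided) (hy : st y = .undecided)
    (hz : st z = .undecided) (hxy : x ≠ y) (hxz : x ≠ z) (hyz : y ≠ z)
    (h : Splits G (((st.choose x).discard y).discard z) cs) :
    Splits G st (st.discard x :: (st.choose x).choose y :: ((st.choose x).discard y).choose z ::
      cs) :=
  .cons_discard hx (.cons_choose (by simp [hxy.symm, hy])
    (.cons_choose (by simp [hxz.symm, hyz.symm, hz]) h))

theorem splits_of_two_nbrs {v a b : V} {cs cs' : List (State V)} (hs : ∃ s, st s = .chosen)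
    (hv : Undominated G st v) (ha : st a = .undecided) (hb : st b = .undecided) (hab : a ≠ b)
    (hN : ForallUndecidedNbr G st v fun u => u = a ∨ u = b) (ht : Splits G (st.choose a) cs)
    (hd : Splits G ((st.choose b).discard a) cs') : Splits G st (cs ++ cs') := by
  refine .append ha ht (Splits.of_choose (x := b) (by simp [hab.symm, hb]) ?_ fun M hM hA => ?_)
  · rwa [State.choose, State.discard, Function.update_comm hab]
  · rw [accepts_discard ha] at hA
    obtain ⟨u, huM, hu, hvu⟩ := hv.exists_mem hs hM.prop hA.1
    rcases hN u hu hvu with rfl | rfl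
    · exact absurd huM hA.2
    · exact huM

end Splits

section GoodStep

variable {V : Type u} [Fintype V] [DecidableEq V] {G : SimpleGraph V} {st : State V} {α δ : ℝ}

/-- The states `cs` form an exact case distinction for `st`, whose decrease of the measure is
controlled: either there is at most one state, or the decrease is that of a branching vector. The
bound on the number of states is what the algorithm needs to store them. -/
structure GoodStep (G : SimpleGraph V) (α δ : ℝ) (st : State V) (cs : List (State V)) : Prop where
  strictlyExtends : ∀ c ∈ cs, StrictlyExtends c st
  length_le : cs.length ≤ 5
  splits : Splits G st cs
  measure_le : cs = [] ∨ (∃ c, cs = [c] ∧ mu G α δ c ≤ mu G α δ st - 4 / 5) ∨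
    ∃ r ∈ branchingVectors α δ, List.Forall₂ (fun c a => mu G α δ c ≤ mu G α δ st - a) cs r

theorem goodStep_nil {v : V} (hs : ∃ s, st s = .chosen) (hv : Undominated G st v)
    (hN : ForallUndecidedNbr G st v fun _ => False) : GoodStep G α δ st [] where
  strictlyExtends := by simp
  length_le := by simp
  splits := .nil fun M hM hA => by
    obtain ⟨u, -, hu, hvu⟩ := hv.exists_mem hs hM.prop hA
    exact hN u hu hvu
  measure_le := .inl rfl

theorem goodStep_choose {v a : V} (hα : 0 ≤ α) (hδ : 0 ≤ δ) (hδ' : δ ≤ 1 / 5)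
    (hs : ∃ s, st s = .chosen) (hv : Undominated G st v) (ha : st a = .undecided)
    (hN : ForallUndecidedNbr G st v fun u => u = a) : GoodStep G α δ st [st.choose a] where
  strictlyExtends := by simp (maxDischargeDepth := 9) [strictlyExtends_update, ha]
  length_le := by simp
  splits := Splits.refl.of_choose ha fun M hM hA => by
    obtain ⟨u, huM, hu, hvu⟩ := hv.exists_mem hs hM.prop hA
    exact hN u hu hvu ▸ huM
  measure_le := by
    refine .inr (.inl ⟨_, rfl, ?_⟩)
    have hchoose := mu_choose_le (G := G) hα hδ ha
    linarith

theorem mu_choose_discard_le {a b : V} (hα : 0 ≤ α) (hab : a ≠ b) (ha : st a = .undecided) :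
    mu G α δ ((st.choose b).discard a) ≤ mu G α δ (st.choose b) - (1 - α) :=
  mu_discard_le hα (by simp [hab, ha])

theorem goodStep_of_discarded {v a b : V} (hα : 0 ≤ α) (hδ : 0 ≤ δ) (hs : ∃ s, st s = .chosen)
    (hv0 : st v = .discarded) (hv : ¬ HasChosenNbr G st v) (ha : st a = .undecided)
    (hb : st b = .undecided) (hab : a ≠ b) (hva : G.Adj v a) (hvb : G.Adj v b)
    (hN : ForallUndecidedNbr G st v fun u => u = a ∨ u = b) :
    GoodStep G α δ st [st.choose a, (st.choose b).discard a] where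
  strictlyExtends := by
    simp (maxDischargeDepth := 9) [strictlyExtends_update, StrictlyExtends.update, ha, hb]
  length_le := by simp
  splits := splits_of_two_nbrs hs ⟨by simp [hv0], hv⟩ ha hb hab hN .refl .refl
  measure_le := by
    refine .inr (.inr ⟨[1 + α - δ, 2 - δ], by simp [branchingVectors], .cons ?_ (.cons ?_ .nil)⟩)
    · exact mu_choose_le_of_undominated_nbr hα hδ ha hv0 hv hva.symm
    · have hchoose := mu_choose_le_of_undominated_nbr hα hδ hb hv0 hv hvb.symm
      have hdiscard := mu_choose_discard_le (G := G) (δ := δ) hα hab ha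
      linarith

theorem goodStep_of_undecided {v a b : V} (hα : 0 ≤ α) (hδ : 0 ≤ δ) (hs : ∃ s, st s = .chosen)
    (hv0 : st v = .undecided) (hv : ¬ HasChosenNbr G st v) (ha : st a = .undecided)
    (hb : st b = .undecided) (hab : a ≠ b) (hva : G.Adj v a) (hvb : G.Adj v b)
    (hN : ForallUndecidedNbr G st v fun u => u = a ∨ u = b) :
    GoodStep G α δ st
      [(st.choose a).choose v, ((st.choose b).discard a).discard v,
       (st.choose a).discard v, ((st.choose b).choose v).discard a] where
  strictlyExtends := by
    simp (maxDischargeDepth := 9) [strictlyExtends_update, StrictlyExtends.update, ha, hb, hv0]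
  length_le := by simp
  splits := by
    have hsplit := splits_of_two_nbrs hs ⟨by simp [hv0], hv⟩ ha hb hab hN
      (.cons_choose (x := v) (by simp [hva.ne, hv0]) .refl)
      (.cons_discard (x := v) (by simp [hva.ne, hvb.ne, hv0]) .refl)
    have hcomm : ((st.choose b).discard a).choose v = ((st.choose b).choose v).discard a :=
      Function.update_comm hva.ne' _ _ _
    rw [hcomm] at hsplit
    exact hsplit.perm (.cons _ (.swap _ _ _))
  measure_le := by
    have hchoose {a : V} (ha : st a = .undecided) (hva : G.Adj v a) {s : Status}
        (hs : s ≠ .undecided) :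
        mu G α δ (Function.update (st.choose a) v s) ≤ mu G α δ st - (2 - δ) := by
      have ha' := mu_choose_le (G := G) hα hδ ha
      have hv' := mu_update_le_of_dominated (G := G) (st := st.choose a) hα hδ (x := v)
        (by simp [hva.ne, hv0]) ⟨a, by simp, hva⟩ hs
      linarith
    refine .inr (.inr ⟨[2 - δ, 3 - δ - α, 2 - δ, 3 - δ], by simp [branchingVectors],
      .cons (hchoose ha hva (by simp)) (.cons ?_ (.cons (hchoose ha hva (by simp))
        (.cons ?_ .nil)))⟩)
    · have hb' := mu_choose_le (G := G) hα hδ hb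
      have ha' := mu_choose_discard_le (G := G) (δ := δ) hα hab ha
      have hv' := mu_discard_le_of_dominated (G := G) (δ := δ) (st := (st.choose b).discard a)
        (x := v) hα (by simp [hva.ne, hvb.ne, hv0]) ⟨b, by simp [hab.symm], hvb⟩
      linarith
    · have hb' := hchoose hb hvb (s := .chosen) (by simp)
      have ha' := mu_discard_le_of_dominated (G := G) (δ := δ) (st := (st.choose b).choose v)
        (x := a) hα (by simp [hva.ne', hab, ha]) ⟨v, by simp, hva.symm⟩
      linarith

theorem goodStep_of_undominated_nbr {x v : V} (hα : 0 ≤ α) (hδ : 0 ≤ δ) (hx : st x = .undecided)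
    (hdx : HasChosenNbr G st x) (hv0 : st v = .discarded) (hv : ¬ HasChosenNbr G st v)
    (hxv : G.Adj x v) : GoodStep G α δ st [st.discard x, st.choose x] where
  strictlyExtends := by simp (maxDischargeDepth := 9) [strictlyExtends_update, hx]
  length_le := by simp
  splits := splits_discard_choose hx
  measure_le := .inr (.inr ⟨[1, 1 + α], by simp [branchingVectors],
    .cons (mu_discard_le_of_dominated hα hx hdx)
      (.cons (mu_choose_le_of_dominated_of_undominated_nbr hα hδ hx hdx hv0 hv hxv) .nil)⟩)

theorem goodStep_of_not_linked {x s t : V} (hα : 0 ≤ α) (hδ : 0 ≤ δ) (hx : st x = .undecided)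
    (hs : st s = .chosen) (ht : st t = .chosen) (hxs : G.Adj x s) (hxt : G.Adj x t)
    (hst : ¬ Linked G (chosenSet st) s t) :
    GoodStep G α δ st [st.discard x, st.choose x] where
  strictlyExtends := by simp (maxDischargeDepth := 9) [strictlyExtends_update, hx]
  length_le := by simp
  splits := splits_discard_choose hx
  measure_le := .inr (.inr ⟨[1, 1 + δ], by simp [branchingVectors],
    .cons (mu_discard_le_of_dominated hα hx ⟨s, hs, hxs⟩)
      (.cons (mu_choose_le_of_not_linked hα hδ hx hs ht hxs hxt hst) .nil)⟩)

end GoodStep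

section SimpleStep

variable {V : Type u} [Fintype V] [DecidableEq V] {G : SimpleGraph V} {st : State V} {α δ : ℝ}
  {x y z w : V}

theorem IsSimple.goodStep_discard (hα : 0 ≤ α) (hx : IsSimple G st x)
    (hN : ForallUndecidedNbr G st x fun _ => False) : GoodStep G α δ st [st.discard x] where
  strictlyExtends := by simp (maxDischargeDepth := 9) [strictlyExtends_update, hx.1]
  length_le := by simp
  splits := Splits.refl.of_discard hx.1 fun M hM hA hxM => by
    obtain ⟨y, hy, hxy, -⟩ := hx.exists_mem_or_private hM hA hxM
    exact hN y hy hxy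
  measure_le := by
    refine .inr (.inl ⟨_, rfl, ?_⟩)
    have hdiscard := mu_discard_le_of_dominated (δ := δ) hα hx.1 hx.2.1
    linarith

theorem IsSimple.goodStep_of_dominated_nbr (hα : 0 ≤ α) (hδ : 0 ≤ δ) (hδ' : δ ≤ 1 / 5)
    (hx : IsSimple G st x) (hy : st y = .undecided) (hxy : G.Adj x y)
    (hdy : HasChosenNbr G st y) (hN : ForallUndecidedNbr G st x fun u => u = y) :
    GoodStep G α δ st [st.discard x, (st.choose x).choose y] where
  strictlyExtends := by
    simp (maxDischargeDepth := 9) [strictlyExtends_update, StrictlyExtends.update, hx.1, hy]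
  length_le := by simp
  splits := by
    refine .cons_discard hx.1 (Splits.refl.of_choose (by simp [hxy.ne', hy]) fun M hM hA => ?_)
    rw [accepts_choose hx.1] at hA
    obtain ⟨u, hu, hxu, h⟩ := hx.exists_mem_or_private hM hA.1 hA.2
    obtain rfl := hN u hu hxu
    exact h.resolve_right fun h => h.1 hdy
  measure_le := by
    refine .inr (.inr ⟨[1, 1 + δ], by simp [branchingVectors],
      .cons (mu_discard_le_of_dominated hα hx.1 hx.2.1) (.cons ?_ .nil)⟩)
    have hchoose := mu_choose_update_le hα hδ hx.1 hx.2.1 hy hxy (s := .chosen) (by simp)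
    linarith

theorem IsSimple.goodStep_of_undominated_nbr (hα : 0 ≤ α) (hα' : α ≤ 1 / 5) (hδ : 0 ≤ δ)
    (hx : IsSimple G st x) (hy : st y = .undecided) (hxy : G.Adj x y)
    (hN : ForallUndecidedNbr G st x fun u => u = y) (hw : st w = .undecided) (hyw : G.Adj y w)
    (hwx : w ≠ x) :
    GoodStep G α δ st
      [st.discard x, (st.choose x).choose y, discardNbrs G y ((st.choose x).discard y)] where
  strictlyExtends := by
    simp (maxDischargeDepth := 9) [strictlyExtends_update, StrictlyExtends.update,
      StrictlyExtends.discardNbrs, hx.1, hy]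
  length_le := by simp
  splits := by
    have hy' : st.choose x y = .undecided := by simp [hxy.ne', hy]
    refine .cons_discard hx.1 (.cons_choose hy' (Splits.refl.of_discardNbrs
      fun M hM hA v hv hyv hvM => ?_))
    simp only [accepts_discard hy', accepts_choose hx.1] at hA
    obtain ⟨⟨hA, hxM⟩, hyM⟩ := hA
    obtain ⟨u, hu, hxu, h⟩ := hx.exists_mem_or_private hM hA hxM
    obtain rfl := hN u hu hxu
    obtain rfl := (h.resolve_left hyM).2 v hvM hyv
    simp [hxy.ne] at hv
  measure_le := by
    refine .inr (.inr ⟨[1, 2, 2 + α], by simp [branchingVectors],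
      .cons (mu_discard_le_of_dominated hα hx.1 hx.2.1)
        (.cons (mu_choose_update_le hα hδ hx.1 hx.2.1 hy hxy (by simp)) (.cons ?_ .nil))⟩)
    have hupdate := mu_choose_update_le hα hδ hx.1 hx.2.1 hy hxy (s := .discarded) (by simp)
    have hnbrs := mu_discardNbrs_le_of_adj (G := G) (δ := δ) (st := (st.choose x).discard y) hα
      (by linarith) (w := w) (by simp [hyw.ne', hwx, hw]) hyw
    linarith

theorem IsSimple.goodStep_of_dominated_nbrs (hα : 0 ≤ α) (hδ : 0 ≤ δ) (hδ' : δ ≤ 1 / 5)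
    (hx : IsSimple G st x) (hy : st y = .undecided) (hz : st z = .undecided) (hyz : y ≠ z)
    (hxy : G.Adj x y) (hxz : G.Adj x z) (hdy : HasChosenNbr G st y) (hdz : HasChosenNbr G st z)
    (hN : ForallUndecidedNbr G st x fun u => u = y ∨ u = z) :
    GoodStep G α δ st
      [st.discard x, (st.choose x).choose y, ((st.choose x).discard y).choose z] where
  strictlyExtends := by
    simp (maxDischargeDepth := 9) [strictlyExtends_update, StrictlyExtends.update, hx.1, hy, hz]
  length_le := by simp
  splits := by
    refine .cons_cons_cons hx.1 hy hz hxy.ne hxz.ne hyz (.nil fun M hM hA => ?_)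
    rcases hx.private_or_private_of_accepts hy hz hyz hxy hxz hN hM hA with h | h
    · exact h.1 hdy
    · exact h.1 hdz
  measure_le := by
    refine .inr (.inr ⟨[1, 2, 2 + δ], by simp [branchingVectors],
      .cons (mu_discard_le_of_dominated hα hx.1 hx.2.1)
        (.cons (mu_choose_update_le hα hδ hx.1 hx.2.1 hy hxy (by simp)) (.cons ?_ .nil))⟩)
    have hchoose := mu_choose_update_update_le hα hδ hx.1 hx.2.1 hy hz hyz hxy hxz
      (s := .discarded) (t := .chosen) (by simp) (by simp)
    linarith

/-- The branches that decide in turn that `x` is discarded, that `y` is chosen, and that `z` is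
chosen decrease the measure by `1`, `2` and `3`; what remains is the case in which `x` is chosen
without `y` and `z`. -/
theorem IsSimple.goodStep_of_splits {cs : List (State V)} {r : List ℝ} (hα : 0 ≤ α) (hδ : 0 ≤ δ)
    (hx : IsSimple G st x) (hy : st y = .undecided) (hz : st z = .undecided) (hyz : y ≠ z)
    (hxy : G.Adj x y) (hxz : G.Adj x z)
    (hext : ∀ c ∈ cs, StrictlyExtends c st) (hlen : cs.length ≤ 2)
    (hsplit : Splits G (((st.choose x).discard y).discard z) cs)
    (hr : 1 :: 2 :: 3 :: r ∈ branchingVectors α δ)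
    (hmu : List.Forall₂ (fun c a =>
      mu G α δ c ≤ mu G α δ (((st.choose x).discard y).discard z) - (a - 3)) cs r) :
    GoodStep G α δ st (st.discard x :: (st.choose x).choose y ::
      ((st.choose x).discard y).choose z :: cs) where
  strictlyExtends := by
    simpa (maxDischargeDepth := 9) [strictlyExtends_update, StrictlyExtends.update, hx.1, hy, hz]
      using hext
  length_le := by simp only [List.length_cons]; lia
  splits := hsplit.cons_cons_cons hx.1 hy hz hxy.ne hxz.ne hyz
  measure_le := by
    have hthree {s : Status} (hs : s ≠ .undecided) := mu_choose_update_update_le hα hδ hx.1 hx.2.1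
      hy hz hyz hxy hxz (s := .discarded) (by simp) hs
    refine .inr (.inr ⟨_, hr, .cons (mu_discard_le_of_dominated hα hx.1 hx.2.1)
      (.cons (mu_choose_update_le hα hδ hx.1 hx.2.1 hy hxy (by simp))
        (.cons (hthree (by simp)) (hmu.imp fun c a hc => ?_)))⟩)
    have := hthree (s := .discarded) (by simp)
    linarith

theorem IsSimple.goodStep_of_dominated_nbr_of_undominated_nbr (hα : 0 ≤ α) (hα' : α ≤ 1 / 5)
    (hδ : 0 ≤ δ) (hx : IsSimple G st x) (hy : st y = .undecided) (hz : st z = .undecided)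
    (hyz : y ≠ z) (hxy : G.Adj x y) (hxz : G.Adj x z) (hdy : HasChosenNbr G st y)
    (hN : ForallUndecidedNbr G st x fun u => u = y ∨ u = z)
    (hw : st w = .undecided) (hzw : G.Adj z w) (hwx : w ≠ x) (hwy : w ≠ y) :
    GoodStep G α δ st
      [st.discard x, (st.choose x).choose y, ((st.choose x).discard y).choose z,
       discardNbrs G z (((st.choose x).discard y).discard z)] := by
  refine hx.goodStep_of_splits hα hδ hy hz hyz hxy hxz ?_ (by simp)
    (Splits.refl.of_discardNbrs fun M hM hA u hu hzu huM => ?_) (r := [4 - α])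
    (by simp [branchingVectors]) (.cons ?_ .nil)
  · simp (maxDischargeDepth := 9) [strictlyExtends_update, StrictlyExtends.update,
      StrictlyExtends.discardNbrs, hx.1, hy, hz]
  · rcases hx.private_or_private_of_accepts hy hz hyz hxy hxz hN hM hA with h | h
    · exact h.1 hdy
    · obtain rfl := h.2 u huM hzu
      simp [hxy.ne, hxz.ne] at hu
  · have hnbrs := mu_discardNbrs_le_of_adj (G := G) (δ := δ)
      (st := ((st.choose x).discard y).discard z) hα (by linarith) (w := w)
      (by simp [hzw.ne', hwx, hwy, hw]) hzw
    linarith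

theorem IsSimple.goodStep_of_common_nbr (hα : 0 ≤ α) (hδ : 0 ≤ δ) (hx : IsSimple G st x)
    (hy : st y = .undecided) (hz : st z = .undecided) (hyz : y ≠ z) (hxy : G.Adj x y)
    (hxz : G.Adj x z) (hN : ForallUndecidedNbr G st x fun u => u = y ∨ u = z)
    (hw : st w = .undecided) (hyw : G.Adj y w) (hwx : w ≠ x) (hzw : G.Adj z w) :
    GoodStep G α δ st
      [st.discard x, (st.choose x).choose y, ((st.choose x).discard y).choose z,
       (((st.choose x).discard y).discard z).discard w] := by
  have hw' : ((st.choose x).discard y).discard z w = .undecided := by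
    simp [hzw.ne', hyw.ne', hwx, hw]
  refine hx.goodStep_of_splits hα hδ hy hz hyz hxy hxz ?_ (by simp)
    (Splits.refl.of_discard hw' fun M hM hA hwM => ?_) (r := [4 - α])
    (by simp [branchingVectors]) (.cons ?_ .nil)
  · simp (maxDischargeDepth := 9) [strictlyExtends_update, StrictlyExtends.update, hx.1, hy, hz, hw]
  · rcases hx.private_or_private_of_accepts hy hz hyz hxy hxz hN hM hA with h | h
    · exact hwx (h.2 w hwM hyw)
    · exact hwx (h.2 w hwM hzw)
  · have hdiscard := mu_discard_le (G := G) (δ := δ) hα hw'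
    linarith

theorem IsSimple.goodStep_of_distinct_nbrs {t : V} (hα : 0 ≤ α) (hα' : α ≤ 1 / 5) (hδ : 0 ≤ δ)
    (hx : IsSimple G st x) (hy : st y = .undecided) (hz : st z = .undecided) (hyz : y ≠ z)
    (hxy : G.Adj x y) (hxz : G.Adj x z) (hN : ForallUndecidedNbr G st x fun u => u = y ∨ u = z)
    (hw : st w = .undecided) (hyw : G.Adj y w) (hwx : w ≠ x) (hwz : w ≠ z) (hzw : ¬ G.Adj z w)
    (ht : st t = .undecided) (hzt : G.Adj z t) (htx : t ≠ x) (hty : t ≠ y) :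
    GoodStep G α δ st
      [st.discard x, (st.choose x).choose y, ((st.choose x).discard y).choose z,
       (((st.choose x).discard y).discard z).discard w,
       discardNbrs G z ((((st.choose x).discard y).discard z).choose w)] := by
  have hw' : ((st.choose x).discard y).discard z w = .undecided := by
    simp [hwz, hyw.ne', hwx, hw]
  have htw : t ≠ w := by rintro rfl; exact hzw hzt
  refine hx.goodStep_of_splits hα hδ hy hz hyz hxy hxz ?_ (by simp)
    (.cons_discard hw' (Splits.refl.of_discardNbrs fun M hM hA u hu hzu huM => ?_))
    (r := [4 - α, 5 - δ - α]) (by simp [branchingVectors]) (.cons ?_ (.cons ?_ .nil))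
  · simp (maxDischargeDepth := 9) [strictlyExtends_update, StrictlyExtends.update,
      StrictlyExtends.discardNbrs, hx.1, hy, hz, hw]
  · rw [accepts_choose hw'] at hA
    rcases hx.private_or_private_of_accepts hy hz hyz hxy hxz hN hM hA.1 with h | h
    · exact hwx (h.2 w hA.2 hyw)
    · obtain rfl := h.2 u huM hzu
      simp [hxy.ne, hxz.ne, hwx.symm] at hu
  · have hdiscard := mu_discard_le (G := G) (δ := δ) hα hw'
    linarith
  · have hchoose := mu_choose_le (G := G) hα hδ hw'
    have hnbrs := mu_discardNbrs_le_of_adj (G := G) (δ := δ)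
      (st := (((st.choose x).discard y).discard z).choose w) hα (by linarith) (w := t)
      (by simp [htw, hzt.ne', htx, hty, ht]) hzt
    linarith

end SimpleStep

/-! ## First-order conditions -/

/-- First-order formulas about a state of the search. Variables are de Bruijn levels: a quantifier
at depth `d` binds the variable `d`. -/
inductive Formula : Type
  | adj (i j : ℕ)
  | hasStatus (i : ℕ) (s : Status)
  | eq (i j : ℕ)
  | linked (i j : ℕ)
  | linkedAvoiding (k i j : ℕ)
  | neg (φ : Formula)
  | and (φ ψ : Formula)
  | ex (φ : Formula)

namespace Formula

variable {V : Type u}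

/-- Truth of a formula at depth `d`, where `env` assigns vertices to the variables. -/
def Holds (G : SimpleGraph V) (st : State V) : Formula → ℕ → (ℕ → V) → Prop
  | adj i j, _, env => G.Adj (env i) (env j)
  | hasStatus i s, _, env => st (env i) = s
  | eq i j, _, env => env i = env j
  | linked i j, _, env => Linked G (chosenSet st) (env i) (env j)
  | linkedAvoiding k i j, _, env => Linked G (chosenSet st \ {env k}) (env i) (env j)
  | neg φ, d, env => ¬ φ.Holds G st d env
  | and φ ψ, d, env => φ.Holds G st d env ∧ ψ.Holds G st d env
  | ex φ, d, env => ∃ v, φ.Holds G st (d + 1) (Function.update env d v)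

/-- The variables that occur in a formula at depth `d` are bound or smaller than `d`. -/
def Scoped : Formula → ℕ → Prop
  | adj i j, d => i < d ∧ j < d
  | hasStatus i _, d => i < d
  | eq i j, d => i < d ∧ j < d
  | linked i j, d => i < d ∧ j < d
  | linkedAvoiding k i j, d => k < d ∧ i < d ∧ j < d
  | neg φ, d => φ.Scoped d
  | and φ ψ, d => φ.Scoped d ∧ ψ.Scoped d
  | ex φ, d => φ.Scoped (d + 1)

/-- Disjunction of two formulas. -/
def or (φ ψ : Formula) : Formula := neg (and (neg φ) (neg ψ))

/-- Conjunction of a list of formulas. -/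
def conj : List Formula → Formula
  | [] => eq 0 0
  | φ :: l => and φ (conj l)

/-- The formula, at depth `d`, for `HasChosenNbr`. -/
def dominated (d i : ℕ) : Formula := ex (and (hasStatus d .chosen) (adj i d))

/-- The formula, at depth `d`, for `Undominated`. -/
def undominated (d i : ℕ) : Formula := and (neg (hasStatus i .chosen)) (neg (dominated d i))

/-- The formula, at depth `d`, for `ForallUndecidedNbr`: the undecided neighbours of `i` satisfy
`φ`, in which they are the variable `d`. -/
def forallNbr (d i : ℕ) (φ : Formula) : Formula :=
  neg (ex (and (hasStatus d .undecided) (and (adj i d) (neg φ))))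

/-- The formula, at depth `d`, for `IsSimple`. -/
def simple (d i : ℕ) : Formula :=
  conj [hasStatus i .undecided, dominated d i,
    neg (ex (conj [adj i d, neg (hasStatus d .undecided), undominated (d + 1) d])),
    neg (ex (ex (conj [hasStatus d .chosen, hasStatus (d + 1) .chosen, adj i d, adj i (d + 1),
      neg (linked d (d + 1))])))]

variable {G : SimpleGraph V} {st : State V} {d i j : ℕ} {env : ℕ → V}

theorem holds_or {φ ψ : Formula} :
    (or φ ψ).Holds G st d env ↔ φ.Holds G st d env ∨ ψ.Holds G st d env := by
  simp only [or, Holds]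
  tauto

theorem holds_conj {l : List Formula} :
    (conj l).Holds G st d env ↔ ∀ φ ∈ l, φ.Holds G st d env := by
  induction l with
  | nil => simp [conj, Holds]
  | cons φ l ih => simp [conj, Holds, ih]

theorem holds_dominated (hi : i < d) :
    (dominated d i).Holds G st d env ↔ HasChosenNbr G st (env i) := by
  simp [dominated, Holds, HasChosenNbr, hi.ne]

theorem holds_undominated (hi : i < d) :
    (undominated d i).Holds G st d env ↔ Undominated G st (env i) := by
  simp [undominated, Holds, holds_dominated hi, Undominated]

theorem holds_forallNbr (hi : i < d) {φ : Formula} : (forallNbr d i φ).Holds G st d env ↔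
    ForallUndecidedNbr G st (env i) fun u => φ.Holds G st (d + 1) (Function.update env d u) := by
  simp [forallNbr, Holds, ForallUndecidedNbr, hi.ne]

theorem holds_simple (hi : i < d) : (simple d i).Holds G st d env ↔ IsSimple G st (env i) := by
  have hi' : i ≠ d + 1 := by lia
  simp only [simple, holds_conj, List.forall_mem_cons, IsSimple, Holds, holds_dominated hi,
    holds_undominated (Nat.lt_succ_self d), Function.update_self, Function.update_of_ne hi.ne,
    Function.update_of_ne hi', Function.update_of_ne (Nat.succ_ne_self d).symm]
  grind

end Formula

/-! ## The branching rules -/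

/-- Decisions of a branching rule: choose a vertex, discard it, or discard all its undecided
neighbours. -/
inductive Decision : Type
  | choose (i : Fin 4)
  | discard (i : Fin 4)
  | discardNbrsOf (i : Fin 4)

/-- The effect of a decision, where `env` assigns vertices to the four variables of a guard. -/
noncomputable def Decision.apply {V : Type u} [DecidableEq V] (G : SimpleGraph V) (env : ℕ → V)
    (st : State V) : Decision → State V
  | choose i => st.choose (env i)
  | discard i => st.discard (env i)
  | discardNbrsOf i => discardNbrs G (env i) st

/-- The effect of a list of decisions. -/
noncomputable def applyDecisions {V : Type u} [DecidableEq V] (G : SimpleGraph V) (env : ℕ → V)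
    (st : State V) (ds : List Decision) : State V :=
  ds.foldl (Decision.apply G env) st

/-- The branching rules. The first four branch on an undominated vertex, according to its
undecided neighbours; the last seven branch on a vertex that is `IsSimple`. -/
inductive Rule : Type
  | noNbr
  | oneNbr
  | discardedTwoNbrs
  | undecidedTwoNbrs
  | undominatedNbr
  | notLinked
  | simpleNoNbr
  | simpleDominatedNbr
  | simpleUndominatedNbr
  | simpleDominatedNbrs
  | simpleMixedNbrs
  | simpleCommonNbr
  | simpleDistinctNbrs

namespace Rule

open Formula

variable {V : Type u} {G : SimpleGraph V} {st : State V}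

/-- `y` is the only undecided neighbour of `x`. -/
def HasOneNbr (G : SimpleGraph V) (st : State V) (x y : V) : Prop :=
  st y = .undecided ∧ G.Adj x y ∧ ForallUndecidedNbr G st x fun u => u = y

/-- `y` and `z` are distinct, and they are the only undecided neighbours of `x`. -/
def HasTwoNbrs (G : SimpleGraph V) (st : State V) (x y z : V) : Prop :=
  st y = .undecided ∧ st z = .undecided ∧ y ≠ z ∧ G.Adj x y ∧ G.Adj x z ∧
    ForallUndecidedNbr G st x fun u => u = y ∨ u = z

/-- The condition under which a rule is applicable to four vertices. -/
def Condition (G : SimpleGraph V) (st : State V) (x y z w : V) : Rule → Prop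
  | noNbr => Undominated G st x ∧ ForallUndecidedNbr G st x fun _ => False
  | oneNbr => Undominated G st x ∧ HasOneNbr G st x y
  | discardedTwoNbrs => st x = .discarded ∧ ¬ HasChosenNbr G st x ∧ HasTwoNbrs G st x y z
  | undecidedTwoNbrs => st x = .undecided ∧ ¬ HasChosenNbr G st x ∧ HasTwoNbrs G st x y z
  | undominatedNbr => st x = .undecided ∧ HasChosenNbr G st x ∧
      st y = .discarded ∧ ¬ HasChosenNbr G st y ∧ G.Adj x y
  | notLinked => st x = .undecided ∧ st y = .chosen ∧ st z = .chosen ∧ G.Adj x y ∧ G.Adj x z ∧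
      ¬ Linked G (chosenSet st) y z
  | simpleNoNbr => IsSimple G st x ∧ ForallUndecidedNbr G st x fun _ => False
  | simpleDominatedNbr => IsSimple G st x ∧ HasOneNbr G st x y ∧ HasChosenNbr G st y
  | simpleUndominatedNbr => IsSimple G st x ∧ HasOneNbr G st x y ∧
      st w = .undecided ∧ G.Adj y w ∧ w ≠ x
  | simpleDominatedNbrs => IsSimple G st x ∧ HasTwoNbrs G st x y z ∧
      HasChosenNbr G st y ∧ HasChosenNbr G st z
  | simpleMixedNbrs => IsSimple G st x ∧ HasTwoNbrs G st x y z ∧ HasChosenNbr G st y ∧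
      st w = .undecided ∧ G.Adj z w ∧ w ≠ x ∧ w ≠ y
  | simpleCommonNbr => IsSimple G st x ∧ HasTwoNbrs G st x y z ∧
      st w = .undecided ∧ G.Adj y w ∧ w ≠ x ∧ G.Adj z w
  | simpleDistinctNbrs => IsSimple G st x ∧ HasTwoNbrs G st x y z ∧
      st w = .undecided ∧ G.Adj y w ∧ w ≠ x ∧ w ≠ z ∧ ¬ G.Adj z w ∧
      ∃ t, st t = .undecided ∧ G.Adj z t ∧ t ≠ x ∧ t ≠ y

/-- The formula for `HasOneNbr`, about the variables `0` and `1`. -/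
def oneNbrFormula : Formula :=
  conj [hasStatus 1 .undecided, adj 0 1, forallNbr 4 0 (eq 4 1)]

/-- The formula for `HasTwoNbrs`, about the variables `0`, `1` and `2`. -/
def twoNbrsFormula : Formula :=
  conj [hasStatus 1 .undecided, hasStatus 2 .undecided, neg (eq 1 2), adj 0 1, adj 0 2,
    forallNbr 4 0 (or (eq 4 1) (eq 4 2))]

/-- The formula for `Rule.Condition`, about the variables `0`, `1`, `2` and `3`. -/
def guard : Rule → Formula
  | noNbr => conj [undominated 4 0, forallNbr 4 0 (neg (eq 0 0))]
  | oneNbr => conj [undominated 4 0, oneNbrFormula]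
  | discardedTwoNbrs => conj [hasStatus 0 .discarded, neg (dominated 4 0), twoNbrsFormula]
  | undecidedTwoNbrs => conj [hasStatus 0 .undecided, neg (dominated 4 0), twoNbrsFormula]
  | undominatedNbr => conj [hasStatus 0 .undecided, dominated 4 0, hasStatus 1 .discarded,
      neg (dominated 4 1), adj 0 1]
  | notLinked => conj [hasStatus 0 .undecided, hasStatus 1 .chosen, hasStatus 2 .chosen, adj 0 1,
      adj 0 2, neg (linked 1 2)]
  | simpleNoNbr => conj [simple 4 0, forallNbr 4 0 (neg (eq 0 0))]
  | simpleDominatedNbr => conj [simple 4 0, oneNbrFormula, dominated 4 1]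
  | simpleUndominatedNbr => conj [simple 4 0, oneNbrFormula,
      hasStatus 3 .undecided, adj 1 3, neg (eq 3 0)]
  | simpleDominatedNbrs => conj [simple 4 0, twoNbrsFormula, dominated 4 1, dominated 4 2]
  | simpleMixedNbrs => conj [simple 4 0, twoNbrsFormula, dominated 4 1,
      hasStatus 3 .undecided, adj 2 3, neg (eq 3 0), neg (eq 3 1)]
  | simpleCommonNbr => conj [simple 4 0, twoNbrsFormula,
      hasStatus 3 .undecided, adj 1 3, neg (eq 3 0), adj 2 3]
  | simpleDistinctNbrs => conj [simple 4 0, twoNbrsFormula,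
      hasStatus 3 .undecided, adj 1 3, neg (eq 3 0), neg (eq 3 2), neg (adj 2 3),
      ex (conj [hasStatus 4 .undecided, adj 2 4, neg (eq 4 0), neg (eq 4 1)])]

theorem holds_guard {env : ℕ → V} (ρ : Rule) :
    ρ.guard.Holds G st 4 env ↔ ρ.Condition G st (env 0) (env 1) (env 2) (env 3) := by
  cases ρ <;>
    simp [guard, Condition, oneNbrFormula, twoNbrsFormula, HasOneNbr, HasTwoNbrs, Holds,
      holds_conj, holds_or, holds_dominated, holds_undominated, holds_forallNbr, holds_simple]

open Decision in
/-- The branches of a rule, each given by its decisions. -/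
def branches : Rule → List (List Decision)
  | noNbr => []
  | oneNbr => [[choose 1]]
  | discardedTwoNbrs => [[choose 1], [choose 2, discard 1]]
  | undecidedTwoNbrs => [[choose 1, choose 0], [choose 2, discard 1, discard 0],
      [choose 1, discard 0], [choose 2, choose 0, discard 1]]
  | undominatedNbr => [[discard 0], [choose 0]]
  | notLinked => [[discard 0], [choose 0]]
  | simpleNoNbr => [[discard 0]]
  | simpleDominatedNbr => [[discard 0], [choose 0, choose 1]]
  | simpleUndominatedNbr => [[discard 0], [choose 0, choose 1],
      [choose 0, discard 1, discardNbrsOf 1]]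
  | simpleDominatedNbrs => [[discard 0], [choose 0, choose 1], [choose 0, discard 1, choose 2]]
  | simpleMixedNbrs => [[discard 0], [choose 0, choose 1], [choose 0, discard 1, choose 2],
      [choose 0, discard 1, discard 2, discardNbrsOf 2]]
  | simpleCommonNbr => [[discard 0], [choose 0, choose 1], [choose 0, discard 1, choose 2],
      [choose 0, discard 1, discard 2, discard 3]]
  | simpleDistinctNbrs => [[discard 0], [choose 0, choose 1], [choose 0, discard 1, choose 2],
      [choose 0, discard 1, discard 2, discard 3],
      [choose 0, discard 1, discard 2, choose 3, discardNbrsOf 2]]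

theorem Condition.goodStep [Fintype V] [DecidableEq V] {α δ : ℝ} (hα : 0 ≤ α) (hα' : α ≤ 1 / 5)
    (hδ : 0 ≤ δ) (hδ' : δ ≤ 1 / 5) (hs : ∃ s, st s = .chosen) {env : ℕ → V} {ρ : Rule}
    (h : ρ.Condition G st (env 0) (env 1) (env 2) (env 3)) :
    GoodStep G α δ st (ρ.branches.map (applyDecisions G env st)) :=
  match ρ, h with
  | noNbr, ⟨hv, hN⟩ => goodStep_nil hs hv hN
  | oneNbr, ⟨hv, ha, _, hN⟩ => goodStep_choose hα hδ hδ' hs hv ha hN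
  | discardedTwoNbrs, ⟨hv0, hv, ha, hb, hab, hva, hvb, hN⟩ =>
    goodStep_of_discarded hα hδ hs hv0 hv ha hb hab hva hvb hN
  | undecidedTwoNbrs, ⟨hv0, hv, ha, hb, hab, hva, hvb, hN⟩ =>
    goodStep_of_undecided hα hδ hs hv0 hv ha hb hab hva hvb hN
  | undominatedNbr, ⟨hx, hdx, hv0, hv, hxv⟩ => goodStep_of_undominated_nbr hα hδ hx hdx hv0 hv hxv
  | notLinked, ⟨hx, hs, ht, hxs, hxt, hst⟩ => goodStep_of_not_linked hα hδ hx hs ht hxs hxt hst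
  | simpleNoNbr, ⟨hx, hN⟩ => hx.goodStep_discard hα hN
  | simpleDominatedNbr, ⟨hx, ⟨hy, hxy, hN⟩, hdy⟩ =>
    hx.goodStep_of_dominated_nbr hα hδ hδ' hy hxy hdy hN
  | simpleUndominatedNbr, ⟨hx, ⟨hy, hxy, hN⟩, hw, hyw, hwx⟩ =>
    hx.goodStep_of_undominated_nbr hα hα' hδ hy hxy hN hw hyw hwx
  | simpleDominatedNbrs, ⟨hx, ⟨hy, hz, hyz, hxy, hxz, hN⟩, hdy, hdz⟩ =>
    hx.goodStep_of_dominated_nbrs hα hδ hδ' hy hz hyz hxy hxz hdy hdz hN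
  | simpleMixedNbrs, ⟨hx, ⟨hy, hz, hyz, hxy, hxz, hN⟩, hdy, hw, hzw, hwx, hwy⟩ =>
    hx.goodStep_of_dominated_nbr_of_undominated_nbr hα hα' hδ hy hz hyz hxy hxz hdy hN hw hzw hwx
      hwy
  | simpleCommonNbr, ⟨hx, ⟨hy, hz, hyz, hxy, hxz, hN⟩, hw, hyw, hwx, hzw⟩ =>
    hx.goodStep_of_common_nbr hα hδ hy hz hyz hxy hxz hN hw hyw hwx hzw
  | simpleDistinctNbrs, ⟨hx, ⟨hy, hz, hyz, hxy, hxz, hN⟩, hw, hyw, hwx, hwz, hzw, _, ht, hzt, htx,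
      hty⟩ =>
    hx.goodStep_of_distinct_nbrs hα hα' hδ hy hz hyz hxy hxz hN hw hyw hwx hwz hzw ht hzt htx hty

end Rule

section Stuck

variable {V : Type u} {G : SimpleGraph V} {st : State V}

/-- No rule is applicable to the state. -/
def IsStuck (G : SimpleGraph V) (st : State V) : Prop :=
  ∀ (ρ : Rule) (x y z w : V), ¬ ρ.Condition G st x y z w

theorem ForallUndecidedNbr.eq_empty_or_singleton_or_pair {v a b : V}
    (h : ForallUndecidedNbr G st v fun u => u = a ∨ u = b) :
    (ForallUndecidedNbr G st v fun _ => False) ∨ (∃ c, Rule.HasOneNbr G st v c) ∨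
      Rule.HasTwoNbrs G st v a b := by
  simp only [ForallUndecidedNbr, Rule.HasOneNbr, Rule.HasTwoNbrs] at *
  grind

namespace IsStuck

theorem exists_nbr {v : V} (h : IsStuck G st) (hv : Undominated G st v) (a b : V) :
    ∃ c, st c = .undecided ∧ G.Adj v c ∧ c ≠ a ∧ c ≠ b := by
  by_contra! hab
  have hN : ForallUndecidedNbr G st v fun u => u = a ∨ u = b := fun u hu hvu =>
    or_iff_not_imp_left.2 (hab u hu hvu)
  rcases hN.eq_empty_or_singleton_or_pair with hN | ⟨c, hN⟩ | hN
  · exact h .noNbr v v v v ⟨hv, hN⟩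
  · exact h .oneNbr v c v v ⟨hv, hN⟩
  · cases hst : st v with
    | undecided => exact h .undecidedTwoNbrs v a b v ⟨hst, hv.2, hN⟩
    | chosen => exact hv.1 hst
    | discarded => exact h .discardedTwoNbrs v a b v ⟨hst, hv.2, hN⟩

theorem isSimple {x : V} (h : IsStuck G st) (hx : st x = .undecided)
    (hdx : HasChosenNbr G st x) : IsSimple G st x := by
  refine ⟨hx, hdx, fun v hxv hv hu => ?_, fun s t hs ht hxs hxt => ?_⟩
  · cases hst : st v with
    | undecided => exact hv hst
    | chosen => exact hu.1 hst
    | discarded => exact h .undominatedNbr x v x x ⟨hx, hdx, hst, hu.2, hxv⟩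
  · by_contra hlinked
    exact h .notLinked x s t x ⟨hx, hs, ht, hxs, hxt, hlinked⟩

theorem not_hasOneNbr {x y : V} (h : IsStuck G st) (hx : IsSimple G st x) :
    ¬ Rule.HasOneNbr G st x y := fun hN => by
  by_cases hdy : HasChosenNbr G st y
  · exact h .simpleDominatedNbr x y x x ⟨hx, hN, hdy⟩
  · obtain ⟨w, hw, hyw, hwx, -⟩ := h.exists_nbr ⟨by simp [hN.1], hdy⟩ x x
    exact h .simpleUndominatedNbr x y x w ⟨hx, hN, hw, hyw, hwx⟩

theorem hasChosenNbr_right {x y z : V} (h : IsStuck G st) (hx : IsSimple G st x)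
    (hN : Rule.HasTwoNbrs G st x y z) (hdy : HasChosenNbr G st y) : HasChosenNbr G st z := by
  by_contra hdz
  obtain ⟨w, hw, hzw, hwx, hwy⟩ := h.exists_nbr ⟨by simp [hN.2.1], hdz⟩ x y
  exact h .simpleMixedNbrs x y z w ⟨hx, hN, hdy, hw, hzw, hwx, hwy⟩

theorem not_hasTwoNbrs {x y z : V} (h : IsStuck G st) (hx : IsSimple G st x) :
    ¬ Rule.HasTwoNbrs G st x y z := fun hN => by
  have ⟨hy, hz, hyz, hxy, hxz, hN₂⟩ := hN
  have hN' : Rule.HasTwoNbrs G st x z y :=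
    ⟨hz, hy, hyz.symm, hxz, hxy, fun u hu hxu => (hN₂ u hu hxu).symm⟩
  by_cases hdy : HasChosenNbr G st y
  · exact h .simpleDominatedNbrs x y z x ⟨hx, hN, hdy, h.hasChosenNbr_right hx hN hdy⟩
  have hdz : ¬ HasChosenNbr G st z := mt (h.hasChosenNbr_right hx hN') hdy
  obtain ⟨w, hw, hyw, hwx, hwz⟩ := h.exists_nbr ⟨by simp [hN.1], hdy⟩ x z
  by_cases hzw : G.Adj z w
  · exact h .simpleCommonNbr x y z w ⟨hx, hN, hw, hyw, hwx, hzw⟩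
  · exact h .simpleDistinctNbrs x y z w ⟨hx, hN, hw, hyw, hwx, hwz, hzw,
      h.exists_nbr ⟨by simp [hN.2.1], hdz⟩ x y⟩

end IsStuck

/-- The vertices to be decided or dominated span a 2-degenerate graph, so one of them, `x`, has at
most two undecided neighbours. -/
theorem IsDegenerate.not_isStuck [Fintype V] (hG : IsDegenerate G 2)
    (hst : ∃ v, st v = .undecided) : ¬ IsStuck G st := fun h => by
  obtain ⟨x, hx, a, b, hab⟩ := hG.exists_neighbors_subset_pair
    (W := {v | st v = .undecided ∨ Undominated G st v}) (hst.imp fun _ h => .inl h)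
  have hN : ForallUndecidedNbr G st x fun u => u = a ∨ u = b := fun u hu hxu => hab u (.inl hu) hxu
  have hdom : ¬ Undominated G st x := fun hu => by
    obtain ⟨c, hc, hxc, hca, hcb⟩ := h.exists_nbr hu a b
    exact (hN c hc hxc).elim hca hcb
  have hx0 : st x = .undecided := hx.resolve_right hdom
  have hx : IsSimple G st x := h.isSimple hx0 (by_contra fun hd => hdom ⟨by simp [hx0], hd⟩)
  rcases hN.eq_empty_or_singleton_or_pair with hN | ⟨c, hN⟩ | hN
  · exact h .simpleNoNbr x x x x ⟨hx, hN⟩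
  · exact h.not_hasOneNbr hx hN
  · exact h.not_hasTwoNbrs hx hN

end Stuck

/-! ## Branching numbers -/

/-- A number slightly below `1.9767` that is not smaller than any of the branching numbers; the gap
absorbs polynomial factors. -/
noncomputable def rate : ℝ := 1.97669

theorem rate_pos : 0 < rate := by norm_num [rate]

theorem one_lt_rate : 1 < rate := by norm_num [rate]

/-- The exponent is `53 / 500`, so bounds on `rate ^ 0.106` are bounds on integer powers. -/
theorem rate_rpow_eq : rate ^ (0.106 : ℝ) = (rate ^ 53) ^ ((500 : ℕ) : ℝ)⁻¹ := by
  rw [← Real.rpow_natCast rate, ← Real.rpow_mul rate_pos.le]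
  norm_num

set_option exponentiation.threshold 1000 in
theorem rate_rpow_le : rate ^ (0.106 : ℝ) ≤ 1.0749036 := by
  rw [rate_rpow_eq, Real.rpow_inv_le_iff_of_pos (by positivity [rate_pos]) (by norm_num)
    (by norm_num), Real.rpow_natCast]
  norm_num [rate]

set_option exponentiation.threshold 1000 in
theorem le_rate_rpow : 1.0749 ≤ rate ^ (0.106 : ℝ) := by
  rw [rate_rpow_eq, Real.le_rpow_inv_iff_of_pos (by norm_num) (by positivity [rate_pos])
    (by norm_num), Real.rpow_natCast]
  norm_num [rate]

theorem rate_rpow_neg_le_of_eq_sub {a : ℝ} (k m : ℕ) (h : a = k - m * 0.106) :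
    rate ^ (-a) ≤ 1.0749036 ^ m / 1.97669 ^ k := by
  rw [h, show -((k : ℝ) - m * 0.106) = 0.106 * m - k by ring, Real.rpow_sub rate_pos,
    Real.rpow_mul rate_pos.le, Real.rpow_natCast, Real.rpow_natCast]
  exact div_le_div_of_nonneg_right (pow_le_pow_left₀ (Real.rpow_nonneg rate_pos.le _)
    rate_rpow_le m) (pow_nonneg rate_pos.le k)

theorem rate_rpow_neg_le_of_eq_add {a : ℝ} (k : ℕ) (h : a = k + 0.106) :
    rate ^ (-a) ≤ 1 / (1.97669 ^ k * 1.0749) := by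
  rw [h, Real.rpow_neg rate_pos.le, Real.rpow_add rate_pos, Real.rpow_natCast, ← one_div]
  exact one_div_le_one_div_of_le (by norm_num)
    (mul_le_mul_of_nonneg_left le_rate_rpow (pow_nonneg rate_pos.le k))

theorem sum_rate_rpow_neg_le_one {r : List ℝ} (hr : r ∈ branchingVectors 0.106 0.106) :
    (r.map fun a => rate ^ (-a)).sum ≤ 1 := by
  have h1 := rate_rpow_neg_le_of_eq_sub (a := 1) 1 0 (by norm_num)
  have h1' := rate_rpow_neg_le_of_eq_sub (a := 1 + 0.106 - 0.106) 1 0 (by norm_num)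
  have h1α := rate_rpow_neg_le_of_eq_add (a := 1 + 0.106) 1 (by norm_num)
  have h2 := rate_rpow_neg_le_of_eq_sub (a := 2) 2 0 (by norm_num)
  have h2α := rate_rpow_neg_le_of_eq_add (a := 2 + 0.106) 2 (by norm_num)
  have h2δ := rate_rpow_neg_le_of_eq_sub (a := 2 - 0.106) 2 1 (by norm_num)
  have h3 := rate_rpow_neg_le_of_eq_sub (a := 3) 3 0 (by norm_num)
  have h3δ := rate_rpow_neg_le_of_eq_sub (a := 3 - 0.106) 3 1 (by norm_num)
  have h3δα := rate_rpow_neg_le_of_eq_sub (a := 3 - 0.106 - 0.106) 3 2 (by norm_num)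
  have h4α := rate_rpow_neg_le_of_eq_sub (a := 4 - 0.106) 4 1 (by norm_num)
  have h4αα := rate_rpow_neg_le_of_eq_sub (a := 4 - 2 * 0.106) 4 2 (by norm_num)
  have h5δα := rate_rpow_neg_le_of_eq_sub (a := 5 - 0.106 - 0.106) 5 2 (by norm_num)
  have h5αα := rate_rpow_neg_le_of_eq_sub (a := 5 - 2 * 0.106) 5 2 (by norm_num)
  norm_num1 at h1 h1' h1α h2 h2α h2δ h3 h3δ h3δα h4α h4αα h5δα h5αα
  simp only [branchingVectors, List.mem_cons, List.not_mem_nil, or_false] at hr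
  rcases hr with rfl | rfl | rfl | rfl | rfl | rfl | rfl | rfl | rfl | rfl <;>
    norm_num only [List.map_cons, List.map_nil, List.sum_cons, List.sum_nil] <;> linarith

theorem exists_branchingNumber {r : List ℝ} (hr : r ∈ branchingVectors 0.106 0.106) :
    ∃ x : ℝ, IsBranchingNumber r x ∧ x < 1.9767 := by
  have hone : (1 : ℝ) ≤ (r.map fun a => (1 : ℝ) ^ (-a)).sum := by
    have : r ≠ [] := by rintro rfl; simp [branchingVectors] at hr
    simpa [Nat.one_le_iff_ne_zero] using this
  have hcont : ContinuousOn (fun x : ℝ => (r.map fun a => x ^ (-a)).sum) (Set.Icc 1 rate) :=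
    continuousOn_list_sum r fun a _ x hx => (Real.continuousAt_rpow_const x (-a)
      (.inl (zero_lt_one.trans_le hx.1).ne')).continuousWithinAt
  obtain ⟨x, hx, hsum⟩ := intermediate_value_Icc' one_lt_rate.le hcont
    (⟨sum_rate_rpow_neg_le_one hr, hone⟩ : (1 : ℝ) ∈ Set.Icc _ _)
  exact ⟨x, ⟨zero_lt_one.trans_le hx.1, hsum⟩, hx.2.trans_lt (by norm_num [rate])⟩

theorem exists_pow_mul_rate_pow_le (k : ℕ) :
    ∃ C : ℝ, ∀ n : ℕ, ((n : ℝ) + 2) ^ k * rate ^ n ≤ C * 1.9767 ^ n := by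
  have hq : |rate / 1.9767| < 1 := by
    rw [abs_of_pos (by norm_num [rate])]; norm_num [rate]
  obtain ⟨B, hB⟩ := ((Filter.tendsto_add_atTop_iff_nat 2).2
    (tendsto_pow_const_mul_const_pow_of_abs_lt_one k hq)).bddAbove_range
  refine ⟨B * (1.9767 / rate) ^ 2, fun n => ?_⟩
  have hn : ((n : ℝ) + 2) ^ k * (rate / 1.9767) ^ (n + 2) ≤ B := by
    simpa using hB ⟨n, rfl⟩
  have hr := rate_pos
  calc ((n : ℝ) + 2) ^ k * rate ^ n
      = ((n : ℝ) + 2) ^ k * (rate / 1.9767) ^ (n + 2) * ((1.9767 / rate) ^ 2 * 1.9767 ^ n) := by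
        rw [div_pow, div_pow, pow_add, pow_add]
        field_simp
    _ ≤ B * ((1.9767 / rate) ^ 2 * 1.9767 ^ n) := by gcongr
    _ = B * (1.9767 / rate) ^ 2 * 1.9767 ^ n := by ring

/-! ## The search tree -/

theorem StrictlyExtends.exists_chosen {V : Type u} {st c : State V} (h : StrictlyExtends c st)
    (hs : ∃ s, st s = .chosen) : ∃ s, c s = .chosen :=
  hs.imp fun s hs => (h.1 s (by simp [hs])).trans hs

theorem exists_toInstance_eq {V : Type u} [Fintype V] (I : BranchInstance V) :
    ∃ st : State V, st.toInstance = I := by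
  classical
  refine ⟨fun v => if v ∈ I.free then .undecided else if v ∈ I.sol then .chosen else .discarded, ?_⟩
  obtain ⟨F, S, hFS⟩ := I
  rw [State.toInstance, BranchInstance.mk.injEq]
  have := @Finset.disjoint_left V F S
  constructor <;> ext v <;> simp only [Finset.mem_filter, Finset.mem_univ, true_and] <;> grind

section Tree

variable {V : Type u} [Fintype V] [DecidableEq V] {G : SimpleGraph V} {st c : State V} {α δ : ℝ}

theorem compatible_toInstance {M : Finset V} : st.toInstance.Compatible M ↔ Accepts st M := by
  simp only [BranchInstance.Compatible, Accepts, Finset.subset_iff, Finset.mem_union, mem_sol,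
    mem_free, ← forall_and]
  refine forall_congr' fun v => and_congr_right fun _ => ?_
  cases st v <;> simp

theorem StrictlyExtends.refines (h : StrictlyExtends c st) :
    c.toInstance.Refines st.toInstance := by
  obtain ⟨hkeep, v, hv, hcv⟩ := h
  refine ⟨Finset.ssubset_iff_of_subset (fun u hu => ?_) |>.2 ⟨v, by simpa, by simpa⟩,
    fun u hu => ?_, fun u hu => ?_⟩
  all_goals
    have := hkeep u
    simp only [Finset.mem_union, mem_sol, mem_free] at *
    grind

theorem StrictlyExtends.card_free_lt {V : Type u} [Fintype V] {st c : State V}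
    (h : StrictlyExtends c st) :
    c.toInstance.free.card < st.toInstance.free.card := by
  classical exact Finset.card_lt_card h.refines.1

theorem GoodStep.covers {cs : List (State V)} (h : GoodStep G α δ st cs) :
    BranchInstance.Covers G (cs.map State.toInstance) st.toInstance := by
  refine ⟨List.forall_mem_map.2 fun c hc => (h.strictlyExtends c hc).refines, fun M hM hst => ?_⟩
  have hcount := h.splits M hM
  rw [if_pos (compatible_toInstance.1 hst)] at hcount
  obtain ⟨c, hc, hcM⟩ := List.countP_pos_iff.1 (hcount ▸ one_pos)
  exact ⟨_, List.mem_map_of_mem hc, compatible_toInstance.2 (by simpa using hcM)⟩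

theorem GoodStep.hasSearchTree {cs : List (State V)} (h : GoodStep G α δ st cs)
    (hcs : ∀ c ∈ cs, HasSearchTree G α δ c.toInstance) : HasSearchTree G α δ st.toInstance := by
  have hcov := h.covers
  rcases h.measure_le with rfl | ⟨c, rfl, hc⟩ | ⟨r, hr, hf⟩
  · exact .discard _ fun M hM hc => by simpa using hcov.2 M hM hc
  · exact .reduce _ _ hcov (by simp only [mu] at hc; linarith) (hcs c (by simp))
  · exact .branch _ _ r hr hcov (List.forall₂_map_left_iff.2 hf) (List.forall_mem_map.2 hcs)

theorem State.hasSearchTree (hα : 0 ≤ α) (hα' : α ≤ 1 / 5) (hδ : 0 ≤ δ) (hδ' : δ ≤ 1 / 5)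
    (hG : IsDegenerate G 2) (st : State V) (hs : ∃ s, st s = .chosen) :
    HasSearchTree G α δ st.toInstance := by
  induction hn : st.toInstance.free.card using Nat.strong_induction_on generalizing st with
  | _ n ih =>
    by_cases hfree : ∃ v, st v = .undecided
    · obtain ⟨ρ, x, y, z, w, h⟩ : ∃ (ρ : Rule) (x y z w : V), ρ.Condition G st x y z w := by
        simpa [IsStuck] using hG.not_isStuck hfree
      let env : ℕ → V | 0 => x | 1 => y | 2 => z | _ => w
      have hstep := Rule.Condition.goodStep (env := env) hα hα' hδ hδ' hs h
      refine hstep.hasSearchTree fun c hc => ?_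
      have hext := hstep.strictlyExtends c hc
      exact ih _ (hn ▸ hext.card_free_lt) c (hext.exists_chosen hs) rfl
    · exact .leaf _ (Finset.eq_empty_of_forall_notMem fun v hv => hfree ⟨v, mem_free.1 hv⟩)

theorem hasSearchTree (hα : 0 ≤ α) (hα' : α ≤ 1 / 5) (hδ : 0 ≤ δ) (hδ' : δ ≤ 1 / 5)
    (hG : IsDegenerate G 2) (I : BranchInstance V) (hI : I.sol.Nonempty) :
    HasSearchTree G α δ I := by
  obtain ⟨st, rfl⟩ := exists_toInstance_eq I
  exact st.hasSearchTree hα hα' hδ hδ' hG (hI.imp fun _ => mem_sol.1)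

end Tree

/-! ## The number of minimal connected dominating sets -/

theorem ncard_le_sum_map_ncard {β γ : Type*} [Finite γ] (f : β → Set γ) {l : List β} {s : Set γ}
    (hs : ∀ a ∈ s, ∃ b ∈ l, a ∈ f b) : s.ncard ≤ (l.map fun b => (f b).ncard).sum := by
  induction l generalizing s with
  | nil => simp [Set.eq_empty_of_forall_notMem fun a ha => by simpa using hs a ha]
  | cons b l ih =>
    rw [List.map_cons, List.sum_cons, ← Set.ncard_inter_add_ncard_sdiff_eq_ncard s (f b)]
    refine add_le_add (Set.ncard_le_ncard Set.inter_subset_right) (ih fun a ha => ?_)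
    simpa [ha.2] using hs a ha.1

theorem sum_rate_rpow_le {β : Type*} {f : β → ℝ} {m : ℝ} {l : List β} {r : List ℝ}
    (h : List.Forall₂ (fun b a => f b ≤ m - a) l r) :
    (l.map fun b => rate ^ f b).sum ≤ rate ^ m * (r.map fun a => rate ^ (-a)).sum := by
  induction h with
  | nil => simp
  | cons h _ ih =>
    simp only [List.map_cons, List.sum_cons, mul_add]
    refine add_le_add ?_ ih
    rw [← Real.rpow_add rate_pos, ← sub_eq_add_neg]
    exact Real.rpow_le_rpow_of_exponent_le one_lt_rate.le h

theorem sum_rate_rpow_le_of_mem_branchingVectors {β : Type*} {f : β → ℝ} {m : ℝ} {l : List β}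
    {r : List ℝ} (hr : r ∈ branchingVectors 0.106 0.106)
    (h : List.Forall₂ (fun b a => f b ≤ m - a) l r) :
    (l.map fun b => rate ^ f b).sum ≤ rate ^ m :=
  (sum_rate_rpow_le h).trans (mul_le_of_le_one_right (Real.rpow_nonneg rate_pos.le _)
    (sum_rate_rpow_neg_le_one hr))

section Compatible

variable {V : Type u} [DecidableEq V] {G : SimpleGraph V}

/-- The minimal connected dominating sets that are compatible with an instance. -/
def compatibleCDSs (G : SimpleGraph V) (I : BranchInstance V) : Set (Finset V) :=
  {M | IsMinimalCDS G M ∧ I.Compatible M}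

theorem compatible_iff_of_free_eq_empty {I : BranchInstance V} (hI : I.free = ∅) {M : Finset V} :
    I.Compatible M ↔ M = I.sol := by
  rw [BranchInstance.Compatible, hI, Finset.union_empty, ← Finset.Subset.antisymm_iff, eq_comm]

theorem ncard_compatibleCDSs_le_sum [Finite V] {I : BranchInstance V}
    {Js : List (BranchInstance V)} (h : BranchInstance.Covers G Js I) :
    ((compatibleCDSs G I).ncard : ℝ) ≤
      (Js.map fun J => ((compatibleCDSs G J).ncard : ℝ)).sum := by
  have hJs : ∀ M ∈ compatibleCDSs G I, ∃ J ∈ Js, M ∈ compatibleCDSs G J := fun M hM =>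
    (h.2 M hM.1 hM.2).imp fun J hJ => ⟨hJ.1, hM.1, hJ.2⟩
  refine (Nat.cast_le.2 (ncard_le_sum_map_ncard _ hJs)).trans_eq ?_
  rw [Nat.cast_list_sum, List.map_map, Function.comp_def]

end Compatible

section Count

variable {V : Type u} [Fintype V] [DecidableEq V] {G : SimpleGraph V} {st : State V} {α δ : ℝ}

theorem HasSearchTree.ncard_compatibleCDSs_le {I : BranchInstance V}
    (h : HasSearchTree G 0.106 0.106 I) :
    ((compatibleCDSs G I).ncard : ℝ) ≤ rate ^ I.measure G 0.106 0.106 := by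
  induction h with
  | leaf I h =>
    have hcard : (compatibleCDSs G I).ncard ≤ 1 :=
      (Set.ncard_le_one_iff (Set.toFinite _)).2 fun hM hN =>
        ((compatible_iff_of_free_eq_empty h).1 hM.2).trans
          ((compatible_iff_of_free_eq_empty h).1 hN.2).symm
    have hmeasure : 0 ≤ I.measure G 0.106 0.106 := by unfold BranchInstance.measure; positivity
    exact (Nat.cast_le_one.2 hcard).trans (Real.one_le_rpow one_lt_rate.le hmeasure)
  | discard I h =>
    have hempty : compatibleCDSs G I = ∅ :=
      Set.eq_empty_of_forall_notMem fun M hM => h M hM.1 hM.2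
    rw [hempty, Set.ncard_empty]
    exact_mod_cast Real.rpow_nonneg rate_pos.le _
  | reduce I J hc hm _ ih =>
    refine (ncard_compatibleCDSs_le_sum hc).trans ?_
    simpa using ih.trans (Real.rpow_le_rpow_of_exponent_le one_lt_rate.le hm)
  | branch I Js r hr hc hm _ ih =>
    exact (ncard_compatibleCDSs_le_sum hc).trans ((List.sum_le_sum ih).trans
      (sum_rate_rpow_le_of_mem_branchingVectors hr hm))

theorem mu_le_card_add (hα : α ≤ 1) (hδ : 0 ≤ δ) :
    mu G α δ st ≤ Fintype.card V + δ * st.toInstance.sol.card := by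
  have hunion : st.toInstance.free.card + (st.toInstance.discardedUndominated G).card ≤
      Fintype.card V := by
    rw [← Finset.card_union_of_disjoint]
    · exact Finset.card_le_univ _
    · exact Finset.disjoint_left.2 fun v hv hv' =>
        by
        simp_all
  have hcomponents : Nat.card (G.induce (chosenSet st)).ConnectedComponent ≤
      st.toInstance.sol.card := by
    refine (Nat.card_le_card_of_surjective (G.induce (chosenSet st)).connectedComponentMk
      Quot.mk_surjective).trans_eq ?_
    rw [← coe_sol, Nat.card_coe_set_eq, Set.ncard_coe_finset]
  rify at hunion hcomponents
  rw [mu_eq]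
  linarith [mul_le_mul_of_nonneg_left hcomponents hδ, mul_le_of_le_one_left
    (Nat.cast_nonneg (st.toInstance.discardedUndominated G).card) hα]

theorem rate_rpow_mu_le_of_sol_eq_singleton {v : V} (hst : st.toInstance.sol = {v}) :
    rate ^ mu G 0.106 0.106 st ≤ rate ^ (Fintype.card V + 1) := by
  rw [← Real.rpow_natCast]
  refine Real.rpow_le_rpow_of_exponent_le one_lt_rate.le
    ((mu_le_card_add (by norm_num) (by norm_num)).trans ?_)
  rw [hst, Finset.card_singleton]
  push_cast
  linarith

end Count

theorem IsDegenerate.ncard_isMinimalCDS_mem_le {V : Type u} [Fintype V] {G : SimpleGraph V}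
    (hG : IsDegenerate G 2) (v : V) :
    ({M | IsMinimalCDS G M ∧ v ∈ M}.ncard : ℝ) ≤ rate ^ (Fintype.card V + 1) := by
  classical
  let st : State V := State.choose (fun _ => .undecided) v
  have hsol : st.toInstance.sol = {v} := by
    ext u
    by_cases h : u = v <;> simp [st, h]
  have hst : {M | IsMinimalCDS G M ∧ v ∈ M} = compatibleCDSs G st.toInstance := by
    ext M
    refine and_congr_right fun _ => ?_
    rw [compatible_toInstance, accepts_choose rfl]
    simp [Accepts]
  rw [hst]
  exact (hasSearchTree (by norm_num) (by norm_num) (by norm_num) (by norm_num) hG _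
    (by simp [hsol])).ncard_compatibleCDSs_le.trans (rate_rpow_mu_le_of_sol_eq_singleton hsol)

theorem exists_ncard_isMinimalCDS_le : ∃ C : ℝ, ∀ (V : Type u) [Fintype V] (G : SimpleGraph V),
    IsDegenerate G 2 →
      ({S : Finset V | IsMinimalCDS G S}.ncard : ℝ) ≤ C * (1.9767 : ℝ) ^ Fintype.card V := by
  obtain ⟨C, hC⟩ := exists_pow_mul_rate_pow_le 1
  refine ⟨rate * C, fun V _ G hG => ?_⟩
  classical
  have hunion : {S | IsMinimalCDS G S} = ⋃ v, {S | IsMinimalCDS G S ∧ v ∈ S} := by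
    ext S
    simpa using fun hS : IsMinimalCDS G S => (isCDS_iff_linked.1 hS.prop).2.1.exists_mem
  have hr := rate_pos
  calc ({S | IsMinimalCDS G S}.ncard : ℝ)
      ≤ ∑ v, ({S | IsMinimalCDS G S ∧ v ∈ S}.ncard : ℝ) := by
        rw [hunion]
        exact_mod_cast Set.ncard_iUnion_le_of_fintype _
    _ ≤ ∑ _v : V, rate ^ (Fintype.card V + 1) :=
        Finset.sum_le_sum fun v _ => hG.ncard_isMinimalCDS_mem_le v
    _ = rate * (Fintype.card V * rate ^ Fintype.card V) := by
        rw [Finset.sum_const, Finset.card_univ, nsmul_eq_mul]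
        ring
    _ ≤ rate * ((Fintype.card V + 2) ^ 1 * rate ^ Fintype.card V) := by
        gcongr
        simp
    _ ≤ rate * (C * 1.9767 ^ Fintype.card V) := mul_le_mul_of_nonneg_left (hC _) hr.le
    _ = rate * C * 1.9767 ^ Fintype.card V := by ring

/-! ## Reasoning about programs -/

open Classical in
/-- The number that represents a truth value. -/
noncomputable def bit (p : Prop) : ℕ := if p then 1 else 0

section Bit

variable {p q : Prop}

@[simp] theorem bit_eq_zero : bit p = 0 ↔ ¬ p := by
  simp [bit]

@[simp] theorem bit_pos : 0 < bit p ↔ p := by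
  simp [Nat.pos_iff_ne_zero]

@[simp] theorem bit_mul_bit : bit p * bit q = bit (p ∧ q) := by
  by_cases hp : p <;> by_cases hq : q <;> simp [bit, hp, hq]

@[simp] theorem ite_one_zero {_ : Decidable p} : (if p then 1 else 0) = bit p := by
  unfold bit
  congr

theorem bit_lt {s : ℕ} (hs : 1 < s) : bit p < s := by
  unfold bit
  split_ifs <;> lia

end Bit

namespace Expr

variable (σ : Store) (e f : Expr) (a k x : ℕ)

@[simp] theorem eval_num : (num k).eval σ = k := rfl

@[simp] theorem eval_var : (var x).eval σ = σ.vars x := rfl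

@[simp] theorem eval_get : (get a e).eval σ = σ.arr a (e.eval σ) := rfl

@[simp] theorem eval_add : (add e f).eval σ = e.eval σ + f.eval σ := rfl

@[simp] theorem eval_sub : (sub e f).eval σ = e.eval σ - f.eval σ := rfl

@[simp] theorem eval_mul : (mul e f).eval σ = e.eval σ * f.eval σ := rfl

@[simp] theorem eval_lt : (lt e f).eval σ = bit (e.eval σ < f.eval σ) := ite_one_zero

@[simp] theorem eval_eq : (eq e f).eval σ = bit (e.eval σ = f.eval σ) := ite_one_zero

end Expr

section Store

variable (σ : Store) (x y a b i j v : ℕ)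

@[simp] theorem Store.setVar_vars :
    (σ.setVar x v).vars y = if y = x then v else σ.vars y := by
  simp [Store.setVar, Function.update_apply]

@[simp] theorem Store.setVar_arr : (σ.setVar x v).arr = σ.arr := rfl

theorem Store.setArr_arr :
    (σ.setArr a i v).arr b j = if b = a ∧ j = i then v else σ.arr b j := by
  by_cases h : b = a
  · subst h
    simp [Store.setArr, Function.update_apply]
  · simp [Store.setArr, h]

end Store

/-- A bound for the number of steps of a program whose loops are repeated at most `n` times. -/
def timeBound (n : ℕ) : Prog → ℕ
  | .skip => 1
  | .assign _ e => e.cost + 1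
  | .put _ i e => i.cost + e.cost + 1
  | .write e => e.cost + 1
  | .seq p q => timeBound n p + timeBound n q
  | .ite e p q => e.cost + 1 + (timeBound n p + timeBound n q)
  | .loop e p => n * (e.cost + 1 + timeBound n p) + (e.cost + 1)

/-- `f` is bounded by a power of `n + 2`. -/
def PolynomiallyBounded (f : ℕ → ℕ) : Prop := ∃ k, ∀ n, f n ≤ (n + 2) ^ k

theorem polynomiallyBounded_const (c : ℕ) : PolynomiallyBounded fun _ => c :=
  ⟨c, fun _ => Nat.lt_two_pow_self.le.trans (Nat.pow_le_pow_left (by lia) c)⟩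

theorem PolynomiallyBounded.id_mul {f : ℕ → ℕ} (hf : PolynomiallyBounded f) :
    PolynomiallyBounded fun n => n * f n := by
  obtain ⟨k, hk⟩ := hf
  refine ⟨k + 1, fun n => ?_⟩
  rw [pow_succ']
  exact Nat.mul_le_mul (by lia) (hk n)

theorem PolynomiallyBounded.add {f g : ℕ → ℕ} (hf : PolynomiallyBounded f)
    (hg : PolynomiallyBounded g) : PolynomiallyBounded fun n => f n + g n := by
  obtain ⟨k, hk⟩ := hf
  obtain ⟨l, hl⟩ := hg
  refine ⟨max k l + 1, fun n => ?_⟩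
  calc f n + g n ≤ (n + 2) ^ max k l + (n + 2) ^ max k l :=
        Nat.add_le_add ((hk n).trans (Nat.pow_le_pow_right (by lia) (le_max_left k l)))
          ((hl n).trans (Nat.pow_le_pow_right (by lia) (le_max_right k l)))
    _ = (n + 2) ^ max k l * 2 := (Nat.mul_two _).symm
    _ ≤ (n + 2) ^ (max k l + 1) := Nat.mul_le_mul_left _ (by lia)

theorem polynomiallyBounded_timeBound (P : Prog) :
    PolynomiallyBounded fun n => timeBound n P := by
  induction P with
  | skip => exact polynomiallyBounded_const 1
  | assign _ e => exact polynomiallyBounded_const _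
  | put _ i e => exact polynomiallyBounded_const _
  | write e => exact polynomiallyBounded_const _
  | seq p q hp hq => exact hp.add hq
  | ite e p q hp hq => exact (polynomiallyBounded_const _).add (hp.add hq)
  | loop e p hp =>
    exact ((polynomiallyBounded_const _).add hp).id_mul.add (polynomiallyBounded_const _)

/-- `P` halts on `σ` within its time bound, in a memory of size `s`, in a store with `Q`. -/
def Does (s n : ℕ) (P : Prog) (σ : Store) (Q : Store → Prop) : Prop :=
  ∃ τ t, Exec s P σ τ t ∧ t ≤ timeBound n P ∧ Q τ

/-- Repeat `P` with the values `0, …, n - 1` in the register `x`, where `n` is in register `0`. -/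
def forLoop (x : ℕ) (P : Prog) : Prog :=
  .seq (.assign x (.num 0))
    (.loop (.lt (.var x) (.var 0)) (.seq P (.assign x (.add (.var x) (.num 1)))))

/-- `J m` is an invariant for the store in which at most `m` repetitions are still to be done. -/
theorem exec_loop {s b : ℕ} {e : Expr} {P : Prog} (J : ℕ → Store → Prop)
    (hdone : ∀ τ, J 0 τ → e.eval τ = 0)
    (hstep : ∀ m τ, J (m + 1) τ → e.eval τ ≠ 0 → ∃ υ t, Exec s P τ υ t ∧ t ≤ b ∧ J m υ) (m : ℕ) :
    ∀ σ, J m σ → ∃ τ t m', Exec s (.loop e P) σ τ t ∧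
      t ≤ m * (e.cost + 1 + b) + (e.cost + 1) ∧ J m' τ ∧ e.eval τ = 0 := by
  induction m with
  | zero => exact fun σ hσ => ⟨σ, _, 0, .loop_done (hdone σ hσ), by lia, hσ, hdone σ hσ⟩
  | succ m ih =>
    intro σ hσ
    by_cases he : e.eval σ = 0
    · exact ⟨σ, _, m + 1, .loop_done he, by lia, hσ, he⟩
    · obtain ⟨τ, t, hexec, ht, hτ⟩ := hstep m σ hσ he
      obtain ⟨υ, t', m', hexec', ht', hυ⟩ := ih τ hτ
      exact ⟨υ, _, m', .loop_step he hexec hexec', by lia, hυ⟩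

namespace Does

variable {s n : ℕ} {σ : Store} {P P' : Prog} {Q Q' : Store → Prop} {e e' : Expr} {x a : ℕ}

theorem mono (h : Does s n P σ Q) (hQ : ∀ τ, Q τ → Q' τ) : Does s n P σ Q' := by
  obtain ⟨τ, t, hexec, ht, hτ⟩ := h
  exact ⟨τ, t, hexec, ht, hQ τ hτ⟩

theorem skip (h : Q σ) : Does s n .skip σ Q := ⟨σ, 1, .skip σ, le_rfl, h⟩

theorem assign (hv : e.eval σ < s) (h : Q (σ.setVar x (e.eval σ))) :
    Does s n (.assign x e) σ Q := ⟨_, _, .assign x e σ hv, le_rfl, h⟩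

theorem put (hi : e.eval σ < s) (hv : e'.eval σ < s)
    (h : Q (σ.setArr a (e.eval σ) (e'.eval σ))) : Does s n (.put a e e') σ Q :=
  ⟨_, _, .put a e e' σ hi hv, le_rfl, h⟩

theorem write (hv : e.eval σ < s) (h : Q (σ.emit (e.eval σ))) :
    Does s n (.write e) σ Q := ⟨_, _, .write e σ hv, le_rfl, h⟩

theorem seq (h : Does s n P σ fun τ => Does s n P' τ Q) : Does s n (.seq P P') σ Q := by
  obtain ⟨τ, t, hexec, ht, υ, t', hexec', ht', hυ⟩ := h
  exact ⟨υ, t + t', .seq hexec hexec', Nat.add_le_add ht ht', hυ⟩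

theorem ite (h : e.eval σ ≠ 0 → Does s n P σ Q) (h' : e.eval σ = 0 → Does s n P' σ Q) :
    Does s n (.ite e P P') σ Q := by
  by_cases he : e.eval σ = 0
  · obtain ⟨τ, t, hexec, ht, hτ⟩ := h' he
    exact ⟨τ, _, .ite_false he hexec, by simp only [timeBound]; lia, hτ⟩
  · obtain ⟨τ, t, hexec, ht, hτ⟩ := h he
    exact ⟨τ, _, .ite_true he hexec, by simp only [timeBound]; lia, hτ⟩

/-- `J m` is an invariant for the store in which `m` repetitions are still to be done. -/
theorem loop (J : ℕ → Store → Prop) (hdone : ∀ τ, J 0 τ → e.eval τ = 0)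
    (hstep : ∀ m τ, J (m + 1) τ → e.eval τ ≠ 0 ∧ Does s n P τ (J m)) (h : J n σ) :
    Does s n (.loop e P) σ (J 0) := by
  obtain ⟨τ, t, m, hexec, ht, hτ, he⟩ :=
    exec_loop J hdone (fun m τ hτ _ => (hstep m τ hτ).2) n σ h
  cases m with
  | zero => exact ⟨τ, t, hexec, ht, hτ⟩
  | succ m => exact absurd he (hstep m τ hτ).1

theorem forLoop (I : ℕ → Store → Prop) (hs : n < s)
    (horder : ∀ i τ, I i τ → τ.vars 0 = n) (hIx : ∀ i τ v, I i τ → I i (τ.setVar x v))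
    (h0 : I 0 σ) (hstep : ∀ (i : Fin n) τ, τ.vars x = (i : ℕ) → I i τ →
      Does s n P τ fun υ => υ.vars x = (i : ℕ) ∧ I ((i : ℕ) + 1) υ) :
    Does s n (forLoop x P) σ (I n) := by
  refine seq (assign (Nat.zero_lt_of_lt hs) ?_)
  refine mono (loop (fun m τ => m ≤ n ∧ τ.vars x = n - m ∧ I (n - m) τ) ?_ ?_ ?_)
    fun τ hτ => hτ.2.2
  · rintro τ ⟨-, hτx, hτ⟩
    simp [horder _ _ hτ, hτx]
  · rintro m τ ⟨hm, hτx, hτ⟩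
    have hlt : n - (m + 1) < n := by lia
    refine ⟨by simp [horder _ _ hτ, hτx]; lia,
      seq ((hstep ⟨n - (m + 1), hlt⟩ τ hτx hτ).mono fun υ hυ => ?_)⟩
    have hsucc : (Expr.add (.var x) (.num 1)).eval υ = n - m := by
      rw [Expr.eval_add, Expr.eval_var, Expr.eval_num, hυ.1]
      lia
    have hpred : n - (m + 1) + 1 = n - m := by lia
    refine assign (by lia) ⟨by lia, by simpa using hsucc, hIx _ _ _ ?_⟩
    simpa only [hpred] using hυ.2
  · exact ⟨le_rfl, by simp, hIx _ _ _ (by simpa using h0)⟩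

end Does

/-- `τ` agrees with `σ` on the registers in `R`, on the array cells in `C`, and on the output. -/
structure Agree (R : ℕ → Prop) (C : ℕ → ℕ → Prop) (σ τ : Store) : Prop where
  vars : ∀ {r}, R r → τ.vars r = σ.vars r
  arr : ∀ {a j}, C a j → τ.arr a j = σ.arr a j
  out : τ.out = σ.out

namespace Agree

variable {R R' : ℕ → Prop} {C C' : ℕ → ℕ → Prop} {σ τ υ : Store}

theorem refl (R : ℕ → Prop) (C : ℕ → ℕ → Prop) (σ : Store) : Agree R C σ σ :=
  ⟨fun _ => rfl, fun _ => rfl, rfl⟩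

theorem trans (h : Agree R C σ τ) (h' : Agree R C τ υ) : Agree R C σ υ :=
  ⟨fun hr => (h'.vars hr).trans (h.vars hr), fun hc => (h'.arr hc).trans (h.arr hc),
    h'.out.trans h.out⟩

theorem mono (h : Agree R C σ τ) (hR : ∀ r, R' r → R r) (hC : ∀ a j, C' a j → C a j) :
    Agree R' C' σ τ :=
  ⟨fun hr => h.vars (hR _ hr), fun hc => h.arr (hC _ _ hc), h.out⟩

theorem setVar {x v : ℕ} (h : Agree R C σ τ) (hx : ¬ R x) : Agree R C σ (τ.setVar x v) := by
  refine ⟨fun {r} hr => ?_, h.arr, h.out⟩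
  have hrx : r ≠ x := fun hrx => hx (hrx ▸ hr)
  rw [Store.setVar_vars, if_neg hrx, h.vars hr]

theorem setArr {a i v : ℕ} (h : Agree R C σ τ) (hi : ¬ C a i) :
    Agree R C σ (τ.setArr a i v) := by
  refine ⟨h.vars, fun {b j} hc => ?_, h.out⟩
  have hne : ¬ (b = a ∧ j = i) := by
    rintro ⟨rfl, rfl⟩
    exact hi hc
  rw [Store.setArr_arr, if_neg hne, h.arr hc]

end Agree

/-! ## Filling rows and matrices -/

/-- The index of the entry `j` of the row `i`, when every row has `n` entries. -/
def rowIdx (i j : Expr) : Expr := .add (.mul i (.var 0)) j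

/-- Set the entries of the row `i` of the array `a` to the value of `e`, which may refer to the
current entry by register `12`. -/
def fillRow (a : ℕ) (i e : Expr) : Prog := forLoop 12 (.put a (rowIdx i (.var 12)) e)

/-- Set the entries of the matrix `k` of the array `a` to the value of `e`, which may refer to the
current row by register `5` and to the current column by register `12`. -/
def fillMatrix (a : ℕ) (k e : Expr) : Prog := forLoop 5 (fillRow a (rowIdx k (.var 5)) e)

/-- The registers and cells that are not affected when a row is filled. -/
abbrev AgreeOffRow (n a b : ℕ) : Store → Store → Prop :=
  Agree (· ≠ 12) fun c j => c ≠ a ∨ j / n ≠ b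

/-- The registers and cells that are not affected when a matrix is filled. -/
abbrev AgreeOffMatrix (n a k : ℕ) : Store → Store → Prop :=
  Agree (fun r => r ≠ 5 ∧ r ≠ 12) fun c j => c ≠ a ∨ j / n / n ≠ k

theorem row_div {n : ℕ} (b : ℕ) (v : Fin n) : (b * n + v) / n = b := by
  rw [mul_comm, Nat.mul_add_div (Fin.pos v), Nat.div_eq_of_lt v.2, add_zero]

theorem row_lt {n s b l : ℕ} (hb : b < l) (hs : l * n ≤ s) (v : Fin n) : b * n + v < s :=
  calc b * n + v < b * n + n := Nat.add_lt_add_left v.2 _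
    _ = (b + 1) * n := (Nat.succ_mul b n).symm
    _ ≤ s := (Nat.mul_le_mul_right n hb).trans hs

section Fill

variable {n s a : ℕ} {σ : Store} {i e : Expr}

/-- While the row is filled, `e` sees both old and new entries. -/
theorem fillRow_does {b l : ℕ} (f : Fin n → ℕ) (hn : σ.vars 0 = n) (hns : n < s) (hb : b < l)
    (hl : l * n ≤ s) (hf : ∀ v, f v < s)
    (he : ∀ τ (v : Fin n), AgreeOffRow n a b σ τ → τ.vars 12 = v →
      (∀ w : Fin n, τ.arr a (b * n + w) = f w ∨ τ.arr a (b * n + w) = σ.arr a (b * n + w)) →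
      i.eval τ = b ∧ e.eval τ = f v) :
    Does s n (fillRow a i e) σ fun τ =>
      AgreeOffRow n a b σ τ ∧ ∀ v : Fin n, τ.arr a (b * n + v) = f v := by
  refine (Does.forLoop (fun m τ => AgreeOffRow n a b σ τ ∧ ∀ w : Fin n, τ.arr a (b * n + w) =
      if (w : ℕ) < m then f w else σ.arr a (b * n + w))
    hns (fun _ τ h => (h.1.vars (by decide)).trans hn)
    (fun _ τ v h => ⟨h.1.setVar (by simp), h.2⟩) ⟨.refl _ _ σ, by simp⟩ ?_).mono
    fun τ h => ⟨h.1, fun v => by rw [h.2, if_pos v.2]⟩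
  rintro v τ hv ⟨hagree, hentry⟩
  obtain ⟨hi, hv'⟩ := he τ v hagree hv fun w => by
    rw [hentry]
    split_ifs
    exacts [.inl rfl, .inr rfl]
  have hidx : (rowIdx i (.var 12)).eval τ = b * n + v := by
    simp [rowIdx, hi, hv, hagree.vars (r := 0) (by decide), hn]
  refine Does.put (hidx ▸ row_lt hb hl v) (hv' ▸ hf v) ?_
  rw [hidx, hv']
  refine ⟨hv, hagree.setArr (by simp [row_div]), fun w => ?_⟩
  rw [Store.setArr_arr, hentry]
  grind

theorem fillMatrix_does {k : ℕ} {kexp : Expr} (f : Fin n → Fin n → ℕ) (hn : σ.vars 0 = n)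
    (hns : n < s) (hk : (k + 1) * n * n ≤ s) (hf : ∀ u v, f u v < s)
    (hkexp : ∀ τ, AgreeOffMatrix n a k σ τ → kexp.eval τ = k)
    (he : ∀ τ (u v : Fin n), AgreeOffMatrix n a k σ τ → τ.vars 5 = u → τ.vars 12 = v →
      (∀ u' v' : Fin n, τ.arr a ((k * n + u') * n + v') = f u' v' ∨
        τ.arr a ((k * n + u') * n + v') = σ.arr a ((k * n + u') * n + v')) → e.eval τ = f u v) :
    Does s n (fillMatrix a kexp e) σ fun τ => AgreeOffMatrix n a k σ τ ∧
      ∀ u v : Fin n, τ.arr a ((k * n + u) * n + v) = f u v := by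
  refine (Does.forLoop (fun m τ => AgreeOffMatrix n a k σ τ ∧ ∀ u v : Fin n,
      τ.arr a ((k * n + u) * n + v) =
        if (u : ℕ) < m then f u v else σ.arr a ((k * n + u) * n + v))
    hns (fun _ τ h => (h.1.vars (by decide)).trans hn)
    (fun _ τ v h => ⟨h.1.setVar (by simp), h.2⟩) ⟨.refl _ _ σ, by simp⟩ ?_).mono
    fun τ h => ⟨h.1, fun u v => by rw [h.2, if_pos u.2]⟩
  rintro u τ hu ⟨hagree, hentry⟩
  have hoff : ∀ {υ}, AgreeOffRow n a (k * n + u) τ υ → AgreeOffMatrix n a k σ υ := fun h =>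
    hagree.trans (h.mono (fun _ => And.right) fun c j => Or.imp_right fun hj hjn =>
      hj (hjn ▸ row_div k u))
  have hother : ∀ {υ} (u' v' : Fin n), u' ≠ u → AgreeOffRow n a (k * n + u) τ υ →
      υ.arr a ((k * n + u') * n + v') = τ.arr a ((k * n + u') * n + v') := by
    intro υ u' v' hu' h
    refine h.arr (.inr ?_)
    rw [row_div]
    lia
  refine (fillRow_does (f u) ((hagree.vars (by decide)).trans hn) hns (row_lt (Nat.lt_succ_self k)
    le_rfl u) hk (hf u) fun υ v hυ hv hrow => ⟨?_, ?_⟩).mono fun υ hυ => ⟨?_, ?_, ?_⟩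
  · simp [rowIdx, hkexp υ (hoff hυ), (hυ.vars (by decide)).trans hu,
      (hoff hυ).vars (r := 0) (by decide), hn]
  · refine he υ u v (hoff hυ) ((hυ.vars (by decide)).trans hu) hv fun u' v' => ?_
    by_cases hu' : u' = u
    · subst hu'
      simpa [hentry] using hrow v'
    · rw [hother u' v' hu' hυ, hentry]
      split_ifs
      exacts [.inl rfl, .inr rfl]
  · exact (hυ.1.vars (by decide)).trans hu
  · exact hoff hυ.1
  · intro u' v'
    by_cases hu' : u' = u
    · subst hu'
      simp [hυ.2]
    · rw [hother u' v' hu' hυ.1, hentry]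
      grind

end Fill

/-! ## Evaluating formulas -/

/-- The number that represents a status in the arrays. -/
def Status.code : Status → ℕ
  | undecided => 0
  | chosen => 1
  | discarded => 2

theorem Status.code_injective : Function.Injective Status.code := by
  rintro (_ | _ | _) (_ | _ | _) <;> simp [Status.code]

theorem Status.code_le (s : Status) : s.code ≤ 2 := by
  cases s <;> decide

/-- The chosen vertices without `k`; all chosen vertices for `k = n`. -/
def chosenAvoiding {n : ℕ} (st : State (Fin n)) (k : ℕ) : Set (Fin n) :=
  {v | st v = .chosen ∧ (v : ℕ) ≠ k}

/-- Registers and arrays of the algorithm: register `0` holds `n` and register `1` the height of the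
stack; at depth `d`, a formula leaves its result in register `2 * d + 3`, and register `2 * d + 4`
holds the variable `d`. Array `0` holds the adjacency matrix, array `1` the stack, one state per
row, array `2` the current state, and array `3` the connection matrices of `HasState`. -/
structure HasGraph {n : ℕ} (G : SimpleGraph (Fin n)) (σ : Store) : Prop where
  order : σ.vars 0 = n
  adj : ∀ u v : Fin n, σ.arr 0 (u * n + v) = bit (G.Adj u v)

/-- The graph and the current state, but not its connection matrices. -/
structure HasStatus {n : ℕ} (G : SimpleGraph (Fin n)) (st : State (Fin n)) (σ : Store) : Prop
    extends HasGraph G σ where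
  status : ∀ v : Fin n, σ.arr 2 v = (st v).code

/-- The graph and the current state, where the connection matrix `k` says which of the chosen
vertices other than `k` are linked. -/
structure HasState {n : ℕ} (G : SimpleGraph (Fin n)) (st : State (Fin n)) (σ : Store) : Prop
    extends HasStatus G st σ where
  connection : ∀ k ≤ n, ∀ u v : Fin n,
    σ.arr 3 ((k * n + u) * n + v) = bit (Linked G (chosenAvoiding st k) u v)

section Agree

variable {n : ℕ} {G : SimpleGraph (Fin n)} {st : State (Fin n)} {R : ℕ → Prop} {C : ℕ → ℕ → Prop}
  {σ τ : Store}

theorem HasGraph.agree (h : HasGraph G σ) (hagree : Agree R C σ τ) (hR : R 0) (hC : ∀ j, C 0 j) :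
    HasGraph G τ :=
  ⟨(hagree.vars hR).trans h.order, fun u v => (hagree.arr (hC _)).trans (h.adj u v)⟩

theorem HasStatus.agree (h : HasStatus G st σ) (hagree : Agree R C σ τ) (hR : R 0)
    (hC : ∀ a j, a = 0 ∨ a = 2 → C a j) : HasStatus G st τ :=
  ⟨h.toHasGraph.agree hagree hR fun j => hC 0 j (.inl rfl),
    fun v => (hagree.arr (hC 2 _ (.inr rfl))).trans (h.status v)⟩

theorem HasState.agree (h : HasState G st σ) (hagree : Agree R C σ τ) (hR : R 0)
    (hC : ∀ a j, a ≠ 1 → C a j) : HasState G st τ :=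
  ⟨h.toHasStatus.agree hagree hR fun a j ha => hC a j (by lia),
    fun k hk u v => (hagree.arr (hC 3 _ (by decide))).trans (h.connection k hk u v)⟩

end Agree

/-- What a search for a number below `n` with the property `p` may leave in a register. -/
def FoundIn {n : ℕ} (p : Fin n → Prop) (r : ℕ) : Prop :=
  (r = 0 ∧ ∀ v, ¬ p v) ∨ ∃ v : Fin n, r = v + 1 ∧ p v

theorem FoundIn.ne_zero_iff {n : ℕ} {p : Fin n → Prop} {r : ℕ} (h : FoundIn p r) :
    r ≠ 0 ↔ ∃ v, p v := by
  rcases h with ⟨rfl, h⟩ | ⟨v, rfl, h⟩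
  · simpa using h
  · simpa using ⟨v, h⟩

/-- Search for a value of the variable `d` for which `P` leaves a non-zero result. -/
def searchProg (d : ℕ) (P : Prog) : Prog :=
  .seq (.assign (2 * d + 3) (.num 0)) (forLoop (2 * d + 4) (.seq P
    (.ite (.var (2 * d + 5)) (.assign (2 * d + 3) (.add (.var (2 * d + 4)) (.num 1))) .skip)))

/-- Only the registers of depth at least `d` may differ. -/
abbrev AgreeBelow (d : ℕ) : Store → Store → Prop := Agree (· < 2 * d + 3) fun _ _ => True

theorem searchProg_does {n s d : ℕ} {P : Prog} {σ : Store} (p : Fin n → Prop)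
    (hn : σ.vars 0 = n) (hs : n < s)
    (hP : ∀ (v : Fin n) τ, AgreeBelow d σ τ → τ.vars (2 * d + 4) = v → Does s n P τ fun υ =>
      AgreeBelow (d + 1) τ υ ∧ (υ.vars (2 * d + 5) ≠ 0 ↔ p v)) :
    Does s n (searchProg d P) σ fun τ => AgreeBelow d σ τ ∧ FoundIn p (τ.vars (2 * d + 3)) := by
  refine .seq (.assign (Nat.zero_lt_of_lt hs) ?_)
  refine (Does.forLoop (fun m τ => AgreeBelow d σ τ ∧
      ((τ.vars (2 * d + 3) = 0 ∧ ∀ v : Fin n, v < m → ¬ p v) ∨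
        ∃ v : Fin n, τ.vars (2 * d + 3) = v + 1 ∧ p v)) hs
      (fun _ τ h => (h.1.vars (by lia)).trans hn)
      (fun _ τ v h => ⟨h.1.setVar (by lia), by simpa using h.2⟩)
      ⟨(Agree.refl _ _ σ).setVar (by lia), by simp⟩ ?_).mono
    fun τ h => ⟨h.1, h.2.imp_left <| And.imp_right fun h v => h v v.2⟩
  rintro v τ hv ⟨hagree, hfound⟩
  refine .seq ((hP v τ hagree hv).mono fun υ ⟨hυ, hres⟩ => ?_)
  have hv' : υ.vars (2 * d + 4) = v := (hυ.vars (by lia)).trans hv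
  have hagree' : AgreeBelow d σ υ := hagree.trans (hυ.mono (by lia) fun _ _ => id)
  refine .ite (fun he => .assign (by simp [hv']; lia) ?_) fun he => .skip ?_
  · exact ⟨by simpa using hv', hagree'.setVar (by lia), .inr ⟨v, by simp [hv'], hres.1 he⟩⟩
  · refine ⟨hv', hagree', ?_⟩
    rw [hυ.vars (r := 2 * d + 3) (by lia)]
    refine hfound.imp_left (And.imp_right fun hlt w hw hpw => ?_)
    rcases Nat.lt_succ_iff_lt_or_eq.1 hw with hw | hw
    · exact hlt w hw hpw
    · exact hres.2 (Fin.ext hw ▸ hpw) he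

/-- The entry `(i, j)` of the connection matrix `k`. -/
def connEntry (k i j : Expr) : Expr := .get 3 (rowIdx (rowIdx k i) j)

/-- The expression for the variable `i` of a formula. -/
abbrev variableExpr (i : ℕ) : Expr := .var (2 * i + 4)

namespace Formula

/-- The program that evaluates a formula at depth `d`. -/
def compile : Formula → ℕ → Prog
  | adj i j, d => .assign (2 * d + 3) (.get 0 (rowIdx (variableExpr i) (variableExpr j)))
  | hasStatus i s, d => .assign (2 * d + 3) (.eq (.get 2 (variableExpr i)) (.num s.code))
  | eq i j, d => .assign (2 * d + 3) (.eq (variableExpr i) (variableExpr j))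
  | linked i j, d => .assign (2 * d + 3) (connEntry (.var 0) (variableExpr i) (variableExpr j))
  | linkedAvoiding k i j, d =>
    .assign (2 * d + 3) (connEntry (variableExpr k) (variableExpr i) (variableExpr j))
  | neg φ, d => .seq (φ.compile d) (.assign (2 * d + 3) (.eq (.var (2 * d + 3)) (.num 0)))
  | and φ ψ, d => .seq (φ.compile d) (.ite (.var (2 * d + 3)) (ψ.compile d) .skip)
  | ex φ, d => searchProg d (φ.compile (d + 1))

end Formula

/-- The registers hold the variables of a formula at depth `d`. -/
def HasEnv {n : ℕ} (d : ℕ) (env : ℕ → Fin n) (σ : Store) : Prop :=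
  ∀ i < d, σ.vars (2 * i + 4) = env i

section Compile

variable {n : ℕ} {G : SimpleGraph (Fin n)} {st : State (Fin n)} {σ τ : Store} {d : ℕ}
  {env : ℕ → Fin n}

theorem HasState.agreeBelow (h : HasState G st σ) (hagree : AgreeBelow d σ τ) :
    HasState G st τ := h.agree hagree (by lia) fun _ _ _ => trivial

theorem HasEnv.agreeBelow {d' : ℕ} (h : HasEnv d env σ) (hagree : AgreeBelow d' σ τ)
    (hd : d ≤ d') : HasEnv d env τ :=
  fun i hi => (hagree.vars (by lia)).trans (h i hi)

theorem HasEnv.update {v : Fin n} (h : HasEnv d env σ) (hv : σ.vars (2 * d + 4) = v) :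
    HasEnv (d + 1) (Function.update env d v) σ := fun i hi => by
  rcases Nat.lt_succ_iff_lt_or_eq.1 hi with hi | rfl
  · rw [Function.update_of_ne hi.ne, h i hi]
  · rw [Function.update_self, hv]

theorem chosenAvoiding_order : chosenAvoiding st n = chosenSet st := by
  ext v
  simp [chosenAvoiding, chosenSet, v.2.ne]

theorem chosenAvoiding_val (k : Fin n) : chosenAvoiding st k = chosenSet st \ {k} := by
  ext v
  simp [chosenAvoiding, chosenSet, Fin.ext_iff]

theorem HasState.eval_connEntry {i j k : Expr} {u v : Fin n} (h : HasState G st σ)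
    (hk : k.eval σ ≤ n) (hi : i.eval σ = u) (hj : j.eval σ = v) :
    (connEntry k i j).eval σ = bit (Linked G (chosenAvoiding st (k.eval σ)) u v) := by
  simp [connEntry, rowIdx, hi, hj, h.order, h.connection _ hk]

namespace Formula

/-- `P` leaves a truth value of `p` in the register for depth `d`. -/
def Decides (s n d : ℕ) (P : Prog) (σ : Store) (p : Prop) : Prop :=
  Does s n P σ fun τ => AgreeBelow d σ τ ∧ (τ.vars (2 * d + 3) ≠ 0 ↔ p)

theorem decides_assign {s : ℕ} {e : Expr} {p : Prop} (hs : 2 < s) (he : e.eval σ = bit p) :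
    Decides s n d (.assign (2 * d + 3) e) σ p :=
  .assign (he ▸ bit_lt (by lia)) ⟨(Agree.refl _ _ σ).setVar (by lia), by simp [he]⟩

theorem Decides.neg {s : ℕ} {P : Prog} {p : Prop} (hs : 2 < s) (h : Decides s n d P σ p) :
    Decides s n d (.seq P (.assign (2 * d + 3) (.eq (.var (2 * d + 3)) (.num 0)))) σ (¬ p) := by
  refine .seq (h.mono fun τ hτ => .assign ?_ ⟨hτ.1.setVar (by lia), ?_⟩)
  · rw [Expr.eval_eq]
    exact bit_lt (one_lt_two.trans hs)
  · simp [← hτ.2]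

theorem Decides.and {s : ℕ} {P Q : Prog} {p q : Prop} (h : Decides s n d P σ p)
    (h' : ∀ τ, AgreeBelow d σ τ → Decides s n d Q τ q) :
    Decides s n d (.seq P (.ite (.var (2 * d + 3)) Q .skip)) σ (p ∧ q) := by
  refine .seq (h.mono fun τ ⟨hagree, hp⟩ => .ite (fun he => ?_) fun he => .skip ⟨hagree, ?_⟩)
  · refine (h' τ hagree).mono fun υ hυ => ⟨hagree.trans hυ.1, ?_⟩
    rw [hυ.2, and_iff_right (hp.1 he)]
  · exact iff_of_false (not_not.2 he) fun hpq => hp.2 hpq.1 he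

theorem compile_ex_does {s : ℕ} (hs : n < s) {φ : Formula} (hσ : HasState G st σ)
    (henv : HasEnv d env σ)
    (hφ : ∀ {env σ}, HasState G st σ → HasEnv (d + 1) env σ →
      Decides s n (d + 1) (φ.compile (d + 1)) σ (φ.Holds G st (d + 1) env)) :
    Does s n ((ex φ).compile d) σ fun τ => AgreeBelow d σ τ ∧
      FoundIn (fun v => φ.Holds G st (d + 1) (Function.update env d v)) (τ.vars (2 * d + 3)) :=
  searchProg_does _ hσ.order hs fun _ _ hτ hv =>
    hφ (hσ.agreeBelow hτ) ((henv.agreeBelow hτ le_rfl).update hv)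

theorem decides_compile {s : ℕ} (hs : n + 2 < s) {φ : Formula} (hφ : φ.Scoped d)
    (hσ : HasState G st σ) (henv : HasEnv d env σ) :
    Decides s n d (φ.compile d) σ (φ.Holds G st d env) := by
  induction φ generalizing d env σ with
  | adj i j =>
    refine decides_assign (by lia) ?_
    simp [rowIdx, henv i hφ.1, henv j hφ.2, hσ.order, hσ.adj, Holds]
  | hasStatus i s =>
    refine decides_assign (by lia) ?_
    simp [henv i hφ, hσ.status, Status.code_injective.eq_iff, Holds]
  | eq i j =>
    refine decides_assign (by lia) ?_
    simp [henv i hφ.1, henv j hφ.2, Holds, Fin.ext_iff]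
  | linked i j =>
    refine decides_assign (by lia) ?_
    have hk : (Expr.var 0).eval σ = n := hσ.order
    rw [hσ.eval_connEntry (i := variableExpr i) (j := variableExpr j) hk.le (henv i hφ.1)
      (henv j hφ.2), hk, chosenAvoiding_order, Holds]
  | linkedAvoiding k i j =>
    refine decides_assign (by lia) ?_
    have hk : (variableExpr k).eval σ = env k := henv k hφ.1
    rw [hσ.eval_connEntry (i := variableExpr i) (j := variableExpr j) (hk ▸ (env k).2.le)
      (henv i hφ.2.1) (henv j hφ.2.2), hk, chosenAvoiding_val, Holds]
  | neg φ ih => exact (ih hφ hσ henv).neg (by lia)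
  | and φ ψ ihφ ihψ =>
    exact (ihφ hφ.1 hσ henv).and fun τ hτ =>
      ihψ hφ.2 (hσ.agreeBelow hτ) (henv.agreeBelow hτ le_rfl)
  | ex φ ih =>
    exact (compile_ex_does (by lia) hσ henv (ih hφ)).mono fun τ hτ => ⟨hτ.1, hτ.2.ne_zero_iff⟩

end Formula

open Formula

/-- Find values for `k` variables from the variable `d` on that satisfy `φ`. -/
def witnessProg : ℕ → ℕ → Formula → Prog
  | 0, _, _ => .skip
  | k + 1, d, φ => .seq ((ex (ex^[k] φ)).compile d)
      (.seq (.assign (2 * d + 4) (.sub (.var (2 * d + 3)) (.num 1))) (witnessProg k (d + 1) φ))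

theorem Formula.scoped_iterate_ex {k : ℕ} {φ : Formula} :
    (ex^[k] φ).Scoped d ↔ φ.Scoped (d + k) := by
  induction k generalizing d with
  | zero => rfl
  | succ k ih => rw [Function.iterate_succ_apply', Scoped, ih, add_right_comm, add_assoc]

theorem witnessProg_does {s k : ℕ} (hs : n + 2 < s) {φ : Formula} (hφ : φ.Scoped (d + k))
    (hσ : HasState G st σ) (henv : HasEnv d env σ) (h : (ex^[k] φ).Holds G st d env) :
    Does s n (witnessProg k d φ) σ fun τ => AgreeBelow d σ τ ∧
      ∃ env', HasEnv (d + k) env' τ ∧ φ.Holds G st (d + k) env' := by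
  induction k generalizing d env σ with
  | zero => exact .skip ⟨.refl _ _ σ, env, henv, h⟩
  | succ k ih =>
    rw [← Nat.add_assoc, Nat.add_right_comm] at hφ ⊢
    rw [Function.iterate_succ_apply'] at h
    refine .seq ((compile_ex_does (by lia) hσ henv
      (decides_compile hs (scoped_iterate_ex.2 hφ))).mono fun τ hτ => ?_)
    obtain ⟨v, hv, hφv⟩ := hτ.2.resolve_left fun hnone => h.elim hnone.2
    have hval : (Expr.sub (.var (2 * d + 3)) (.num 1)).eval τ = v := by simp [hv]
    have hagree := hτ.1.setVar (x := 2 * d + 4) (v := v) (by lia)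
    refine .seq (.assign (by lia) ?_)
    rw [hval]
    refine (ih hφ (hσ.agreeBelow hagree) ((henv.agreeBelow hagree le_rfl).update (by simp))
      hφv).mono fun υ hυ => ⟨hagree.trans (hυ.1.mono (by lia) fun _ _ => id), hυ.2⟩

end Compile

/-! ## Computing the connections -/

section PathBelow

variable {n : ℕ} {G : SimpleGraph (Fin n)} {T : Set (Fin n)} {u v w : Fin n}

/-- There is a path in `G[T]` whose inner vertices are smaller than `m`: the relation that the
Floyd–Warshall algorithm computes in round `m`. -/
def PathBelow (G : SimpleGraph (Fin n)) (T : Set (Fin n)) : ℕ → Fin n → Fin n → Prop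
  | 0, u, v => u ∈ T ∧ v ∈ T ∧ (u = v ∨ G.Adj u v)
  | m + 1, u, v => PathBelow G T m u v ∨
      ∃ h : m < n, PathBelow G T m u ⟨m, h⟩ ∧ PathBelow G T m ⟨m, h⟩ v

theorem PathBelow.mono {m m' : ℕ} (hm : m ≤ m') (h : PathBelow G T m u v) :
    PathBelow G T m' u v := by
  induction hm with
  | refl => exact h
  | step _ ih => exact .inl ih

theorem pathBelow_succ (w : Fin n) : PathBelow G T (w + 1) u v ↔
    PathBelow G T w u v ∨ PathBelow G T w u w ∧ PathBelow G T w w v := by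
  simp [PathBelow]

theorem pathBelow_succ_left : PathBelow G T (w + 1) w v ↔ PathBelow G T w w v := by
  rw [pathBelow_succ]
  tauto

theorem pathBelow_succ_right : PathBelow G T (w + 1) u w ↔ PathBelow G T w u w := by
  rw [pathBelow_succ]
  tauto

theorem PathBelow.trans {m : ℕ} (hw : (w : ℕ) < m) (h : PathBelow G T m u w)
    (h' : PathBelow G T m w v) : PathBelow G T m u v := by
  induction m generalizing u v w with
  | zero => exact absurd hw (Nat.not_lt_zero _)
  | succ m ih =>
    rcases Nat.lt_succ_iff_lt_or_eq.1 hw with hw | rfl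
    · rcases h with h | ⟨hm, hum, hmw⟩
      · exact h'.imp (ih hw h) fun ⟨hm, hwm, hmv⟩ => ⟨hm, ih hw h hwm, hmv⟩
      · exact .inr ⟨hm, hum, h'.elim (ih hw hmw) fun ⟨_, _, hmv⟩ => hmv⟩
    · exact (pathBelow_succ w).2 (.inr ⟨pathBelow_succ_right.1 h, pathBelow_succ_left.1 h'⟩)

theorem PathBelow.linked {m : ℕ} (h : PathBelow G T m u v) : Linked G T u v := by
  induction m generalizing u v with
  | zero =>
    obtain ⟨hu, hv, rfl | h⟩ := h
    exacts [.refl hu, .of_adj hu hv h]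
  | succ m ih => exact h.elim ih fun ⟨_, h, h'⟩ => (ih h).trans (ih h')

theorem pathBelow_order_iff : PathBelow G T n u v ↔ Linked G T u v := by
  refine ⟨PathBelow.linked, fun h => h.induction (P := PathBelow G T n u) ?_ ?_⟩
  · exact .mono n.zero_le ⟨h.1, h.1, .inl rfl⟩
  · exact fun a b ha hb hab hua => hua.trans a.2 (.mono n.zero_le ⟨ha, hb, .inr hab⟩)

end PathBelow

/-- Is `u` a chosen vertex other than the one in register `4`? -/
def memberExpr (u : Expr) : Expr :=
  .mul (.eq (.get 2 u) (.num Status.chosen.code)) (.eq (.eq u (.var 4)) (.num 0))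

/-- Are `u` and `v` equal or adjacent members of the set of `memberExpr`? -/
def edgeExpr (u v : Expr) : Expr :=
  .mul (.mul (memberExpr u) (memberExpr v))
    (.lt (.num 0) (.add (.eq u v) (.get 0 (rowIdx u v))))

/-- Are `u` and `v` already known to be connected, or connected by the vertex in register `7`? -/
def pivotExpr (u v : Expr) : Expr :=
  .lt (.num 0) (.add (connEntry (.var 4) u v)
    (.mul (connEntry (.var 4) u (.var 7)) (connEntry (.var 4) (.var 7) v)))

/-- Compute the connection matrix whose number is in register `4`. -/
def connMatrixProg : Prog :=
  .seq (fillMatrix 3 (.var 4) (edgeExpr (.var 5) (.var 12)))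
    (forLoop 7 (fillMatrix 3 (.var 4) (pivotExpr (.var 5) (.var 12))))

/-- Compute all connection matrices. -/
def connProg : Prog :=
  .seq (.seq (.assign 4 (.var 0)) connMatrixProg) (forLoop 4 connMatrixProg)

/-- The connection matrix `k` contains the truth values of `B`. -/
def HasMatrix {n : ℕ} (k : ℕ) (B : Fin n → Fin n → Prop) (σ : Store) : Prop :=
  ∀ u v : Fin n, σ.arr 3 ((k * n + u) * n + v) = bit (B u v)

section Connections

variable {n s k : ℕ} {G : SimpleGraph (Fin n)} {st : State (Fin n)} {T : Set (Fin n)} {σ τ : Store}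

theorem HasStatus.eval_memberExpr {i : Expr} {u : Fin n} (h : HasStatus G st σ)
    (hk : σ.vars 4 = k) (hi : i.eval σ = u) :
    (memberExpr i).eval σ = bit (u ∈ chosenAvoiding st k) := by
  simp [memberExpr, hi, hk, h.status, Status.code_injective.eq_iff, chosenAvoiding]

theorem HasStatus.eval_edgeExpr {i j : Expr} {u v : Fin n} (h : HasStatus G st σ)
    (hk : σ.vars 4 = k) (hi : i.eval σ = u) (hj : j.eval σ = v) :
    (edgeExpr i j).eval σ = bit (PathBelow G (chosenAvoiding st k) 0 u v) := by
  simp [edgeExpr, h.eval_memberExpr hk hi, h.eval_memberExpr hk hj, rowIdx, hi, hj, h.order, h.adj,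
    PathBelow, Fin.ext_iff, and_assoc]

/-- In the row and in the column of the pivot, the old and the new entries are the same. -/
theorem eval_pivotExpr {i j : Expr} {u v w : Fin n} (hn : σ.vars 0 = n) (hk : σ.vars 4 = k)
    (hw : σ.vars 7 = w) (hi : i.eval σ = u) (hj : j.eval σ = v)
    (h : ∀ u v : Fin n, σ.arr 3 ((k * n + u) * n + v) = bit (PathBelow G T (w + 1) u v) ∨
      σ.arr 3 ((k * n + u) * n + v) = bit (PathBelow G T w u v)) :
    (pivotExpr i j).eval σ = bit (PathBelow G T (w + 1) u v) := by
  have huw := (h u w).elim (·.trans (congrArg bit (propext pathBelow_succ_right))) id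
  have hwv := (h w v).elim (·.trans (congrArg bit (propext pathBelow_succ_left))) id
  have heval : (pivotExpr i j).eval σ = bit (0 < σ.arr 3 ((k * n + u) * n + v) +
      bit (PathBelow G T w u w ∧ PathBelow G T w w v)) := by
    simp [pivotExpr, connEntry, rowIdx, hn, hk, hw, hi, hj, huw, hwv]
  rw [heval]
  rcases h u v with huv | huv <;> simp [huv, pathBelow_succ]

theorem connMatrixProg_does (hns : n + 2 < s) (hs : (n + 1) * n * n ≤ s) (hσ : HasStatus G st σ)
    (hk : σ.vars 4 = k) (hkn : k ≤ n) :
    Does s n connMatrixProg σ fun τ =>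
      Agree (· < 5) (fun c j => c ≠ 3 ∨ j / n / n ≠ k) σ τ ∧
        HasMatrix k (Linked G (chosenAvoiding st k)) τ := by
  have hks : (k + 1) * n * n ≤ s := le_trans (by gcongr) hs
  have hoff : ∀ {τ υ}, AgreeOffMatrix n 3 k τ υ →
      Agree (· < 5) (fun c j => c ≠ 3 ∨ j / n / n ≠ k) τ υ :=
    fun h => h.mono (by lia) fun _ _ => id
  refine .seq ((fillMatrix_does (kexp := .var 4)
    (fun u v => bit (PathBelow G (chosenAvoiding st k) 0 u v)) hσ.order (by lia) hks
    (fun _ _ => bit_lt (by lia)) (fun τ h => (h.vars (by decide)).trans hk)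
    fun τ u v h hu hv _ => ?_).mono fun τ hτ => ?_)
  · exact (hσ.agree h (by decide) (by lia)).eval_edgeExpr ((h.vars (by decide)).trans hk) hu hv
  refine (Does.forLoop (fun m υ => Agree (· < 5) (fun c j => c ≠ 3 ∨ j / n / n ≠ k) σ υ ∧
      HasMatrix k (PathBelow G (chosenAvoiding st k) m) υ) (by lia)
    (fun _ υ h => (h.1.vars (by decide)).trans hσ.order)
    (fun _ υ v h => ⟨h.1.setVar (by decide), h.2⟩) ⟨hoff hτ.1, hτ.2⟩ ?_).mono
    fun υ h => ⟨h.1, fun u v => (h.2 u v).trans (congrArg bit (propext pathBelow_order_iff))⟩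
  rintro w υ hw ⟨hυ, hmatrix⟩
  have hn : υ.vars 0 = n := (hυ.vars (by decide)).trans hσ.order
  have hk' : υ.vars 4 = k := (hυ.vars (by decide)).trans hk
  refine (fillMatrix_does (kexp := .var 4)
    (fun u v => bit (PathBelow G (chosenAvoiding st k) (w + 1) u v)) hn (by lia) hks
    (fun _ _ => bit_lt (by lia)) (fun ρ h => (h.vars (by decide)).trans hk')
    fun ρ u v h hu hv hentry => ?_).mono
    fun ρ hρ => ⟨(hρ.1.vars (by decide)).trans hw, hυ.trans (hoff hρ.1), hρ.2⟩
  exact eval_pivotExpr ((h.vars (by decide)).trans hn) ((h.vars (by decide)).trans hk')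
    ((h.vars (by decide)).trans hw) hu hv fun u v => (hentry u v).imp_right (·.trans (hmatrix u v))

theorem HasMatrix.agree {k' : ℕ} {B : Fin n → Fin n → Prop} {R : ℕ → Prop}
    (h : HasMatrix k B σ) (hagree : Agree R (fun c j => c ≠ 3 ∨ j / n / n ≠ k') σ τ) (hk : k ≠ k') :
    HasMatrix k B τ :=
  fun u v => (hagree.arr (.inr (by rwa [row_div, row_div]))).trans (h u v)

theorem connProg_does (hns : n + 2 < s) (hs : (n + 1) * n * n ≤ s) (hσ : HasStatus G st σ) :
    Does s n connProg σ fun τ => Agree (· < 4) (fun c _ => c ≠ 3) σ τ ∧ HasState G st τ := by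
  have hmatrix : ∀ {τ k}, Agree (· < 4) (fun c _ => c ≠ 3) σ τ → τ.vars 4 = k → k ≤ n →
      Does s n connMatrixProg τ fun υ => Agree (· < 5) (fun c j => c ≠ 3 ∨ j / n / n ≠ k) τ υ ∧
        Agree (· < 4) (fun c _ => c ≠ 3) σ υ ∧ HasMatrix k (Linked G (chosenAvoiding st k)) υ :=
    fun hτ hk hkn => (connMatrixProg_does hns hs (hσ.agree hτ (by decide) (by lia)) hk hkn).mono
      fun υ h => ⟨h.1, hτ.trans (h.1.mono (by lia) fun _ _ => .inl), h.2⟩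
  refine .seq (.seq (.assign (by simp [hσ.order]; lia)
    ((hmatrix ((Agree.refl _ _ σ).setVar (by decide)) (by simp [hσ.order]) le_rfl).mono ?_)))
  rintro τ ⟨-, hτ, hlast⟩
  refine (Does.forLoop (fun m υ => Agree (· < 4) (fun c _ => c ≠ 3) σ υ ∧
      ∀ k ≤ n, k = n ∨ k < m → HasMatrix k (Linked G (chosenAvoiding st k)) υ) (by lia)
    (fun _ υ h => (h.1.vars (by decide)).trans hσ.order)
    (fun _ υ v h => ⟨h.1.setVar (by decide), h.2⟩) ⟨hτ, by grind⟩ ?_).mono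
    fun υ h => ⟨h.1, hσ.agree h.1 (by decide) (by lia), fun k hk => h.2 k hk (by lia)⟩
  rintro k υ hk ⟨hυ, hdone⟩
  refine (hmatrix hυ hk k.2.le).mono fun ρ ⟨hρ, hagree, hnew⟩ =>
    ⟨(hρ.vars (by decide)).trans hk, hagree, fun k' hk'n hk' => ?_⟩
  by_cases hkk : k' = k
  · exact hkk ▸ hnew
  · exact (hdone k' hk'n (by lia)).agree hρ hkk

end Connections

/-! ## The stack of states -/

/-- The conditional expression: the value of `a` or `b`, according to the truth value `c`. -/
def iteExpr (c a b : Expr) : Expr := .add (.mul c a) (.mul (.eq c (.num 0)) b)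

theorem eval_iteExpr {σ : Store} {c a b : Expr} {p : Prop} [Decidable p]
    (hc : c.eval σ = bit p) :
    (iteExpr c a b).eval σ = if p then a.eval σ else b.eval σ := by
  by_cases hp : p <;> simp [iteExpr, hc, hp, bit]

/-- The expression for the status, after a decision, of the vertex in register `12`, where `e` is
the expression for its status before the decision. -/
def Decision.statusExpr (e : Expr) : Decision → Expr
  | choose i => iteExpr (.eq (.var 12) (variableExpr i)) (.num Status.chosen.code) e
  | discard i => iteExpr (.eq (.var 12) (variableExpr i)) (.num Status.discarded.code) e
  | discardNbrsOf i => iteExpr (.mul (.eq e (.num Status.undecided.code))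
      (.get 0 (rowIdx (variableExpr i) (.var 12)))) (.num Status.discarded.code) e

/-- Push the state that arises from the current state by the decisions `ds`. -/
def pushProg (ds : List Decision) : Prog :=
  .seq (fillRow 1 (.var 1) (ds.foldl Decision.statusExpr (.get 2 (.var 12))))
    (.assign 1 (.add (.var 1) (.num 1)))

/-- Push the states that arise from the current state by the decisions in `branches`. -/
def pushAllProg : List (List Decision) → Prog
  | [] => .skip
  | ds :: branches => .seq (pushProg ds) (pushAllProg branches)

/-- The stack holds the states `l`, the last one on top. -/
structure HasStack {n : ℕ} (l : List (State (Fin n))) (σ : Store) : Prop where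
  height : σ.vars 1 = l.length
  row : ∀ k (h : k < l.length) (v : Fin n), σ.arr 1 (k * n + v) = (l[k] v).code

section Stack

variable {n s : ℕ} {G : SimpleGraph (Fin n)} {st : State (Fin n)} {σ τ : Store}
  {l : List (State (Fin n))} {env : ℕ → Fin n}

theorem HasStack.agree {R : ℕ → Prop} {C : ℕ → ℕ → Prop} (h : HasStack l σ)
    (hagree : Agree R C σ τ) (hR : R 1) (hC : ∀ j, C 1 j) : HasStack l τ :=
  ⟨(hagree.vars hR).trans h.height, fun k hk v => (hagree.arr (hC _)).trans (h.row k hk v)⟩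

theorem HasStack.append_singleton {R : ℕ → Prop} (h : HasStack l σ)
    (hagree : Agree R (fun a j => a ≠ 1 ∨ j / n ≠ l.length) σ τ) (hτ : τ.vars 1 = l.length + 1)
    (hrow : ∀ v : Fin n, τ.arr 1 (l.length * n + v) = (st v).code) : HasStack (l ++ [st]) τ := by
  refine ⟨by simpa using hτ, fun k hk v => ?_⟩
  rw [List.getElem_append]
  split_ifs with hkl
  · rw [hagree.arr (.inr (by rw [row_div]; exact hkl.ne)), h.row k hkl v]
  · obtain rfl : k = l.length := by simp at hk; lia
    simp [hrow]

theorem Decision.eval_statusExpr {e : Expr} {v : Fin n} (d : Decision) (hσ : HasGraph G σ)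
    (henv : HasEnv 4 env σ) (hv : σ.vars 12 = v) (he : e.eval σ = (st v).code) :
    (d.statusExpr e).eval σ = (d.apply G env st v).code := by
  classical
  have henv (i : Fin 4) : σ.vars (2 * i + 4) = env i := henv i i.2
  rcases d with i | i | i
  iterate 2
    rw [statusExpr, eval_iteExpr (p := v = env i) (by simp [hv, henv, Fin.ext_iff])]
    by_cases hvi : v = env i <;> simp [apply, hvi, he]
  · rw [statusExpr, eval_iteExpr (p := st v = .undecided ∧ G.Adj (env i) v)
      (by simp [rowIdx, hv, henv, he, hσ.order, hσ.adj, Status.code_injective.eq_iff])]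
    by_cases hvi : st v = .undecided ∧ G.Adj (env i) v <;> simp [apply, discardNbrs, hvi, he]

theorem eval_foldl_statusExpr {e : Expr} {v : Fin n} (ds : List Decision) (hσ : HasGraph G σ)
    (henv : HasEnv 4 env σ) (hv : σ.vars 12 = v) (he : e.eval σ = (st v).code) :
    (ds.foldl Decision.statusExpr e).eval σ = (applyDecisions G env st ds v).code := by
  induction ds generalizing e st with
  | nil => exact he
  | cons d _ ih => exact ih (d.eval_statusExpr hσ henv hv he)

theorem pushProg_does {ds : List Decision} (hns : n + 2 < s) (hl : (l.length + 1) * (n + 2) ≤ s)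
    (hσ : HasStatus G st σ) (henv : HasEnv 4 env σ) (hstack : HasStack l σ) :
    Does s n (pushProg ds) σ fun τ =>
      Agree (fun r => r ≠ 1 ∧ r ≠ 12) (fun a _ => a ≠ 1) σ τ ∧
        HasStack (l ++ [applyDecisions G env st ds]) τ := by
  refine .seq ((fillRow_does (i := .var 1) (fun v => (applyDecisions G env st ds v).code)
    hσ.order (by lia) (Nat.lt_succ_self l.length) (le_trans (by gcongr; lia) hl)
    (fun v => (Status.code_le _).trans_lt (by lia)) fun τ v hτ hv _ =>
      ⟨(hτ.vars (by decide)).trans hstack.height, ?_⟩).mono fun τ ⟨hτ, hrow⟩ => ?_)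
  · refine eval_foldl_statusExpr ds (hσ.toHasGraph.agree hτ (by decide) (by simp))
      (fun i hi => (hτ.vars (by lia)).trans (henv i hi)) hv ?_
    simp [hv, hτ.arr, hσ.status]
  · have hheight : τ.vars 1 = l.length := (hτ.vars (by decide)).trans hstack.height
    refine .assign (by simp [hheight]; nlinarith) ⟨?_, ?_⟩
    · exact (hτ.mono (fun _ => And.right) fun _ _ => .inl).setVar (by simp)
    · exact hstack.append_singleton ((hτ.mono (R' := fun r => r ≠ 1 ∧ r ≠ 12) (fun _ => And.right)
        fun _ _ => id).setVar (by simp)) (by simp [hheight]) hrow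

theorem pushAllProg_does (branches : List (List Decision)) (hns : n + 2 < s)
    (hl : (l.length + branches.length) * (n + 2) ≤ s) (hσ : HasStatus G st σ)
    (henv : HasEnv 4 env σ) (hstack : HasStack l σ) :
    Does s n (pushAllProg branches) σ fun τ =>
      Agree (fun r => r ≠ 1 ∧ r ≠ 12) (fun a _ => a ≠ 1) σ τ ∧
        HasStack (l ++ branches.map (applyDecisions G env st)) τ := by
  induction branches generalizing l σ with
  | nil => exact .skip ⟨.refl _ _ σ, by simpa using hstack⟩
  | cons ds branches ih =>
    rw [List.length_cons] at hl
    refine .seq ((pushProg_does (ds := ds) hns (le_trans (by gcongr; lia) hl) hσ henv hstack).mono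
      fun τ ⟨hτ, hstack'⟩ => ?_)
    refine (ih (le_trans (by simp; lia) hl) (hσ.agree hτ (by decide) (by lia))
      (fun i hi => (hτ.vars (by lia)).trans (henv i hi)) hstack').mono
      fun υ ⟨hυ, hstack''⟩ => ⟨hτ.trans hυ, by simpa using hstack''⟩

end Stack

/-! ## The search for an applicable rule -/

namespace Rule

/-- All rules, in the order in which they are tried. -/
def all : List Rule :=
  [noNbr, oneNbr, discardedTwoNbrs, undecidedTwoNbrs, undominatedNbr, notLinked, simpleNoNbr,
    simpleDominatedNbr, simpleUndominatedNbr, simpleDominatedNbrs, simpleMixedNbrs, simpleCommonNbr,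
    simpleDistinctNbrs]

theorem mem_all (ρ : Rule) : ρ ∈ all := by
  cases ρ <;> simp [all]

open Formula in
theorem scoped_guard (ρ : Rule) : ρ.guard.Scoped 4 := by
  cases ρ <;>
    simp [guard, oneNbrFormula, twoNbrsFormula, Scoped, conj, Formula.or, forallNbr, dominated,
      undominated, simple]

theorem length_branches_le (ρ : Rule) : ρ.branches.length ≤ 5 := by
  cases ρ <;> decide

theorem holds_iterate_ex_guard {V : Type u} {G : SimpleGraph V} {st : State V} {env : ℕ → V}
    (ρ : Rule) : (Formula.ex^[4] ρ.guard).Holds G st 0 env ↔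
      ∃ x y z w, ρ.Condition G st x y z w := by
  simp [Formula.Holds, holds_guard]

end Rule

/-- Push the branches of the first applicable rule in a list, or run `leaf` if there is none. -/
def branchProg (leaf : Prog) : List Rule → Prog
  | [] => leaf
  | ρ :: rules => .seq ((Formula.ex^[4] ρ.guard).compile 0) (.ite (.var 3)
      (.seq (witnessProg 4 0 ρ.guard) (pushAllProg ρ.branches)) (branchProg leaf rules))

section Branch

variable {n s : ℕ} {G : SimpleGraph (Fin n)} {st : State (Fin n)} {σ : Store} {α δ : ℝ}
  {l : List (State (Fin n))} {leaf : Prog} {Q : Store → Prop}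

theorem branchProg_does (hα : 0 ≤ α) (hα' : α ≤ 1 / 5) (hδ : 0 ≤ δ) (hδ' : δ ≤ 1 / 5)
    (hst : ∃ v, st v = .chosen) (hns : n + 2 < s) (hl : (l.length + 5) * (n + 2) ≤ s)
    (rules : List Rule) (hσ : HasState G st σ) (hstack : HasStack l σ)
    (hbranch : ∀ τ cs, Agree (· = 0) (fun a _ => a ≠ 1) σ τ → GoodStep G α δ st cs →
      HasStack (l ++ cs) τ → Q τ)
    (hleaf : ∀ τ, AgreeBelow 0 σ τ → (∀ ρ ∈ rules, ∀ x y z w, ¬ ρ.Condition G st x y z w) →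
      Does s n leaf τ Q) :
    Does s n (branchProg leaf rules) σ Q := by
  obtain ⟨v, hv⟩ := hst
  induction rules generalizing σ with
  | nil => exact hleaf σ (.refl _ _ σ) (by simp)
  | cons ρ rules ih =>
    have henv : HasEnv 0 (fun _ => v) σ := fun i hi => absurd hi (Nat.not_lt_zero i)
    have hscoped : (Formula.ex^[4] ρ.guard).Scoped 0 :=
      Formula.scoped_iterate_ex.2 ρ.scoped_guard
    refine .seq ((Formula.decides_compile hns hscoped hσ henv).mono fun τ ⟨hτ, hres⟩ => ?_)
    have hσ' := hσ.agreeBelow hτ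
    have hstack' := hstack.agree hτ (by decide) fun _ => trivial
    refine .ite (fun h => .seq ?_) fun h => ?_
    · refine (witnessProg_does hns ρ.scoped_guard hσ' (henv.agreeBelow hτ le_rfl)
        (hres.1 h)).mono fun υ ⟨hυ, env, henv', hguard⟩ => ?_
      have hstack'' := hstack'.agree hυ (by decide) fun _ => trivial
      refine (pushAllProg_does ρ.branches hns (le_trans (by gcongr; exact ρ.length_branches_le) hl)
        (hσ'.agreeBelow hυ).toHasStatus henv' hstack'').mono fun ω ⟨hω, hpushed⟩ => ?_
      refine hbranch ω _ (((hτ.trans hυ).mono ?_ ?_).trans (hω.mono ?_ ?_))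
        (Rule.Condition.goodStep hα hα' hδ hδ' ⟨v, hv⟩ (ρ.holds_guard.1 hguard)) hpushed
      all_goals simp +contextual
    · refine ih hσ' hstack' (fun υ cs hυ => hbranch υ cs ((hτ.mono ?_ ?_).trans hυ)) fun υ hυ hρs =>
        hleaf υ (hτ.trans hυ) (List.forall_mem_cons.2 ⟨fun x y z w hρ => ?_, hρs⟩)
      · simp +contextual
      · simp
      · exact hres.2 (ρ.holds_iterate_ex_guard.2 ⟨x, y, z, w, hρ⟩) h

end Branch

/-! ## Processing a state -/

namespace Formula

/-- The formula, at depth `d`, for `IsCDS`, where `mem i` and `conn i j` express that the variable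
`i` belongs to the set, and that it is linked to `j` in it. -/
def cds (d : ℕ) (mem : ℕ → Formula) (conn : ℕ → ℕ → Formula) : Formula :=
  and (neg (ex (and (neg (mem d)) (neg (ex (and (mem (d + 1)) (adj d (d + 1))))))))
    (and (ex (mem d)) (neg (ex (ex (conj [mem d, mem (d + 1), neg (conn d (d + 1))])))))

/-- The formula, with free variable `0`, for membership in the chosen set without `0`. -/
def chosenNeZero (i : ℕ) : Formula := and (hasStatus i .chosen) (neg (eq i 0))

/-- The sentence that the chosen set is a minimal connected dominating set. -/
def minimalCDS : Formula :=
  and (cds 0 (hasStatus · .chosen) linked)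
    (neg (ex (and (hasStatus 0 .chosen) (cds 1 chosenNeZero (linkedAvoiding 0)))))

theorem scoped_minimalCDS : minimalCDS.Scoped 0 := by
  simp [minimalCDS, cds, chosenNeZero, conj, Scoped]

variable {V : Type u} {G : SimpleGraph V} {st : State V} {env : ℕ → V}

theorem holds_cds {d : ℕ} {S : Finset V} {mem : ℕ → Formula} {conn : ℕ → ℕ → Formula}
    (hmem : ∀ k e, (∀ i < d, e i = env i) → ∀ i, (mem i).Holds G st k e ↔ e i ∈ S)
    (hconn : ∀ k e, (∀ i < d, e i = env i) → ∀ i j, (conn i j).Holds G st k e ↔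
      Linked G S (e i) (e j)) :
    (cds d mem conn).Holds G st d env ↔ IsCDS G S := by
  have h1 (v : V) : ∀ i < d, Function.update env d v i = env i :=
    fun i hi => Function.update_of_ne hi.ne _ _
  have h2 (v w : V) : ∀ i < d, Function.update (Function.update env d v) (d + 1) w i = env i :=
    fun i hi => by rw [Function.update_of_ne (by lia), h1 v i hi]
  simp only [cds, holds_conj, List.forall_mem_cons, Holds, hmem _ _ (h1 _), hmem _ _ (h2 _ _),
    hconn _ _ (h2 _ _), Function.update_self, Function.update_of_ne (Nat.succ_ne_self d).symm,
    isCDS_iff_linked]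
  grind [Finset.Nonempty]

theorem holds_minimalCDS [Fintype V] :
    minimalCDS.Holds G st 0 env ↔ IsMinimalCDS G st.toInstance.sol := by
  classical
  have hcds : (cds 0 (hasStatus · .chosen) linked).Holds G st 0 env ↔
      IsCDS G st.toInstance.sol :=
    holds_cds (fun _ e _ i => by simp [Holds]) fun _ e _ i j => by simp [Holds, coe_sol]
  have herase (v : V) : (cds 1 chosenNeZero (linkedAvoiding 0)).Holds G st 1
      (Function.update env 0 v) ↔ IsCDS G (st.toInstance.sol.erase v) := by
    refine holds_cds (fun _ e he i => ?_) fun _ e he i j => ?_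
    · simp [chosenNeZero, Holds, he 0 one_pos, and_comm]
    · simp [Holds, he 0 one_pos, coe_sol]
  simp [minimalCDS, isMinimalCDS_iff_erase, Holds, hcds, herase]

end Formula

/-- Output the chosen set of the current state. -/
def emitProg : Prog :=
  .seq (forLoop 4 (.write (.eq (.get 2 (.var 4)) (.num Status.chosen.code)))) (.write (.num 2))

/-- Output the chosen set of the current state if it is a minimal connected dominating set. -/
def leafProg : Prog := .seq (Formula.minimalCDS.compile 0) (.ite (.var 3) emitProg .skip)

/-- Pop a state from the stack. -/
def popProg : Prog :=
  .seq (.assign 1 (.sub (.var 1) (.num 1)))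
    (fillRow 2 (.num 0) (.get 1 (rowIdx (.var 1) (.var 12))))

/-- Pop a state from the stack and push the branches of the first applicable rule, if any. -/
def stepProg : Prog := .seq popProg (.seq connProg (branchProg leafProg Rule.all))

section Step

variable {n s : ℕ} {G : SimpleGraph (Fin n)} {st : State (Fin n)} {σ : Store}
  {l : List (State (Fin n))}

theorem HasGraph.withOut (h : HasGraph G σ) (o : List ℕ) : HasGraph G { σ with out := o } :=
  ⟨h.order, h.adj⟩

theorem HasStack.withOut (h : HasStack l σ) (o : List ℕ) : HasStack l { σ with out := o } :=
  ⟨h.height, h.row⟩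

theorem Agree.write {R : ℕ → Prop} {C : ℕ → ℕ → Prop} {τ : Store} {o : List ℕ} {v : ℕ}
    (h : Agree R C { σ with out := o } τ) : Agree R C { σ with out := o ++ [v] } (τ.emit v) :=
  ⟨h.vars, h.arr, by simp [Store.emit, h.out]⟩

theorem emitProg_does (hns : n + 2 < s) (hσ : HasStatus G st σ) :
    Does s n emitProg σ fun τ => Agree (· ≠ 4) (fun _ _ => True)
      { σ with out := σ.out ++ encodeSet st.toInstance.sol } τ := by
  set bits : List ℕ := List.ofFn fun v : Fin n => if v ∈ st.toInstance.sol then 1 else 0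
    with hbits
  refine .seq ((Does.forLoop (fun m τ => Agree (· ≠ 4) (fun _ _ => True)
      { σ with out := σ.out ++ bits.take m } τ) (by lia)
    (fun _ τ h => (h.vars (by decide)).trans hσ.order) (fun _ τ v h => h.setVar (by simp))
    (by simpa using Agree.refl _ _ σ) fun v τ hv hτ => ?_).mono fun τ hτ => ?_)
  · have hbit : (Expr.eq (.get 2 (.var 4)) (.num Status.chosen.code)).eval τ =
        bits[v]'(by simp [hbits]) := by
      simp [hbits, hv, hτ.arr, hσ.status, Status.code_injective.eq_iff]
    refine .write ?_ ⟨hv, ?_⟩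
    · rw [Expr.eval_eq]
      exact bit_lt (by lia)
    · rw [hbit, List.take_add_one, List.getElem?_eq_getElem (by simp [hbits]), ← List.append_assoc]
      exact hτ.write
  · refine .write (by simp; lia) ?_
    rw [List.take_of_length_le (by simp [hbits])] at hτ
    rw [encodeSet, ← hbits, ← List.append_assoc]
    exact hτ.write

open Classical in
theorem leafProg_does (hns : n + 2 < s) (v : Fin n) (hσ : HasState G st σ) :
    Does s n leafProg σ fun τ => Agree (· < 3) (fun _ _ => True)
      { σ with out := σ.out ++
        ([st.toInstance.sol].filter fun M => IsMinimalCDS G M).flatMap encodeSet } τ := by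
  refine .seq ((Formula.decides_compile (env := fun _ => v) hns Formula.scoped_minimalCDS hσ
    fun i hi => absurd hi i.not_lt_zero).mono fun τ ⟨hτ, hres⟩ => ?_)
  rw [Formula.holds_minimalCDS] at hres
  refine .ite (fun h => ?_) fun h => .skip ?_
  · refine (emitProg_does hns (hσ.agreeBelow hτ).toHasStatus).mono fun υ hυ =>
      ⟨fun hr => (hυ.vars (by lia)).trans (hτ.vars (by lia)),
        fun _ => (hυ.arr trivial).trans (hτ.arr trivial), ?_⟩
    simp [hυ.out, hτ.out, hres.1 h]
  · exact ⟨fun hr => hτ.vars (by lia), hτ.arr, by simp [hτ.out, mt hres.2 (not_not.2 h)]⟩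

theorem popProg_does (hns : n + 2 < s) (hl : (l.length + 1) * (n + 2) ≤ s) (hσ : HasGraph G σ)
    (hstack : HasStack (l ++ [st]) σ) : Does s n popProg σ fun τ =>
      HasStatus G st τ ∧ HasStack l τ ∧ τ.out = σ.out := by
  have hheight : (Expr.sub (.var 1) (.num 1)).eval σ = l.length := by simp [hstack.height]
  refine .seq (.assign (by rw [hheight]; nlinarith) ?_)
  rw [hheight]
  set τ := σ.setVar 1 l.length with hτ
  have hagree : Agree (· ≠ 1) (fun _ _ => True) σ τ := (Agree.refl _ _ σ).setVar (by simp)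
  have hgraph : HasGraph G τ := hσ.agree hagree (by decide) fun _ => trivial
  have hstack' : HasStack l τ := by
    refine ⟨by simp [hτ], fun k hk v => ?_⟩
    rw [hagree.arr trivial, hstack.row k (by simp; lia), List.getElem_append_left hk]
  refine (fillRow_does (b := 0) (fun v => (st v).code) hgraph.order (by lia) one_pos (by lia)
    (fun v => (Status.code_le _).trans_lt (by lia)) fun υ v hυ hv _ => ⟨rfl, ?_⟩).mono
    fun υ ⟨hυ, hrow⟩ => ⟨⟨hgraph.agree hυ (by decide) (by simp), fun v => by simpa using hrow v⟩,
      hstack'.agree hυ (by decide) (by simp), hυ.out⟩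
  have horder : υ.vars 0 = n := (hυ.vars (by decide)).trans hgraph.order
  have hlast : σ.arr 1 (l.length * n + v) = (st v).code := by
    simpa using hstack.row l.length (by simp) v
  simp [rowIdx, hv, horder, (hυ.vars (by decide)).trans hstack'.height, hυ.arr, hτ, hlast]

open Classical in
theorem stepProg_does (hs : (n + 5) ^ 3 ≤ s) (hG : IsDegenerate G 2) (hl : l.length ≤ 5 * n)
    (hst : ∃ v, st v = .chosen) (hσ : HasGraph G σ) (hstack : HasStack (l ++ [st]) σ) :
    Does s n stepProg σ fun τ => HasGraph G τ ∧
      ((∃ cs, GoodStep G 0.106 0.106 st cs ∧ HasStack (l ++ cs) τ ∧ τ.out = σ.out) ∨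
        (∀ v, st v ≠ .undecided) ∧ HasStack l τ ∧ τ.out = σ.out ++
          ([st.toInstance.sol].filter fun M => IsMinimalCDS G M).flatMap encodeSet) := by
  have hns : n + 2 < s :=
    (by lia : n + 2 < n + 5).trans_le ((Nat.le_self_pow (by decide) _).trans hs)
  have hls : (l.length + 5) * (n + 2) ≤ s := by nlinarith [Nat.mul_le_mul_right (n + 2) hl]
  refine .seq ((popProg_does hns (by nlinarith) hσ hstack).mono fun τ ⟨hτ, hstackτ, hout⟩ => ?_)
  refine .seq ((connProg_does hns (by nlinarith) hτ).mono fun υ ⟨hυ, hstate⟩ => ?_)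
  have hstackυ : HasStack l υ := hstackτ.agree hυ (by decide) (by simp)
  refine branchProg_does (by norm_num) (by norm_num) (by norm_num) (by norm_num) hst hns hls
    Rule.all hstate hstackυ (fun ω cs hω hcs hpushed => ⟨?_, .inl ⟨cs, hcs, hpushed, ?_⟩⟩)
    fun ω hω hstuck => ?_
  · exact hstate.toHasGraph.agree hω rfl (by simp)
  · rw [hω.out, hυ.out, hout]
  · have hdecided : ∀ v, st v ≠ .undecided := fun v hv =>
      hG.not_isStuck ⟨v, hv⟩ fun ρ => hstuck ρ ρ.mem_all
    have hstateω := hstate.agreeBelow hω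
    have hstackω := hstackυ.agree hω (by decide) fun _ => trivial
    refine (leafProg_does hns hst.choose hstateω).mono fun φ hφ =>
      ⟨?_, .inr ⟨hdecided, ?_, ?_⟩⟩
    · exact (hstateω.toHasGraph.withOut _).agree hφ (by decide) fun _ => trivial
    · exact (hstackω.withOut _).agree hφ (by decide) fun _ => trivial
    · rw [hφ.out, hω.out, hυ.out, hout]

end Step

/-! ## The enumeration algorithm -/

section Weight

variable {V : Type u} [Fintype V] [DecidableEq V] {G : SimpleGraph V} {st : State V}

/-- A potential that bounds the number of states generated from `st`, including `st` itself. The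
subtracted `1` makes it decrease by at least `1` when `st` is replaced by its branches. -/
noncomputable def weight (G : SimpleGraph V) (st : State V) : ℝ :=
  3 * rate ^ mu G 0.106 0.106 st - 1

theorem one_le_rate_rpow_mu : 1 ≤ rate ^ mu G 0.106 0.106 st :=
  Real.one_le_rpow one_lt_rate.le (mu_nonneg (by norm_num) (by norm_num))

theorem one_le_weight : 1 ≤ weight G st := by
  linarith [one_le_rate_rpow_mu (G := G) (st := st), weight.eq_1 G st]

theorem sum_map_weight (cs : List (State V)) : (cs.map (weight G)).sum =
    3 * (cs.map fun c => rate ^ mu G 0.106 0.106 c).sum - cs.length := by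
  induction cs with
  | nil => simp
  | cons c cs ih =>
    simp only [List.map_cons, List.sum_cons, ih, weight, List.length_cons, Nat.cast_add,
      Nat.cast_one]
    ring

theorem sum_map_weight_nonneg (l : List (State V)) : 0 ≤ (l.map (weight G)).sum :=
  List.sum_nonneg (List.forall_mem_map.2 fun _ _ => zero_le_one.trans one_le_weight)

theorem two_le_length_of_mem_branchingVectors {α δ : ℝ} {r : List ℝ}
    (hr : r ∈ branchingVectors α δ) : 2 ≤ r.length := by
  simp only [branchingVectors, List.mem_cons, List.not_mem_nil, or_false] at hr
  rcases hr with rfl | rfl | rfl | rfl | rfl | rfl | rfl | rfl | rfl | rfl <;> simp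

theorem rate_rpow_neg_four_fifths_le : rate ^ (-(4 / 5) : ℝ) ≤ 2 / 3 := by
  have hpow : rate ^ (4 / 5 : ℝ) = (rate ^ 4) ^ (5 : ℝ)⁻¹ := by
    rw [← Real.rpow_natCast rate, ← Real.rpow_mul rate_pos.le]
    norm_num
  have hle : (3 / 2 : ℝ) ≤ rate ^ (4 / 5 : ℝ) := by
    rw [hpow, Real.le_rpow_inv_iff_of_pos (by norm_num) (by positivity [rate_pos]) (by norm_num)]
    norm_num [rate]
  rw [Real.rpow_neg rate_pos.le]
  exact (inv_anti₀ (by norm_num) hle).trans (by norm_num)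

theorem GoodStep.sum_weight_le {cs : List (State V)}
    (h : GoodStep G 0.106 0.106 st cs) :
    (cs.map (weight G)).sum + 1 ≤ weight G st := by
  have hone := one_le_rate_rpow_mu (G := G) (st := st)
  rcases h.measure_le with rfl | ⟨c, rfl, hc⟩ | ⟨r, hr, hf⟩
  · simpa using one_le_weight
  · have hdrop : rate ^ mu G 0.106 0.106 c ≤ rate ^ mu G 0.106 0.106 st * (2 / 3) := by
      refine (Real.rpow_le_rpow_of_exponent_le one_lt_rate.le hc).trans ?_
      rw [sub_eq_add_neg, Real.rpow_add rate_pos]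
      exact mul_le_mul_of_nonneg_left rate_rpow_neg_four_fifths_le (by linarith)
    simp only [weight, List.map_cons, List.map_nil, List.sum_cons, List.sum_nil]
    linarith
  · have hsum := sum_rate_rpow_le_of_mem_branchingVectors hr hf
    have hlen : (2 : ℝ) ≤ cs.length := by
      rw [hf.length_eq]
      exact_mod_cast two_le_length_of_mem_branchingVectors hr
    rw [sum_map_weight, weight]
    linarith

end Weight

theorem accepts_iff_of_forall_ne_undecided {V : Type u} [Fintype V] {st : State V}
    {M : Finset V} (hst : ∀ v, st v ≠ .undecided) : Accepts st M ↔ M = st.toInstance.sol := by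
  classical
  rw [← compatible_toInstance, compatible_iff_of_free_eq_empty]
  exact Finset.eq_empty_of_forall_notMem fun v hv => hst v (mem_free.1 hv)

section Pending

variable {n : ℕ} {G : SimpleGraph (Fin n)} {st : State (Fin n)} {l : List (State (Fin n))}
  {L : List (Finset (Fin n))}

open Classical in
/-- The invariant of the enumeration, for the stack `l` and the list `L` of the sets found so far.
A step at height `k` pops one state and pushes at most five with fewer undecided vertices each, so
`height` persists; it bounds the stack by `5 * n`. -/
structure Pending (G : SimpleGraph (Fin n)) (l : List (State (Fin n)))
    (L : List (Finset (Fin n))) : Prop where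
  height : ∀ k (h : k < l.length), k + 4 * l[k].toInstance.free.card ≤ 5 * n
  chosen : ∀ st ∈ l, ∃ v, st v = .chosen
  found : ∀ M ∈ L, IsMinimalCDS G M
  count : ∀ M, IsMinimalCDS G M → L.count M + l.countP (fun st => Accepts st M) = 1

theorem Pending.height_last (h : Pending G (l ++ [st]) L) :
    l.length + 4 * st.toInstance.free.card ≤ 5 * n := by
  simpa using h.height l.length (by simp)

theorem Pending.height_of_lt (h : Pending G (l ++ [st]) L) {k : ℕ} (hk : k < l.length) :
    k + 4 * l[k].toInstance.free.card ≤ 5 * n := by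
  have hheight := h.height k (by simp; lia)
  rwa [List.getElem_append_left hk] at hheight

theorem Pending.append_of_goodStep {cs : List (State (Fin n))} (h : Pending G (l ++ [st]) L)
    (hcs : GoodStep G 0.106 0.106 st cs) : Pending G (l ++ cs) L where
  height k hk := by
    rcases lt_or_ge k l.length with hkl | hkl
    · simpa only [List.getElem_append_left hkl] using h.height_of_lt hkl
    · rw [List.length_append] at hk
      rw [List.getElem_append_right hkl]
      have hfree := (hcs.strictlyExtends _
        (List.getElem_mem (l := cs) (n := k - l.length) (by lia))).card_free_lt
      have hlast := h.height_last
      have hlen := hcs.length_le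
      lia
  chosen c hc := by
    rcases List.mem_append.1 hc with hc | hc
    · exact h.chosen c (List.mem_append_left _ hc)
    · exact (hcs.strictlyExtends c hc).exists_chosen (h.chosen st (by simp))
  found := h.found
  count M hM := by
    rw [← h.count M hM, List.countP_append, List.countP_append, List.countP_singleton,
      hcs.splits M hM]
    simp

open Classical in
theorem Pending.append_leaf (h : Pending G (l ++ [st]) L) (hst : ∀ v, st v ≠ .undecided) :
    Pending G l (L ++ [st.toInstance.sol].filter fun M => IsMinimalCDS G M) where
  height _ hk := h.height_of_lt hk
  chosen c hc := h.chosen c (List.mem_append_left _ hc)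
  found M hM := by
    rcases List.mem_append.1 hM with hM | hM
    · exact h.found M hM
    · simpa using (List.mem_filter.1 hM).2
  count M hM := by
    rw [← h.count M hM, List.count_append, List.countP_append, List.countP_singleton,
      List.count_filter (by simpa using hM), List.count_singleton]
    simp only [accepts_iff_of_forall_ne_undecided hst, beq_iff_eq, decide_eq_true_eq,
      eq_comm (a := M)]
    lia

theorem Pending.nodup_and_mem_iff (h : Pending G [] L) :
    L.Nodup ∧ ∀ M, M ∈ L ↔ IsMinimalCDS G M := by
  classical
  have hcount : ∀ M, IsMinimalCDS G M → L.count M = 1 := fun M hM => by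
    simpa using h.count M hM
  have hmem : ∀ M, M ∈ L ↔ IsMinimalCDS G M := fun M =>
    ⟨h.found M, fun hM => List.count_pos_iff.1 (hcount M hM ▸ one_pos)⟩
  exact ⟨List.nodup_iff_count_eq_one.2 fun M hM => hcount M ((hmem M).1 hM), hmem⟩

end Pending

section Drain

variable {n s : ℕ} {G : SimpleGraph (Fin n)} {st : State (Fin n)} {σ τ : Store}
  {l : List (State (Fin n))} {L : List (Finset (Fin n))}

/-- Pop and branch on the states on the stack until it is empty. -/
def drainProg : Prog := .loop (.var 1) stepProg

/-- The store represents the graph, a stack of weight at most `N`, and the sets found so far. -/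
def HasPending (G : SimpleGraph (Fin n)) (N : ℕ) (σ : Store) : Prop :=
  ∃ l L, (l.map (weight G)).sum ≤ (N : ℝ) ∧ Pending G l L ∧ HasGraph G σ ∧ HasStack l σ ∧
    σ.out = L.flatMap encodeSet

theorem HasPending.height_eq_zero (h : HasPending G 0 σ) : σ.vars 1 = 0 := by
  obtain ⟨l, L, hweight, -, -, hstack, -⟩ := h
  rw [hstack.height, List.length_eq_zero_iff]
  cases l with
  | nil => rfl
  | cons st l =>
    have hst := one_le_weight (G := G) (st := st)
    have hl := sum_map_weight_nonneg (G := G) l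
    simp only [List.map_cons, List.sum_cons, Nat.cast_zero] at hweight
    linarith

theorem stepProg_does_hasPending (hs : (n + 5) ^ 3 ≤ s) (hG : IsDegenerate G 2) {N : ℕ}
    (h : HasPending G (N + 1) σ) (hσ : σ.vars 1 ≠ 0) :
    Does s n stepProg σ (HasPending G N) := by
  obtain ⟨l, L, hweight, hpending, hgraph, hstack, hout⟩ := h
  rcases List.eq_nil_or_concat' l with rfl | ⟨l, st, rfl⟩
  · exact absurd hstack.height hσ
  · have hst := one_le_weight (G := G) (st := st)
    simp only [List.map_append, List.sum_append, List.map_cons, List.map_nil, List.sum_cons,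
      List.sum_nil, Nat.cast_succ] at hweight
    refine (stepProg_does hs hG (Nat.le_of_add_right_le hpending.height_last)
      (hpending.chosen st (by simp)) hgraph hstack).mono ?_
    rintro τ ⟨hgraph', ⟨cs, hcs, hstack', hout'⟩ | ⟨hdecided, hstack', hout'⟩⟩
    · refine ⟨l ++ cs, L, ?_, hpending.append_of_goodStep hcs, hgraph', hstack', hout'.trans hout⟩
      rw [List.map_append, List.sum_append]
      linarith [hcs.sum_weight_le]
    · refine ⟨l, _, by linarith, hpending.append_leaf hdecided, hgraph', hstack', ?_⟩
      rw [hout', hout, List.flatMap_append]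

theorem exec_drainProg (hs : (n + 5) ^ 3 ≤ s) (hG : IsDegenerate G 2) {N : ℕ}
    (h : HasPending G N σ) : ∃ τ t L, Exec s drainProg σ τ t ∧
      t ≤ N * (timeBound n stepProg + 2) + 2 ∧ Pending G [] L ∧ τ.out = L.flatMap encodeSet := by
  obtain ⟨τ, t, N', hexec, ht, ⟨l, L, -, hpending, -, hstack, hout⟩, hτ⟩ :=
    exec_loop (e := .var 1) (HasPending G) (fun τ hτ => hτ.height_eq_zero)
      (fun N τ hτ he => stepProg_does_hasPending hs hG hτ he) N σ h
  obtain rfl := List.length_eq_zero_iff.1 (hstack.height.symm.trans hτ)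
  refine ⟨τ, t, L, hexec, ht.trans_eq ?_, hpending, hout⟩
  simp only [Expr.cost]
  ring

end Drain

section Start

variable {n s : ℕ} {G : SimpleGraph (Fin n)} {σ : Store}

/-- The state that fixes `v` as the smallest vertex of the solution, so that every set is accepted
by at most one of these states. -/
def startState (v : Fin n) : State (Fin n) := fun u =>
  if u < v then .discarded else if u = v then .chosen else .undecided

theorem accepts_startState {v : Fin n} {M : Finset (Fin n)} :
    Accepts (startState v) M ↔ IsLeast (M : Set (Fin n)) v := by
  simp only [Accepts, startState, IsLeast, mem_lowerBounds, Finset.mem_coe]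
  grind

theorem pending_start : Pending G (List.ofFn startState) [] where
  height k hk := by
    rw [List.length_ofFn] at hk
    have hfree := Finset.card_le_univ (startState ⟨k, hk⟩).toInstance.free
    rw [Fintype.card_fin] at hfree
    rw [List.getElem_ofFn]
    lia
  chosen := (List.forall_mem_ofFn_iff).2 fun v => ⟨v, by simp [startState]⟩
  found := by simp
  count M hM := by
    classical
    obtain ⟨v, hv⟩ : ∃ v, IsLeast (M : Set (Fin n)) v :=
      ⟨M.min' (isCDS_iff_linked.1 hM.prop).2.1, M.isLeast_min' _⟩
    have haccepts : ∀ u, Accepts (startState u) M ↔ u = v := fun u =>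
      accepts_startState.trans ⟨fun h => h.unique hv, fun h => h ▸ hv⟩
    have hcount := List.count_eq_one_of_mem (List.nodup_finRange n) (List.mem_finRange v)
    rw [List.ofFn_eq_map, List.countP_map, List.count_nil, zero_add, ← hcount]
    simp [Function.comp_def, haccepts, List.count, BEq.beq]

theorem weight_startState_le (v : Fin n) : weight G (startState v) ≤ 6 * rate ^ n := by
  have hsol : (startState v).toInstance.sol = {v} := by
    ext u
    simp only [mem_sol, startState, Finset.mem_singleton]
    grind
  have hmu := rate_rpow_mu_le_of_sol_eq_singleton (G := G) hsol
  have hrate : rate ^ (n + 1) ≤ rate ^ n * 2 := by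
    rw [pow_succ]
    exact mul_le_mul_of_nonneg_left (by norm_num [rate]) (pow_nonneg rate_pos.le n)
  rw [Fintype.card_fin] at hmu
  rw [weight]
  linarith

theorem sum_map_weight_startState_le :
    ((List.ofFn (startState (n := n))).map (weight G)).sum ≤ n * (6 * rate ^ n) := by
  refine (List.sum_le_card_nsmul _ (6 * rate ^ n) ?_).trans_eq (by simp)
  exact List.forall_mem_map.2 (List.forall_mem_ofFn_iff.2 weight_startState_le)

/-- Push the states `startState v`. -/
def startProg : Prog :=
  .seq (fillMatrix 1 (.num 0) (iteExpr (.lt (.var 12) (.var 5)) (.num Status.discarded.code)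
    (iteExpr (.eq (.var 12) (.var 5)) (.num Status.chosen.code) (.num Status.undecided.code))))
    (.assign 1 (.var 0))

theorem startProg_does (hs : (n + 5) ^ 3 ≤ s) (hσ : HasGraph G σ) :
    Does s n startProg σ fun τ => HasGraph G τ ∧ HasStack (List.ofFn (startState (n := n))) τ ∧
      τ.out = σ.out := by
  have hns : n + 2 < s :=
    (by lia : n + 2 < n + 5).trans_le ((Nat.le_self_pow (by decide) _).trans hs)
  refine .seq ((fillMatrix_does (k := 0) (fun u v => (startState u v).code) hσ.order (by lia)
    (by nlinarith) (fun u v => (Status.code_le _).trans_lt (by lia)) (fun _ _ => rfl)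
    fun τ u v _ hu hv _ => ?_).mono fun τ ⟨hτ, hrow⟩ => ?_)
  · rw [eval_iteExpr (p := v < u) (by simp [hu, hv]), eval_iteExpr (p := v = u)
      (by simp [hu, hv, Fin.ext_iff]), startState]
    split_ifs <;> rfl
  · have hτ' := hσ.agree hτ (by decide) (by simp)
    refine .assign (by simp [hτ'.order]; lia) ⟨⟨?_, ?_⟩, ⟨?_, fun k hk v => ?_⟩, hτ.out⟩
    · simp [hτ'.order]
    · exact hτ'.adj
    · simp [hτ'.order]
    · rw [List.length_ofFn] at hk
      simpa using hrow ⟨k, hk⟩ v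

theorem hasGraph_inputStore (G : SimpleGraph (Fin n)) : HasGraph G (inputStore G) := by
  classical
  refine ⟨rfl, fun u v => ?_⟩
  refine (if_congr ⟨?_, fun h => ⟨rfl, u, v, rfl, h⟩⟩ rfl rfl :
    _ = if G.Adj u v then 1 else 0).trans ite_one_zero
  rintro ⟨-, u', v', hindex, hadj⟩
  have hu : (u : ℕ) = u' := by rw [← row_div u v, hindex, row_div]
  have hv : (v : ℕ) = v' := by rwa [hu, Nat.add_left_cancel_iff] at hindex
  rwa [Fin.ext hu, Fin.ext hv]

/-- The enumeration algorithm. -/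
def enumProg : Prog := .seq startProg drainProg

theorem enumProg_enumeratesWithin (hs : (n + 5) ^ 3 ≤ s) (hG : IsDegenerate G 2) {N : ℕ} {T : ℝ}
    (hN : n * (6 * rate ^ n) ≤ N)
    (hT : (timeBound n startProg : ℝ) + (N * (timeBound n stepProg + 2) + 2) ≤ T) :
    EnumeratesWithin enumProg G s T := by
  obtain ⟨σ, t, hstart, ht, hgraph, hstack, hout⟩ := startProg_does hs (hasGraph_inputStore G)
  obtain ⟨τ, t', L, hdrain, ht', hpending, hout'⟩ := exec_drainProg hs hG
    ⟨_, [], sum_map_weight_startState_le.trans hN, pending_start, hgraph, hstack, hout⟩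
  obtain ⟨hnodup, hmem⟩ := hpending.nodup_and_mem_iff
  refine ⟨τ, t + t', L, .seq hstart hdrain, le_trans ?_ hT, hnodup, hmem, hout'⟩
  exact_mod_cast Nat.add_le_add ht ht'

end Start

theorem add_ceil_mul_add_le {n a b t₁ t₂ : ℕ} (h₁ : t₁ ≤ (n + 2) ^ a) (h₂ : t₂ ≤ (n + 2) ^ b) :
    (t₁ : ℝ) + (⌈n * (6 * rate ^ n)⌉₊ * (t₂ + 2) + 2) ≤
      (n + 2) ^ a * rate ^ n + 7 * ((n + 2) ^ (b + 1) * rate ^ n) +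
        16 * ((n + 2) ^ 1 * rate ^ n) := by
  have hrate : (1 : ℝ) ≤ rate ^ n := one_le_pow₀ one_lt_rate.le
  have hn : (0 : ℝ) ≤ n := Nat.cast_nonneg n
  have hceil : (⌈n * (6 * rate ^ n)⌉₊ : ℝ) ≤ 7 * ((n + 2) * rate ^ n) := by
    nlinarith [Nat.ceil_lt_add_one (by positivity : 0 ≤ n * (6 * rate ^ n)), hn]
  have ht₁ : (t₁ : ℝ) ≤ (n + 2) ^ a * rate ^ n :=
    (by exact_mod_cast h₁ : (t₁ : ℝ) ≤ (n + 2) ^ a).trans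
      (le_mul_of_one_le_right (by positivity) hrate)
  have ht₂ : (t₂ : ℝ) + 2 ≤ (n + 2) ^ b + 2 := by gcongr; exact_mod_cast h₂
  have htwo : (2 : ℝ) ≤ 2 * ((n + 2) ^ 1 * rate ^ n) := by nlinarith
  have hprod := mul_le_mul hceil ht₂ (by positivity) (by positivity)
  calc (t₁ : ℝ) + (⌈n * (6 * rate ^ n)⌉₊ * (t₂ + 2) + 2)
      ≤ (n + 2) ^ a * rate ^ n + (7 * ((n + 2) * rate ^ n) * ((n + 2) ^ b + 2) +
          2 * ((n + 2) ^ 1 * rate ^ n)) := add_le_add ht₁ (add_le_add hprod htwo)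
    _ = _ := by ring

theorem exists_enumeratesWithin : ∃ (P : Prog) (C : ℝ) (p : Polynomial ℕ),
    ∀ (n : ℕ) (G : SimpleGraph (Fin n)), IsDegenerate G 2 →
      EnumeratesWithin P G (p.eval n) (C * (1.9767 : ℝ) ^ n) := by
  obtain ⟨a, ha⟩ := polynomiallyBounded_timeBound startProg
  obtain ⟨b, hb⟩ := polynomiallyBounded_timeBound stepProg
  obtain ⟨A, hA⟩ := exists_pow_mul_rate_pow_le a
  obtain ⟨B, hB⟩ := exists_pow_mul_rate_pow_le (b + 1)
  obtain ⟨D, hD⟩ := exists_pow_mul_rate_pow_le 1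
  refine ⟨enumProg, A + 7 * B + 16 * D, (.X + 5) ^ 3, fun n G hG =>
    enumProg_enumeratesWithin (by simp) hG (Nat.le_ceil _)
      ((add_ceil_mul_add_le (ha n) (hb n)).trans ?_)⟩
  linarith [hA n, hB n, hD n]

end CDSEnum

theorem mainTheorem2_general :
    (∃ (P : CDSEnum.Prog) (C : ℝ) (p : Polynomial ℕ),
      ∀ (n : ℕ) (G : SimpleGraph (Fin n)), CDSEnum.IsDegenerate G 2 →
        CDSEnum.EnumeratesWithin P G (p.eval n) (C * (1.9767 : ℝ) ^ n)) ∧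
    ((∀ r ∈ CDSEnum.branchingVectors 0.106 0.106,
        ∃ x : ℝ, CDSEnum.IsBranchingNumber r x ∧ x < 1.9767) ∧
      ∀ (V : Type u) [Fintype V] [DecidableEq V] (G : SimpleGraph V), CDSEnum.IsDegenerate G 2 →
        ∀ α δ : ℝ, 0 ≤ α → α ≤ 1 / 5 → 0 ≤ δ → δ ≤ 1 / 5 →
          ∀ I : CDSEnum.BranchInstance V, I.sol.Nonempty → CDSEnum.HasSearchTree G α δ I) ∧
    (∃ C : ℝ, ∀ (V : Type u) [Fintype V] (G : SimpleGraph V), CDSEnum.IsDegenerate G 2 →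
      ({S : Finset V | CDSEnum.IsMinimalCDS G S}.ncard : ℝ) ≤
        C * (1.9767 : ℝ) ^ Fintype.card V) :=
  ⟨CDSEnum.exists_enumeratesWithin,
    ⟨fun _ hr => CDSEnum.exists_branchingNumber hr, fun _ _ _ _ hG _ _ hα hα' hδ hδ' I hI =>
      CDSEnum.hasSearchTree hα hα' hδ hδ' hG I hI⟩,
    CDSEnum.exists_ncard_isMinimalCDS_le⟩

theorem mainTheorem2 :
    -- enumeration in time `O(1.9767 ^ n)` and polynomial space
    (∃ (P : CDSEnum.Prog) (C : ℝ) (p : Polynomial ℕ),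
      ∀ (n : ℕ) (G : SimpleGraph (Fin n)), CDSEnum.IsDegenerate G 2 →
        CDSEnum.EnumeratesWithin P G (p.eval n) (C * (1.9767 : ℝ) ^ n)) ∧
    -- the branching number is attained with the measure given by `α = δ = 0.106`
    ((∀ r ∈ CDSEnum.branchingVectors 0.106 0.106,
        ∃ x : ℝ, CDSEnum.IsBranchingNumber r x ∧ x < 1.9767) ∧
      ∀ (V : Type u) [Fintype V] [DecidableEq V] (G : SimpleGraph V), CDSEnum.IsDegenerate G 2 →
        ∀ (I : CDSEnum.BranchInstance V) (v : V), I.sol = {v} →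
          CDSEnum.HasSearchTree G 0.106 0.106 I) ∧
    -- the number of minimal connected dominating sets
    (∃ C : ℝ, ∀ (V : Type u) [Fintype V] (G : SimpleGraph V), CDSEnum.IsDegenerate G 2 →
      ({S : Finset V | CDSEnum.IsMinimalCDS G S}.ncard : ℝ) ≤
        C * (1.9767 : ℝ) ^ Fintype.card V) := by
  obtain ⟨henum, ⟨hnumber, htree⟩, hcount⟩ := mainTheorem2_general.{u}
  exact ⟨henum, ⟨hnumber, fun V _ _ G hG I v hI => htree V G hG _ _ (by norm_num) (by norm_num)
    (by norm_num) (by norm_num) I (hI ▸ Finset.singleton_nonempty v)⟩, hcount⟩
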